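/- Let $c\in\mathbb{R}$ and let $N^3(c)$ be the three-dimensional space form, i.e. the complete simply connected Riemannian $3$-manifold of constant sectional curvature $c$ (Euclidean $\mathbb{R}^3$ if $c=0$, the round sphere of radius $1/\sqrt{c}$ if $c>0$, the hyperbolic space of curvature $c$ if $c<0$). For an isometric immersion $\psi:(U,g)\to N^3(c)$ of a surface, with unit normal $\eta$, let $A=-\bar\nabla\eta$ be its shape operator, $f=\operatorname{trace}A$ its mean curvature function and $\tau(\psi)=\operatorname{trace}\nabla d\psi$ its tension field; $\psi$ is called biconservative if $\operatorname{div}S_2=0$, where $$S_2(X,Y)=\tfrac12|\tau(\psi)|^2\langle X,Y\rangle+\langle d\psi,\nabla\tau(\psi)\rangle\langle X,Y\rangle-\langle d\psi(X),\nabla_Y\tau(\psi)\rangle-\langle d\psi(Y),\nabla_X\tau(\psi)\rangle .$$ Let $(M,g)$ be a smooth $2$-dimensional Riemannian manifold with Gaussian curvature $K$. Then the following are equivalent. (i) Every point of $M$ has an open neighbourhood $U$ that admits a smooth isometric embedding $\psi:U\to N^3(c)$ which is biconservative and has, for some smooth unit normal field $\eta$, a mean curvature function $f$ with $f>0$ and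 $\nabla f\neq0$ at every point of $U$. (ii) At every point of $M$ one has $c-K>0$ and $\nabla K\neq 0$, and the level curves of $K$ are circles in $M$ (curves of constant geodesic curvature) of curvature $$\kappa=\frac{3|\nabla K|}{8(c-K)}$$ with respect to the unit normal $-\nabla K/|\nabla K|$; that is, along every smooth unit speed curve $\gamma$ (defined on an open interval) on which $K$ is constant, the function $3|\nabla K|/(8(c-K))$ is constant, with value $\kappa$ say, and $\nabla_{\gamma'}\gamma'=-\kappa\,\nabla K/|\nabla K|$. -/

import Mathlib

open Bundle Set
open scoped Manifold ContDiff Topology Matrix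

noncomputable section

namespace Bicons

/-! ### Coordinate geometry on open subsets of the plane -/

/-- The model plane of a surface. -/
abbrev E2 : Type := EuclideanSpace ℝ (Fin 2)

/-- The linear space `ℝ⁴` containing the models of the three-dimensional space forms. -/
abbrev E4 : Type := EuclideanSpace ℝ (Fin 4)

/-- The `i`-th standard basis vector of the plane. -/
def e (i : Fin 2) : E2 := EuclideanSpace.single i 1

/-- The partial derivative `∂ᵢ F`. -/
def partialD {W : Type*} [NormedAddCommGroup W] [NormedSpace ℝ W]
    (i : Fin 2) (F : E2 → W) (x : E2) : W := fderiv ℝ F x (e i)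

/-- Christoffel symbols `Γᵏᵢⱼ = ½ ∑ₗ gᵏˡ (∂ᵢ gⱼₗ + ∂ⱼ gᵢₗ - ∂ₗ gᵢⱼ)` of a coordinate metric `G`. -/
def christoffel (G : E2 → Matrix (Fin 2) (Fin 2) ℝ) (k i j : Fin 2) (x : E2) : ℝ :=
  (1 / 2 : ℝ) * ∑ l, (G x)⁻¹ k l *
    (partialD i (fun y => G y j l) x + partialD j (fun y => G y i l) x
      - partialD l (fun y => G y i j) x)

/-- Components `Rˡₖᵢⱼ` of the curvature tensor, `R(∂ᵢ, ∂ⱼ)∂ₖ = ∑ₗ Rˡₖᵢⱼ ∂ₗ`,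
with `R(X, Y)Z = ∇_X ∇_Y Z - ∇_Y ∇_X Z - ∇_[X,Y] Z`. -/
def curvatureCoeff (G : E2 → Matrix (Fin 2) (Fin 2) ℝ) (l k i j : Fin 2) (x : E2) : ℝ :=
  partialD i (christoffel G l j k) x - partialD j (christoffel G l i k) x
    + ∑ m, (christoffel G l i m x * christoffel G m j k x
      - christoffel G l j m x * christoffel G m i k x)

/-- Gaussian curvature `⟨R(∂₀, ∂₁)∂₁, ∂₀⟩ / det G` of a coordinate metric `G`. -/
def coordGaussCurvature (G : E2 → Matrix (Fin 2) (Fin 2) ℝ) (x : E2) : ℝ :=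
  (∑ l, G x 0 l * curvatureCoeff G l 1 0 1 x) / (G x).det

/-! ### Space forms

`N³(c)` is the hyperplane `y₃ = 0` of Euclidean `ℝ⁴` if `c = 0`, the sphere of radius `1/√c` in
Euclidean `ℝ⁴` if `c > 0`, and the upper sheet of the hyperboloid `⟨y, y⟩ = 1/c` in Minkowski
`ℝ⁴` if `c < 0`, with the Riemannian metric induced by the ambient bilinear form. -/

/-- The ambient bilinear form on `ℝ⁴`: Euclidean for `c ≥ 0`, Lorentzian for `c < 0`. -/
def form (c : ℝ) (x y : E4) : ℝ :=
  x 0 * y 0 + x 1 * y 1 + x 2 * y 2 + (if c < 0 then -1 else 1) * (x 3 * y 3)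

/-- The space form `N³(c)`, the complete simply connected Riemannian three-manifold of constant
sectional curvature `c`, as a subset of `ℝ⁴`. -/
def spaceForm (c : ℝ) : Set E4 :=
  {y | if c = 0 then y 3 = 0 else form c y y = 1 / c ∧ (c < 0 → 0 < y 3)}

/-- The tangent space of `N³(c)` at `y`. -/
def spaceFormTangent (c : ℝ) (y : E4) : Set E4 :=
  {v | if c = 0 then v 3 = 0 else form c v y = 0}

/-- The covariant derivative `∇̄ᵢ V` of `N³(c)` along a map `Ψ` into `N³(c)`, for a field `V` along
`Ψ` tangent to `N³(c)`: the tangential part of the flat derivative `∂ᵢ V`. For `c ≠ 0` the vector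
`Ψ` is normal to `N³(c)` with `⟨Ψ, Ψ⟩ = 1/c`; for `c = 0` the derivative is already tangent. -/
def covAlong (c : ℝ) (Ψ : E2 → E4) (i : Fin 2) (V : E2 → E4) (x : E2) : E4 :=
  partialD i V x - (c * form c (partialD i V x) (Ψ x)) • Ψ x

/-- The tension field `τ(Ψ) = trace ∇dΨ = ∑ gⁱʲ (∇̄ᵢ ∂ⱼΨ - Γᵏᵢⱼ ∂ₖΨ)`. -/
def tension (c : ℝ) (G : E2 → Matrix (Fin 2) (Fin 2) ℝ) (Ψ : E2 → E4) (x : E2) : E4 :=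
  ∑ i, ∑ j, (G x)⁻¹ i j •
    (covAlong c Ψ i (partialD j Ψ) x - ∑ k, christoffel G k i j x • partialD k Ψ x)

/-- Components of the stress-energy tensor of the bienergy,
`S₂(X, Y) = (½|τ|² + ⟨dΨ, ∇τ⟩)⟨X, Y⟩ - ⟨dΨ(X), ∇_Y τ⟩ - ⟨dΨ(Y), ∇_X τ⟩`. -/
def stressBienergy (c : ℝ) (G : E2 → Matrix (Fin 2) (Fin 2) ℝ) (Ψ : E2 → E4)
    (i j : Fin 2) (x : E2) : ℝ :=
  ((1 / 2 : ℝ) * form c (tension c G Ψ x) (tension c G Ψ x)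
      + ∑ k, ∑ l, (G x)⁻¹ k l * form c (partialD k Ψ x) (covAlong c Ψ l (tension c G Ψ) x))
      * G x i j
    - form c (partialD i Ψ x) (covAlong c Ψ j (tension c G Ψ) x)
    - form c (partialD j Ψ x) (covAlong c Ψ i (tension c G Ψ) x)

/-- Components of the divergence of a symmetric two-tensor,
`(div S)ₖ = ∑ gⁱʲ (∂ᵢ Sⱼₖ - Γˡᵢⱼ Sₗₖ - Γˡᵢₖ Sⱼₗ)`. -/
def divTensor (G : E2 → Matrix (Fin 2) (Fin 2) ℝ) (S : Fin 2 → Fin 2 → E2 → ℝ)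
    (k : Fin 2) (x : E2) : ℝ :=
  ∑ i, ∑ j, (G x)⁻¹ i j *
    (partialD i (S j k) x
      - ∑ l, (christoffel G l i j x * S l k x + christoffel G l i k x * S j l x))

/-! ### Riemannian surfaces -/

/-- Smooth Riemannian metrics on a surface. -/
abbrev SurfaceMetric (M : Type*) [TopologicalSpace M] [ChartedSpace E2 M]
    [IsManifold (𝓡 2) ∞ M] : Type _ :=
  ContMDiffRiemannianMetric (𝓡 2) ∞ E2 (fun x : M => TangentSpace (𝓡 2) x)

section Surface

variable {M : Type*} [TopologicalSpace M] [ChartedSpace E2 M] [IsManifold (𝓡 2) ∞ M]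

/-- The coefficients `gᵢⱼ` of `g` in the coordinates of a chart `φ`, as functions of the coordinates. -/
def metricCoeff (g : SurfaceMetric M) (φ : OpenPartialHomeomorph M E2) (x : E2) :
    Matrix (Fin 2) (Fin 2) ℝ :=
  Matrix.of fun i j => g.inner (φ.symm x)
    (mfderiv (𝓡 2) (𝓡 2) φ.symm x (e i)) (mfderiv (𝓡 2) (𝓡 2) φ.symm x (e j))

/-- The Gaussian curvature of `(M, g)` at `p`. -/
def gaussCurvature (g : SurfaceMetric M) (p : M) : ℝ :=
  coordGaussCurvature (metricCoeff g (chartAt E2 p)) (chartAt E2 p p)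

/-- The Gram matrix of `g` on `T_p M`, in the basis of `T_p M` given by `e 0`, `e 1`. -/
def gram (g : SurfaceMetric M) (p : M) : Matrix (Fin 2) (Fin 2) ℝ :=
  Matrix.of fun i j => g.inner p (e i) (e j)

/-- The gradient of a function, `g(∇u, ·) = du`. -/
def grad (g : SurfaceMetric M) (u : M → ℝ) (p : M) : TangentSpace (𝓡 2) p :=
  (WithLp.toLp 2 ((gram g p)⁻¹ *ᵥ fun i => mfderiv (𝓡 2) 𝓘(ℝ, ℝ) u p (e i)) : E2)

/-- The Riemannian norm of a tangent vector. -/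
def gnorm (g : SurfaceMetric M) {p : M} (v : TangentSpace (𝓡 2) p) : ℝ :=
  Real.sqrt (g.inner p v v)

/-- The velocity of a curve in `M`. -/
def velocity (γ : ℝ → M) (t : ℝ) : TangentSpace (𝓡 2) (γ t) :=
  mfderiv 𝓘(ℝ, ℝ) (𝓡 2) γ t (1 : ℝ)

/-- The covariant acceleration `∇_{γ'} γ'` of a curve in `(M, g)`, for the Levi-Civita connection;
its components are `xᵏ'' + Γᵏᵢⱼ xⁱ' xʲ'` in the preferred chart at `γ t`, in which vectors of the
tangent space at `γ t` are expressed. -/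
def acceleration (g : SurfaceMetric M) (γ : ℝ → M) (t : ℝ) : TangentSpace (𝓡 2) (γ t) :=
  let φ := chartAt E2 (γ t)
  let x : ℝ → E2 := fun s => φ (γ s)
  (WithLp.toLp 2 (fun k => deriv (deriv x) t k
    + ∑ i, ∑ j, christoffel (metricCoeff g φ) k i j (x t) * deriv x t i * deriv x t j) : E2)

/-- `γ : (a, b) → M` is a smooth unit speed curve. -/
def IsUnitSpeedOn (g : SurfaceMetric M) (γ : ℝ → M) (a b : ℝ) : Prop :=
  ContMDiffOn 𝓘(ℝ, ℝ) (𝓡 2) ∞ γ (Ioo a b) ∧ ∀ t ∈ Ioo a b, gnorm g (velocity γ t) = 1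

/-- The unit speed curve `γ : (a, b) → M` is an arc of a circle in `(M, g)`, with constant geodesic
curvature `κ` with respect to the unit normal field `ν` along `γ`: `∇_{γ'} γ' = κ ν`. -/
def IsCircleArc (g : SurfaceMetric M) (γ : ℝ → M) (a b κ : ℝ)
    (ν : ∀ t, TangentSpace (𝓡 2) (γ t)) : Prop :=
  IsUnitSpeedOn g γ a b ∧
    ∀ t ∈ Ioo a b, gnorm g (ν t) = 1 ∧ g.inner (γ t) (ν t) (velocity γ t) = 0 ∧
      acceleration g γ t = κ • ν t

/-- Every smooth unit speed parametrisation of an arc of a level curve of `K` is an arc of a circle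
whose (constant) curvature, with respect to the unit normal `-∇K/|∇K|`, is `κ`, where `κ` is the
value at the points of the curve of the given function. -/
def LevelCurvesAreCircles (g : SurfaceMetric M) (K κ : M → ℝ) : Prop :=
  ∀ (γ : ℝ → M) (a b : ℝ), a < b → IsUnitSpeedOn g γ a b →
    (∃ k, ∀ t ∈ Ioo a b, K (γ t) = k) →
    ∃ κ₀ : ℝ, (∀ t ∈ Ioo a b, κ (γ t) = κ₀) ∧
      IsCircleArc g γ a b κ₀ (fun t => -(gnorm g (grad g K (γ t)))⁻¹ • grad g K (γ t))

/-! ### Surfaces in space forms -/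

/-- The differential of a map `M → ℝ⁴` applied to a tangent vector. -/
def diff (ψ : M → E4) (p : M) (v : TangentSpace (𝓡 2) p) : E4 :=
  mfderiv (𝓡 2) 𝓘(ℝ, E4) ψ p v

/-- `ψ` restricts to a smooth isometric embedding of the open set `U` into `N³(c)`. -/
structure IsIsometricEmbeddingOn (g : SurfaceMetric M) (c : ℝ) (ψ : M → E4) (U : Set M) :
    Prop where
  smooth : ContMDiffOn (𝓡 2) 𝓘(ℝ, E4) ∞ ψ U
  mapsTo : MapsTo ψ U (spaceForm c)
  isometric : ∀ p ∈ U, ∀ v w : TangentSpace (𝓡 2) p,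
    form c (diff ψ p v) (diff ψ p w) = g.inner p v w
  embedding : Topology.IsEmbedding (U.domRestrict ψ)

/-- `η` is a smooth unit normal field, tangent to `N³(c)`, of the surface `ψ` on `U`. -/
structure IsUnitNormalOn (c : ℝ) (ψ η : M → E4) (U : Set M) : Prop where
  smooth : ContMDiffOn (𝓡 2) 𝓘(ℝ, E4) ∞ η U
  tangent : ∀ p ∈ U, η p ∈ spaceFormTangent c (ψ p)
  normal : ∀ p ∈ U, ∀ v : TangentSpace (𝓡 2) p, form c (η p) (diff ψ p v) = 0
  unit : ∀ p ∈ U, form c (η p) (η p) = 1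

/-- The second fundamental form `⟨A eᵢ, eⱼ⟩ = -⟨dη(eᵢ), dψ(eⱼ)⟩`, where `A = -∇̄η` is the shape
operator. -/
def secondFundForm (c : ℝ) (ψ η : M → E4) (p : M) : Matrix (Fin 2) (Fin 2) ℝ :=
  Matrix.of fun i j => -form c (diff η p (e i)) (diff ψ p (e j))

/-- The mean curvature function `f = trace A`. -/
def meanCurvature (g : SurfaceMetric M) (c : ℝ) (ψ η : M → E4) (p : M) : ℝ :=
  ((gram g p)⁻¹ * secondFundForm c ψ η p).trace

/-- `ψ` is biconservative on `U`: the stress-energy tensor of the bienergy is divergence free. -/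
def IsBiconservativeOn (g : SurfaceMetric M) (c : ℝ) (ψ : M → E4) (U : Set M) : Prop :=
  ∀ p ∈ U, ∀ k : Fin 2,
    divTensor (metricCoeff g (chartAt E2 p))
      (stressBienergy c (metricCoeff g (chartAt E2 p)) (ψ ∘ (chartAt E2 p).symm))
      k (chartAt E2 p p) = 0

/-- `(M, g)` can be locally isometrically embedded in `N³(c)` as a biconservative surface whose
mean curvature function is positive with nowhere vanishing gradient. -/
def LocallyEmbedsBiconservatively (g : SurfaceMetric M) (c : ℝ) : Prop :=
  ∀ p : M, ∃ U : Set M, IsOpen U ∧ p ∈ U ∧ ∃ ψ η : M → E4,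
    IsIsometricEmbeddingOn g c ψ U ∧ IsUnitNormalOn c ψ η U ∧ IsBiconservativeOn g c ψ U ∧
    ∀ q ∈ U, 0 < meanCurvature g c ψ η q ∧ grad g (meanCurvature g c ψ η) q ≠ 0

end Surface

end Bicons

end

/-! Let f be the mean curvature function of an immersed surface with ∇f ≠ 0, put s = |∇f|, E₁ =
∇f/s, let E₂ be the rotated unit field and θ⁰, θ¹ the dual coframe, so that df = s θ⁰. By Codazzi
the second fundamental form has totally symmetric covariant derivative, which gives div S₂ = 2A(∇f)
+ f∇f (`divTensor_stressBienergy`). Biconservativity therefore says A E₁ = -(f/2) E₁, and the trace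
forces A E₂ = (3f/2) E₂ (`IsSurfaceOn.sff_eq`). In this frame Codazzi becomes dθ⁰ = 0 and dθ¹ = -κ
θ⁰∧θ¹ with κ = 3s/(4f) (`IsSurfaceOn.structure_eq`), and Gauss becomes K = c - 3f²/4
(`IsSurfaceOn.curvature_eq`). Consequently c - K > 0, |∇K| = 3fs/2, E₁ = -∇K/|∇K| and κ = 3|∇K|/(8(c
- K)).

The intrinsic part of these identities is isolated in `IsSpecialOn`, the hinge of the proof. It
implies the circle condition: ddf = 0 and dθ⁰ = 0 make s, hence κ, constant along level curves
(`wedge_eq_zero`), and the equation for dθ¹ says that a unit speed level curve has acceleration κ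
E₁. Conversely, if (ii) holds, define f by K = c - 3f²/4 and take the coframe adapted to df.
Constancy of κ on level curves gives dθ⁰ = 0, and the acceleration of the integral curves of E₂
gives dθ¹ (`LevelCurvesAreCircles.structure_eq`).

A surface is then built from a special metric. Locally θ⁰ = du and f^(3/4) θ¹ = dv are exact and f =
A(u), and the Gauss equation of the metric becomes a Riccati equation for k = 3A'/(4A)
(`IsSpecialOn.exists_profile`). The moving frame (Ψ, E₁, E₂, N), as a 4 × 4 matrix, must satisfy a
linear system whose coefficients depend on u alone. Hence no Frobenius theorem is needed: the frame
is F₀ V(v) R(u), where R solves an ordinary equation in u and V one with constant coefficient. The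
zero curvature equation, which is Gauss and Codazzi, says precisely that the constant coefficient is
carried by R(u) to the required one (`HasDerivEntries.intertwines`, `exists_frame`). Both matrices
preserve a fixed quadratic form, which keeps the frame orthonormal.

Curvature, divergence and acceleration are defined at each point in the preferred chart of that
point, so differentiating them requires transfer to one fixed chart. The invariance of the curvature
is obtained from the structure equations of coframes rather than from the transformation law of
Christoffel symbols. -/

noncomputable section

namespace Bicons

/-! ### Partial derivatives -/

section Calculus

variable {W : Type*} [NormedAddCommGroup W] [NormedSpace ℝ W] {i j : Fin 2} {x : E2}

theorem partialD_congr {F F' : E2 → W} (h : F =ᶠ[𝓝 x] F') : partialD i F x = partialD i F' x := by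
  simp only [partialD, h.fderiv_eq]

theorem partialD_const (w : W) : partialD i (fun _ => w) x = 0 := by
  simp [partialD]

theorem partialD_add {F F' : E2 → W} (hF : DifferentiableAt ℝ F x) (hF' : DifferentiableAt ℝ F' x) :
    partialD i (fun y => F y + F' y) x = partialD i F x + partialD i F' x := by
  simp [partialD, fderiv_fun_add hF hF']

theorem partialD_sub {F F' : E2 → W} (hF : DifferentiableAt ℝ F x) (hF' : DifferentiableAt ℝ F' x) :
    partialD i (fun y => F y - F' y) x = partialD i F x - partialD i F' x := by
  simp [partialD, fderiv_fun_sub hF hF']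

theorem partialD_neg (F : E2 → W) :
    partialD i (fun y => -F y) x = -partialD i F x := by
  simp [partialD, fderiv_fun_neg]

theorem partialD_smul {u : E2 → ℝ} {F : E2 → W} (hu : DifferentiableAt ℝ u x)
    (hF : DifferentiableAt ℝ F x) :
    partialD i (fun y => u y • F y) x = u x • partialD i F x + partialD i u x • F x := by
  simp [partialD, fderiv_fun_smul hu hF]

theorem partialD_mul {u v : E2 → ℝ} (hu : DifferentiableAt ℝ u x) (hv : DifferentiableAt ℝ v x) :
    partialD i (fun y => u y * v y) x = u x * partialD i v x + partialD i u x * v x := by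
  simpa using partialD_smul (i := i) hu hv

theorem partialD_const_mul {u : E2 → ℝ} (a : ℝ) (hu : DifferentiableAt ℝ u x) :
    partialD i (fun y => a * u y) x = a * partialD i u x := by
  simp [partialD, fderiv_const_mul hu]

theorem partialD_comp {g : ℝ → ℝ} {g' : ℝ} {u : E2 → ℝ} (hg : HasDerivAt g g' (u x))
    (hu : DifferentiableAt ℝ u x) : partialD i (fun y => g (u y)) x = g' * partialD i u x := by
  have := (hg.comp_hasFDerivAt x hu.hasFDerivAt).fderiv
  simp only [partialD]
  rw [show (fun y => g (u y)) = g ∘ u from rfl, this]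
  simp

theorem fderiv_eq_partialD (F : E2 → W) (v : E2) :
    fderiv ℝ F x v = v 0 • partialD 0 F x + v 1 • partialD 1 F x := by
  have hv : v = v 0 • e 0 + v 1 • e 1 := by
    ext k
    fin_cases k <;> simp [e]
  conv_lhs => rw [hv]
  simp [partialD]

theorem hasDerivAt_comp_curve {F : E2 → W} {ξ : ℝ → E2} {ξ' : E2} {t : ℝ}
    (hF : DifferentiableAt ℝ F (ξ t)) (hξ : HasDerivAt ξ ξ' t) :
    HasDerivAt (fun s => F (ξ s)) (ξ' 0 • partialD 0 F (ξ t) + ξ' 1 • partialD 1 F (ξ t)) t := by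
  have := hF.hasFDerivAt.comp_hasDerivAt t hξ
  rwa [fderiv_eq_partialD] at this

theorem _root_.ContDiffAt.partialD {F : E2 → W} (hF : ContDiffAt ℝ ∞ F x) (i : Fin 2) :
    ContDiffAt ℝ ∞ (Bicons.partialD i F) x :=
  (hF.fderiv_right (m := ∞) (by simp)).clm_apply contDiffAt_const

theorem _root_.ContDiffAt.diffAt {E V : Type*} [NormedAddCommGroup E] [NormedSpace ℝ E]
    [NormedAddCommGroup V] [NormedSpace ℝ V]
    {F : E → V} {x : E} (hF : ContDiffAt ℝ ∞ F x) : DifferentiableAt ℝ F x :=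
  hF.differentiableAt (by simp)

theorem partialD_comm {F : E2 → W} (hF : ContDiffAt ℝ ∞ F x) (i j : Fin 2) :
    partialD i (partialD j F) x = partialD j (partialD i F) x := by
  have h1 : DifferentiableAt ℝ (fderiv ℝ F) x :=
    (hF.fderiv_right (m := ∞) (by simp)).diffAt
  have key : ∀ i j : Fin 2, partialD i (partialD j F) x = fderiv ℝ (fderiv ℝ F) x (e i) (e j) := by
    intro i j
    have : HasFDerivAt (partialD j F) ((ContinuousLinearMap.apply ℝ W (e j)).comp
        (fderiv ℝ (fderiv ℝ F) x)) x :=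
      (ContinuousLinearMap.apply ℝ W (e j)).hasFDerivAt.comp x h1.hasFDerivAt
    simp [partialD, this.fderiv]
  rw [key, key]
  exact (hF.isSymmSndFDerivAt (by
    rw [minSmoothness_of_isRCLikeNormedField]
    exact WithTop.coe_le_coe.2 (le_top : (2 : ℕ∞) ≤ ⊤))) (e i) (e j)

end Calculus

/-! ### Coordinate metrics -/

/-- `G` is a smooth Riemannian metric on the open subset `Ω` of the plane. -/
structure IsMetricOn (G : E2 → Matrix (Fin 2) (Fin 2) ℝ) (Ω : Set E2) : Prop where
  isOpen : IsOpen Ω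
  smooth : ∀ x ∈ Ω, ∀ i j, ContDiffAt ℝ ∞ (fun y => G y i j) x
  symm : ∀ x ∈ Ω, G x 1 0 = G x 0 1
  pos : ∀ x ∈ Ω, 0 < G x 0 0
  det_pos : ∀ x ∈ Ω, 0 < G x 0 0 * G x 1 1 - G x 0 1 ^ 2

section Metric

variable {G : E2 → Matrix (Fin 2) (Fin 2) ℝ} {Ω : Set E2} {x : E2}

theorem IsMetricOn.det_eq (hG : IsMetricOn G Ω) (hx : x ∈ Ω) :
    (G x).det = G x 0 0 * G x 1 1 - G x 0 1 ^ 2 := by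
  rw [Matrix.det_fin_two, hG.symm x hx, sq]

theorem IsMetricOn.mono (hG : IsMetricOn G Ω) {Ω' : Set E2} (h : Ω' ⊆ Ω) (ho : IsOpen Ω') :
    IsMetricOn G Ω' :=
  ⟨ho, fun x hx => hG.smooth x (h hx), fun x hx => hG.symm x (h hx), fun x hx => hG.pos x (h hx),
    fun x hx => hG.det_pos x (h hx)⟩

theorem IsMetricOn.det_ne_zero (hG : IsMetricOn G Ω) (hx : x ∈ Ω) : (G x).det ≠ 0 := by
  rw [hG.det_eq hx]; exact (hG.det_pos x hx).ne'

/-- No invertibility is needed: for zero determinant both sides are 0 by convention. -/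
theorem inv_fin_two (A : Matrix (Fin 2) (Fin 2) ℝ) :
    A⁻¹ 0 0 = A 1 1 / A.det ∧ A⁻¹ 0 1 = -A 0 1 / A.det ∧ A⁻¹ 1 0 = -A 1 0 / A.det ∧
      A⁻¹ 1 1 = A 0 0 / A.det := by
  simp [Matrix.inv_def, Matrix.adjugate_fin_two, div_eq_inv_mul]

theorem IsMetricOn.smooth_inv (hG : IsMetricOn G Ω) (hx : x ∈ Ω) (i j : Fin 2) :
    ContDiffAt ℝ ∞ (fun y => (G y)⁻¹ i j) x := by
  have hd : ContDiffAt ℝ ∞ (fun y => (G y).det) x := by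
    simp only [Matrix.det_fin_two]
    exact ((hG.smooth x hx 0 0).mul (hG.smooth x hx 1 1)).sub
      ((hG.smooth x hx 0 1).mul (hG.smooth x hx 1 0))
  have h0 := hG.det_ne_zero hx
  have key := fun y => inv_fin_two (G y)
  fin_cases i <;> fin_cases j
  · simp only [Fin.zero_eta, Fin.isValue, fun y => (key y).1]
    exact (hG.smooth x hx 1 1).div hd h0
  · simp only [Fin.zero_eta, Fin.isValue, Fin.mk_one, fun y => (key y).2.1]
    exact (hG.smooth x hx 0 1).neg.div hd h0
  · simp only [Fin.zero_eta, Fin.isValue, Fin.mk_one, fun y => (key y).2.2.1]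
    exact (hG.smooth x hx 1 0).neg.div hd h0
  · simp only [Fin.isValue, Fin.mk_one, fun y => (key y).2.2.2]
    exact (hG.smooth x hx 0 0).div hd h0

theorem IsMetricOn.smooth_christoffel (hG : IsMetricOn G Ω) (hx : x ∈ Ω) (k i j : Fin 2) :
    ContDiffAt ℝ ∞ (christoffel G k i j) x := by
  unfold christoffel
  refine contDiffAt_const.mul (ContDiffAt.sum fun l _ => (hG.smooth_inv hx k l).mul ?_)
  exact (((hG.smooth x hx j l).partialD i).add ((hG.smooth x hx i l).partialD j)).sub
    ((hG.smooth x hx i j).partialD l)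

theorem IsMetricOn.smooth_curvature (hG : IsMetricOn G Ω) (hx : x ∈ Ω) :
    ContDiffAt ℝ ∞ (coordGaussCurvature G) x := by
  have hΓ := hG.smooth_christoffel hx
  unfold coordGaussCurvature curvatureCoeff
  refine ContDiffAt.div (ContDiffAt.sum fun l _ => (hG.smooth x hx 0 l).mul ?_) ?_
    (hG.det_ne_zero hx)
  · exact (((hΓ l 1 1).partialD 0).sub ((hΓ l 0 1).partialD 1)).add
      (ContDiffAt.sum fun m _ => ((hΓ l 0 m).mul (hΓ m 1 1)).sub ((hΓ l 1 m).mul (hΓ m 0 1)))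
  · simp only [Matrix.det_fin_two]
    exact ((hG.smooth x hx 0 0).mul (hG.smooth x hx 1 1)).sub
      ((hG.smooth x hx 0 1).mul (hG.smooth x hx 1 0))

theorem IsMetricOn.partialD_symm (hG : IsMetricOn G Ω) (hx : x ∈ Ω) (k : Fin 2) :
    partialD k (fun y => G y 1 0) x = partialD k (fun y => G y 0 1) x := by
  apply partialD_congr
  filter_upwards [hG.isOpen.mem_nhds hx] with y hy using hG.symm y hy

theorem IsMetricOn.christoffel_symm (hG : IsMetricOn G Ω) (hx : x ∈ Ω) (k i j : Fin 2) :
    christoffel G k i j x = christoffel G k j i x := by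
  have := hG.partialD_symm hx
  fin_cases i <;> fin_cases j <;> simp [christoffel, this]

/-- The Christoffel symbols of the first kind. -/
theorem IsMetricOn.christoffel_lower (hG : IsMetricOn G Ω) (hx : x ∈ Ω) (k i j : Fin 2) :
    G x k 0 * christoffel G 0 i j x + G x k 1 * christoffel G 1 i j x =
      (1 / 2 : ℝ) * (partialD i (fun y => G y j k) x + partialD j (fun y => G y i k) x
      - partialD k (fun y => G y i j) x) := by
  have hd := hG.det_ne_zero hx
  obtain ⟨h1, h2, h3, h4⟩ := inv_fin_two (G x)
  rw [hG.symm x hx] at h3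
  rw [hG.det_eq hx] at h1 h2 h3 h4 hd
  simp only [christoffel, Fin.sum_univ_two, h1, h2, h3, h4]
  have hs := hG.symm x hx
  -- The determinant is kept opaque while denominators are cleared and is restored only for the
  -- final identity.
  generalize hD : G x 0 0 * G x 1 1 - G x 0 1 ^ 2 = D at hd
  fin_cases k <;> simp only [Fin.zero_eta, Fin.mk_one, Fin.isValue, hs] <;> field_simp <;>
    rw [← hD] <;> ring

end Metric

/-! ### Orthonormal coframes -/

/-- The coefficient of the exterior derivative of a one-form on the plane. -/
def extD (α : Fin 2 → E2 → ℝ) (x : E2) : ℝ := partialD 0 (α 1) x - partialD 1 (α 0) x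

/-- The area density `θ⁰ ∧ θ¹` of a coframe. -/
def area (θ : Fin 2 → Fin 2 → E2 → ℝ) (x : E2) : ℝ := θ 0 0 x * θ 1 1 x - θ 0 1 x * θ 1 0 x

/-- The connection form `ω` of a coframe, characterised by `dθ⁰ = ω ∧ θ¹`, `dθ¹ = -ω ∧ θ⁰`. -/
def connForm (θ : Fin 2 → Fin 2 → E2 → ℝ) (i : Fin 2) (x : E2) : ℝ :=
  (extD (θ 0) x / area θ x) * θ 0 i x + (extD (θ 1) x / area θ x) * θ 1 i x

/-- `θ` is a smooth orthonormal coframe of the metric `G` on `Ω`. -/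
structure IsCoframeOn (G : E2 → Matrix (Fin 2) (Fin 2) ℝ) (θ : Fin 2 → Fin 2 → E2 → ℝ)
    (Ω : Set E2) : Prop where
  smooth : ∀ x ∈ Ω, ∀ a i, ContDiffAt ℝ ∞ (θ a i) x
  gram : ∀ x ∈ Ω, ∀ i j, G x i j = θ 0 i x * θ 0 j x + θ 1 i x * θ 1 j x

section Coframe

variable {G : E2 → Matrix (Fin 2) (Fin 2) ℝ} {θ : Fin 2 → Fin 2 → E2 → ℝ} {Ω : Set E2} {x : E2}

/-- As matrices, G = θᵀθ. -/
theorem IsCoframeOn.area_sq (h : IsCoframeOn G θ Ω) (hx : x ∈ Ω) :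
    G x 0 0 * G x 1 1 - G x 0 1 ^ 2 = area θ x ^ 2 := by
  simp only [h.gram x hx, area]; ring

theorem IsCoframeOn.area_ne_zero (h : IsCoframeOn G θ Ω) (hG : IsMetricOn G Ω) (hx : x ∈ Ω) :
    area θ x ≠ 0 := by
  intro h0
  have := hG.det_pos x hx
  rw [h.area_sq hx, h0] at this
  simp at this

theorem IsCoframeOn.smooth_extD (h : IsCoframeOn G θ Ω) (hx : x ∈ Ω) (a : Fin 2) :
    ContDiffAt ℝ ∞ (extD (θ a)) x :=
  ((h.smooth x hx a 1).partialD 0).sub ((h.smooth x hx a 0).partialD 1)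

theorem IsCoframeOn.smooth_area (h : IsCoframeOn G θ Ω) (hx : x ∈ Ω) :
    ContDiffAt ℝ ∞ (area θ) x :=
  ((h.smooth x hx 0 0).mul (h.smooth x hx 1 1)).sub ((h.smooth x hx 0 1).mul (h.smooth x hx 1 0))

theorem IsCoframeOn.smooth_connForm (h : IsCoframeOn G θ Ω) (hG : IsMetricOn G Ω) (hx : x ∈ Ω)
    (i : Fin 2) : ContDiffAt ℝ ∞ (connForm θ i) x := by
  have h0 := h.area_ne_zero hG hx
  exact (((h.smooth_extD hx 0).div (h.smooth_area hx) h0).mul (h.smooth x hx 0 i)).add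
    (((h.smooth_extD hx 1).div (h.smooth_area hx) h0).mul (h.smooth x hx 1 i))

theorem IsCoframeOn.partialD_gram (h : IsCoframeOn G θ Ω) (hG : IsMetricOn G Ω) (hx : x ∈ Ω)
    (k i j : Fin 2) :
    partialD k (fun y => G y i j) x = θ 0 i x * partialD k (θ 0 j) x + partialD k (θ 0 i) x * θ 0 j x
      + (θ 1 i x * partialD k (θ 1 j) x + partialD k (θ 1 i) x * θ 1 j x) := by
  have hs := fun a i => (h.smooth x hx a i).diffAt
  rw [partialD_congr (F' := fun y => θ 0 i y * θ 0 j y + θ 1 i y * θ 1 j y),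
    partialD_add ((hs 0 i).fun_mul (hs 0 j)) ((hs 1 i).fun_mul (hs 1 j)),
    partialD_mul (hs 0 i) (hs 0 j), partialD_mul (hs 1 i) (hs 1 j)]
  filter_upwards [hG.isOpen.mem_nhds hx] with y hy using h.gram y hy i j

/-- The structure equations `∇θ⁰ = ω ⊗ θ¹`, `∇θ¹ = -ω ⊗ θ⁰` in coordinates. -/
theorem IsCoframeOn.christoffel (h : IsCoframeOn G θ Ω) (hG : IsMetricOn G Ω) (hx : x ∈ Ω)
    (i j : Fin 2) :
    θ 0 0 x * christoffel G 0 i j x + θ 0 1 x * christoffel G 1 i j x =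
        partialD i (θ 0 j) x - connForm θ i x * θ 1 j x ∧
      θ 1 0 x * christoffel G 0 i j x + θ 1 1 x * christoffel G 1 i j x =
        partialD i (θ 1 j) x + connForm θ i x * θ 0 j x := by
  have hA := h.area_ne_zero hG hx
  -- Contracting the two claims with θᵀ lowers the index and reduces them to the formula for
  -- Christoffel symbols of the first kind. Cramer's rule then recovers them, since the area density
  -- is nonzero.
  have key : ∀ k, θ 0 k x * (partialD i (θ 0 j) x - connForm θ i x * θ 1 j x) +
      θ 1 k x * (partialD i (θ 1 j) x + connForm θ i x * θ 0 j x) =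
      G x k 0 * Bicons.christoffel G 0 i j x + G x k 1 * Bicons.christoffel G 1 i j x := by
    intro k
    rw [hG.christoffel_lower hx k i j]
    simp only [h.partialD_gram hG hx, connForm, extD]
    have hA' : θ 0 0 x * θ 1 1 x - θ 0 1 x * θ 1 0 x ≠ 0 := hA
    simp only [area]
    fin_cases k <;> fin_cases i <;> fin_cases j <;>
      simp only [Fin.zero_eta, Fin.mk_one, Fin.isValue] <;> field_simp <;> ring
  have k0 := key 0
  have k1 := key 1
  simp only [h.gram x hx] at k0 k1
  constructor
  · apply mul_left_cancel₀ hA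
    simp only [area]
    linear_combination θ 1 0 x * k1 - θ 1 1 x * k0
  · apply mul_left_cancel₀ hA
    simp only [area]
    linear_combination θ 0 1 x * k0 - θ 0 0 x * k1

/-- The Gauss equation `dω = -K θ⁰ ∧ θ¹`. -/
theorem IsCoframeOn.gauss (h : IsCoframeOn G θ Ω) (hG : IsMetricOn G Ω) (hx : x ∈ Ω) :
    coordGaussCurvature G x * area θ x = -extD (connForm θ) x := by
  have hA := h.area_ne_zero hG hx
  have hs := fun a i => (h.smooth x hx a i).diffAt
  have hs' := fun a i k => ((h.smooth x hx a i).partialD k).diffAt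
  have hΓ := fun k i j => (hG.smooth_christoffel hx k i j).diffAt
  have hω := fun i => (h.smooth_connForm hG hx i).diffAt
  -- derivatives of the structure equations
  have d0 : ∀ l i j : Fin 2, θ 0 0 x * partialD l (Bicons.christoffel G 0 i j) x
      + partialD l (θ 0 0) x * Bicons.christoffel G 0 i j x
      + (θ 0 1 x * partialD l (Bicons.christoffel G 1 i j) x
      + partialD l (θ 0 1) x * Bicons.christoffel G 1 i j x) =
      partialD l (partialD i (θ 0 j)) x - (connForm θ i x * partialD l (θ 1 j) x
        + partialD l (connForm θ i) x * θ 1 j x) := by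
    intro l i j
    rw [← partialD_mul (hs 0 0) (hΓ 0 i j), ← partialD_mul (hs 0 1) (hΓ 1 i j),
      ← partialD_add ((hs 0 0).fun_mul (hΓ 0 i j)) ((hs 0 1).fun_mul (hΓ 1 i j)),
      ← partialD_mul (hω i) (hs 1 j), ← partialD_sub (hs' 0 j i) ((hω i).fun_mul (hs 1 j))]
    apply partialD_congr
    filter_upwards [hG.isOpen.mem_nhds hx] with y hy using (h.christoffel hG hy i j).1
  have d1 : ∀ l i j : Fin 2, θ 1 0 x * partialD l (Bicons.christoffel G 0 i j) x
      + partialD l (θ 1 0) x * Bicons.christoffel G 0 i j x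
      + (θ 1 1 x * partialD l (Bicons.christoffel G 1 i j) x
      + partialD l (θ 1 1) x * Bicons.christoffel G 1 i j x) =
      partialD l (partialD i (θ 1 j)) x + (connForm θ i x * partialD l (θ 0 j) x
        + partialD l (connForm θ i) x * θ 0 j x) := by
    intro l i j
    rw [← partialD_mul (hs 1 0) (hΓ 0 i j), ← partialD_mul (hs 1 1) (hΓ 1 i j),
      ← partialD_add ((hs 1 0).fun_mul (hΓ 0 i j)) ((hs 1 1).fun_mul (hΓ 1 i j)),
      ← partialD_mul (hω i) (hs 0 j), ← partialD_add (hs' 1 j i) ((hω i).fun_mul (hs 0 j))]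
    apply partialD_congr
    filter_upwards [hG.isOpen.mem_nhds hx] with y hy using (h.christoffel hG hy i j).2
  -- Antisymmetrising the differentiated structure equations cancels the second derivatives of θ.
  -- The quadratic terms in ω cancel too, the rotation algebra of the plane being abelian, and only
  -- dω remains.
  have r0 : θ 0 0 x * curvatureCoeff G 0 1 0 1 x + θ 0 1 x * curvatureCoeff G 1 1 0 1 x =
      -extD (connForm θ) x * θ 1 1 x := by
    have e1 := d0 0 1 1
    have e2 := d0 1 0 1
    rw [partialD_comm (h.smooth x hx 0 1) 1 0] at e2
    have c := fun i j => h.christoffel hG hx i j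
    simp only [curvatureCoeff, Fin.sum_univ_two, extD]
    linear_combination e1 - e2 + (Bicons.christoffel G 0 1 1 x) * (c 0 0).1 +
      (Bicons.christoffel G 1 1 1 x) * (c 0 1).1 - (Bicons.christoffel G 0 0 1 x) * (c 1 0).1 -
      (Bicons.christoffel G 1 0 1 x) * (c 1 1).1 - connForm θ 0 x * (c 1 1).2 +
      connForm θ 1 x * (c 0 1).2
  have r1 : θ 1 0 x * curvatureCoeff G 0 1 0 1 x + θ 1 1 x * curvatureCoeff G 1 1 0 1 x =
      extD (connForm θ) x * θ 0 1 x := by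
    have e1 := d1 0 1 1
    have e2 := d1 1 0 1
    rw [partialD_comm (h.smooth x hx 1 1) 1 0] at e2
    have c := fun i j => h.christoffel hG hx i j
    simp only [curvatureCoeff, Fin.sum_univ_two, extD]
    linear_combination e1 - e2 + (Bicons.christoffel G 0 1 1 x) * (c 0 0).2 +
      (Bicons.christoffel G 1 1 1 x) * (c 0 1).2 - (Bicons.christoffel G 0 0 1 x) * (c 1 0).2 -
      (Bicons.christoffel G 1 0 1 x) * (c 1 1).2 + connForm θ 0 x * (c 1 1).1 -
      connForm θ 1 x * (c 0 1).1
  rw [coordGaussCurvature, hG.det_eq hx, h.area_sq hx, Fin.sum_univ_two, h.gram x hx, h.gram x hx]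
  field_simp
  simp only [area]
  linear_combination θ 0 0 x * r0 + θ 1 0 x * r1

end Coframe

/-! ### Coframes adapted to a nowhere vanishing one-form -/

section Adapted

variable {G : E2 → Matrix (Fin 2) (Fin 2) ℝ} {α : Fin 2 → E2 → ℝ} {Ω : Set E2} {x : E2}

/-- The squared norm of a one-form with respect to a coordinate metric. -/
def dualNormSq (G : E2 → Matrix (Fin 2) (Fin 2) ℝ) (α : Fin 2 → E2 → ℝ) (x : E2) : ℝ :=
  ∑ i, ∑ j, (G x)⁻¹ i j * (α i x * α j x)

/-- The oriented orthonormal coframe whose first form is the normalisation of `α`. -/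
def adaptedCoframe (G : E2 → Matrix (Fin 2) (Fin 2) ℝ) (α : Fin 2 → E2 → ℝ) :
    Fin 2 → Fin 2 → E2 → ℝ :=
  ![fun i x => α i x / √(dualNormSq G α x),
    ![fun x => (G x 0 1 * α 0 x - G x 0 0 * α 1 x) / (√(G x).det * √(dualNormSq G α x)),
      fun x => (G x 1 1 * α 0 x - G x 0 1 * α 1 x) / (√(G x).det * √(dualNormSq G α x))]]

theorem adaptedCoframe_zero (i : Fin 2) :
    adaptedCoframe G α 0 i x = α i x / √(dualNormSq G α x) := rfl

theorem adaptedCoframe_one_zero : adaptedCoframe G α 1 0 x =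
    (G x 0 1 * α 0 x - G x 0 0 * α 1 x) / (√(G x).det * √(dualNormSq G α x)) := rfl

theorem adaptedCoframe_one_one : adaptedCoframe G α 1 1 x =
    (G x 1 1 * α 0 x - G x 0 1 * α 1 x) / (√(G x).det * √(dualNormSq G α x)) := rfl

theorem IsMetricOn.dualNormSq_mul_det (hG : IsMetricOn G Ω) (hx : x ∈ Ω) :
    dualNormSq G α x * (G x).det =
      G x 1 1 * α 0 x ^ 2 - 2 * G x 0 1 * α 0 x * α 1 x + G x 0 0 * α 1 x ^ 2 := by
  have hd := hG.det_ne_zero hx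
  obtain ⟨h1, h2, h3, h4⟩ := inv_fin_two (G x)
  simp only [dualNormSq, Fin.sum_univ_two, h1, h2, h3, h4, hG.symm x hx]
  field_simp
  ring

theorem IsMetricOn.det_pos' (hG : IsMetricOn G Ω) (hx : x ∈ Ω) : 0 < (G x).det := by
  rw [hG.det_eq hx]; exact hG.det_pos x hx

theorem IsMetricOn.dualNormSq_pos (hG : IsMetricOn G Ω) (hx : x ∈ Ω)
    (hα : α 0 x ≠ 0 ∨ α 1 x ≠ 0) : 0 < dualNormSq G α x := by
  have h0 := hG.pos x hx
  have hd := hG.det_pos x hx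
  have hd' := hG.det_pos' hx
  -- The factor G₀₀ allows completing the square.
  have key : 0 < G x 0 0 * (dualNormSq G α x * (G x).det) := by
    rw [hG.dualNormSq_mul_det hx]
    have : G x 0 0 * (G x 1 1 * α 0 x ^ 2 - 2 * G x 0 1 * α 0 x * α 1 x + G x 0 0 * α 1 x ^ 2) =
      (G x 0 0 * G x 1 1 - G x 0 1 ^ 2) * α 0 x ^ 2 + (G x 0 0 * α 1 x - G x 0 1 * α 0 x) ^ 2 := by
      ring
    rw [this]
    by_cases h : α 0 x = 0
    · have h1 : α 1 x ≠ 0 := by tauto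
      rw [h]
      have : 0 < (G x 0 0 * α 1 x) ^ 2 := by positivity
      simpa using this
    · have : 0 < (G x 0 0 * G x 1 1 - G x 0 1 ^ 2) * α 0 x ^ 2 := by positivity
      positivity
  exact pos_of_mul_pos_left (pos_of_mul_pos_right key h0.le) hd'.le

theorem IsMetricOn.smooth_det (hG : IsMetricOn G Ω) (hx : x ∈ Ω) :
    ContDiffAt ℝ ∞ (fun y => (G y).det) x := by
  simp only [Matrix.det_fin_two]
  exact ((hG.smooth x hx 0 0).mul (hG.smooth x hx 1 1)).sub
    ((hG.smooth x hx 0 1).mul (hG.smooth x hx 1 0))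

theorem IsMetricOn.smooth_dualNormSq (hG : IsMetricOn G Ω) (hx : x ∈ Ω)
    (hα : ∀ i, ContDiffAt ℝ ∞ (α i) x) : ContDiffAt ℝ ∞ (dualNormSq G α) x :=
  ContDiffAt.sum fun i _ => ContDiffAt.sum fun j _ =>
    (hG.smooth_inv hx i j).mul ((hα i).mul (hα j))

/-- The second form is the Hodge star of the first, hence of unit length and orthogonal to it. -/
theorem IsMetricOn.adaptedCoframe (hG : IsMetricOn G Ω)
    (hα : ∀ x ∈ Ω, ∀ i, ContDiffAt ℝ ∞ (α i) x) (h0 : ∀ x ∈ Ω, α 0 x ≠ 0 ∨ α 1 x ≠ 0) :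
    IsCoframeOn G (adaptedCoframe G α) Ω := by
  constructor
  · intro x hx a i
    have hW := hG.dualNormSq_pos hx (h0 x hx)
    have hs : ContDiffAt ℝ ∞ (fun y => √(dualNormSq G α y)) x :=
      (hG.smooth_dualNormSq hx (hα x hx)).sqrt hW.ne'
    have hd : ContDiffAt ℝ ∞ (fun y => √(G y).det) x :=
      (hG.smooth_det hx).sqrt (hG.det_ne_zero hx)
    have hs0 := (Real.sqrt_pos.2 hW).ne'
    have hd0 := (Real.sqrt_pos.2 (hG.det_pos' hx)).ne'
    have g := hG.smooth x hx
    have ha := hα x hx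
    fin_cases a
    · exact (ha i).div hs hs0
    · fin_cases i
      · exact (((g 0 1).mul (ha 0)).sub ((g 0 0).mul (ha 1))).div (hd.mul hs) (mul_ne_zero hd0 hs0)
      · exact (((g 1 1).mul (ha 0)).sub ((g 0 1).mul (ha 1))).div (hd.mul hs) (mul_ne_zero hd0 hs0)
  · intro x hx i j
    have hW := hG.dualNormSq_pos hx (h0 x hx)
    have hs0 := (Real.sqrt_pos.2 hW).ne'
    have hd0 := (Real.sqrt_pos.2 (hG.det_pos' hx)).ne'
    have e1 := Real.sq_sqrt hW.le
    have e2 := Real.sq_sqrt (hG.det_pos' hx).le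
    have e3 := hG.dualNormSq_mul_det (α := α) hx
    rw [← e1, ← e2] at e3
    have e4 := hG.det_eq hx
    rw [← e2] at e4
    have hsy := hG.symm x hx
    fin_cases i <;> fin_cases j <;>
      simp only [Fin.zero_eta, Fin.mk_one, Fin.isValue, adaptedCoframe_zero, adaptedCoframe_one_zero,
        adaptedCoframe_one_one, hsy] <;> field_simp
    · linear_combination G x 0 0 * e3 - α 0 x ^ 2 * e4
    · linear_combination G x 0 1 * e3 - α 0 x * α 1 x * e4
    · linear_combination G x 0 1 * e3 - α 0 x * α 1 x * e4
    · linear_combination G x 1 1 * e3 - α 1 x ^ 2 * e4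

/-- A coordinate metric admits a smooth orthonormal coframe. -/
theorem IsMetricOn.exists_coframe (hG : IsMetricOn G Ω) : ∃ θ, IsCoframeOn G θ Ω :=
  -- Any nowhere vanishing one-form would do; dx⁰ is chosen.
  ⟨_, hG.adaptedCoframe (α := ![fun _ => 1, fun _ => 0])
    (fun x _ i => by fin_cases i <;> exact contDiffAt_const) (fun x _ => Or.inl (by simp))⟩

end Adapted

/-! ### Change of coordinates -/

section Pullback

variable {Θ : E2 → E2} {y : E2}

/-- The components of the pullback of a one-form. -/
def pullback (Θ : E2 → E2) (α : Fin 2 → E2 → ℝ) (i : Fin 2) (y : E2) : ℝ :=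
  α 0 (Θ y) * partialD i Θ y 0 + α 1 (Θ y) * partialD i Θ y 1

/-- The Jacobian determinant. -/
def jacobian (Θ : E2 → E2) (y : E2) : ℝ :=
  partialD 0 Θ y 0 * partialD 1 Θ y 1 - partialD 1 Θ y 0 * partialD 0 Θ y 1

theorem partialD_comp_map {W : Type*} [NormedAddCommGroup W] [NormedSpace ℝ W] {F : E2 → W}
    (hF : DifferentiableAt ℝ F (Θ y)) (hΘ : DifferentiableAt ℝ Θ y) (i : Fin 2) :
    partialD i (fun z => F (Θ z)) y =
      partialD i Θ y 0 • partialD 0 F (Θ y) + partialD i Θ y 1 • partialD 1 F (Θ y) := by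
  rw [← fderiv_eq_partialD, partialD, show (fun z => F (Θ z)) = F ∘ Θ from rfl,
    fderiv_comp y hF hΘ]
  rfl

theorem _root_.ContDiffAt.coord {W : Type*} [NormedAddCommGroup W] [NormedSpace ℝ W] {ι : Type*}
    [Fintype ι] {F : W → EuclideanSpace ℝ ι} {y : W} (hF : ContDiffAt ℝ ∞ F y) (k : ι) :
    ContDiffAt ℝ ∞ (fun z => F z k) y :=
  (contDiffAt_euclidean.1 hF) k

theorem partialD_coord {ι : Type*} [Fintype ι] {F : E2 → EuclideanSpace ℝ ι}
    (hF : DifferentiableAt ℝ F y) (i : Fin 2) (k : ι) :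
    partialD i (fun z => F z k) y = partialD i F y k := by
  have := ((EuclideanSpace.proj k : EuclideanSpace ℝ ι →L[ℝ] ℝ).hasFDerivAt.comp y
    hF.hasFDerivAt).fderiv
  rw [partialD, show (fun z => F z k) = (EuclideanSpace.proj k : EuclideanSpace ℝ ι →L[ℝ] ℝ) ∘ F
    from rfl, this]
  rfl

/-- Exterior differentiation commutes with pullback: the second derivatives of Θ cancel by symmetry,
and a two-form on the plane scales by the Jacobian. -/
theorem extD_pullback {α : Fin 2 → E2 → ℝ} (hα : ∀ i, ContDiffAt ℝ ∞ (α i) (Θ y))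
    (hΘ : ContDiffAt ℝ ∞ Θ y) :
    extD (pullback Θ α) y = jacobian Θ y * extD α (Θ y) := by
  have hc : ∀ j k, DifferentiableAt ℝ (fun z => partialD j Θ z k) y :=
    fun j k => ((hΘ.partialD j).coord k).diffAt
  have hα' : ∀ k, DifferentiableAt ℝ (fun z => α k (Θ z)) y := fun k => ((hα k).comp y hΘ).diffAt
  have key : ∀ i j, partialD i (pullback Θ α j) y =
      α 0 (Θ y) * partialD i (partialD j Θ) y 0 + (partialD i Θ y 0 * partialD 0 (α 0) (Θ y) +
        partialD i Θ y 1 * partialD 1 (α 0) (Θ y)) * partialD j Θ y 0 +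
      (α 1 (Θ y) * partialD i (partialD j Θ) y 1 + (partialD i Θ y 0 * partialD 0 (α 1) (Θ y) +
        partialD i Θ y 1 * partialD 1 (α 1) (Θ y)) * partialD j Θ y 1) := by
    intro i j
    unfold pullback
    rw [partialD_add ((hα' 0).fun_mul (hc j 0)) ((hα' 1).fun_mul (hc j 1)),
      partialD_mul (hα' 0) (hc j 0), partialD_mul (hα' 1) (hc j 1),
      partialD_comp_map (hα 0).diffAt hΘ.diffAt, partialD_comp_map (hα 1).diffAt hΘ.diffAt,
      partialD_coord (hΘ.partialD j).diffAt, partialD_coord (hΘ.partialD j).diffAt]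
    simp only [smul_eq_mul]
  rw [extD, key, key, partialD_comm hΘ 1 0, extD, jacobian]
  ring

variable {G G' : E2 → Matrix (Fin 2) (Fin 2) ℝ} {θ : Fin 2 → Fin 2 → E2 → ℝ} {Ω Ω' : Set E2}

/-- The smooth map `Θ` from `Ω'` to `Ω` pulls the metric `G` back to the metric `G'`. -/
structure IsIsometryOn (G G' : E2 → Matrix (Fin 2) (Fin 2) ℝ) (Θ : E2 → E2) (Ω Ω' : Set E2) :
    Prop where
  mapsTo : MapsTo Θ Ω' Ω
  smooth : ∀ y ∈ Ω', ContDiffAt ℝ ∞ Θ y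
  eq : ∀ y ∈ Ω', ∀ i j, G' y i j = ∑ k, ∑ l, partialD i Θ y k * G (Θ y) k l * partialD j Θ y l

theorem area_pullback : area (fun a => pullback Θ (θ a)) y = jacobian Θ y * area θ (Θ y) := by
  simp only [area, pullback, jacobian]; ring

theorem IsCoframeOn.pullback (h : IsCoframeOn G θ Ω) (hΘ : IsIsometryOn G G' Θ Ω Ω') :
    IsCoframeOn G' (fun a => Bicons.pullback Θ (θ a)) Ω' := by
  constructor
  · intro y hy a i
    have hs := h.smooth _ (hΘ.mapsTo hy) a
    have hT := hΘ.smooth y hy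
    exact (((hs 0).comp y hT).mul ((hT.partialD i).coord 0)).add
      (((hs 1).comp y hT).mul ((hT.partialD i).coord 1))
  · intro y hy i j
    rw [hΘ.eq y hy]
    simp only [Fin.sum_univ_two, h.gram _ (hΘ.mapsTo hy), Bicons.pullback]
    ring

/-- The Gaussian curvature does not depend on the coordinates. -/
theorem IsIsometryOn.coordGaussCurvature_eq (hΘ : IsIsometryOn G G' Θ Ω Ω') (hG : IsMetricOn G Ω)
    (hG' : IsMetricOn G' Ω') (hy : y ∈ Ω') :
    coordGaussCurvature G' y = coordGaussCurvature G (Θ y) := by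
  obtain ⟨θ, h⟩ := hG.exists_coframe
  have h' := h.pullback hΘ
  -- Θ is not assumed to be a local diffeomorphism; this follows from nondegeneracy of the
  -- pulled-back metric.
  have hJ : ∀ z ∈ Ω', jacobian Θ z ≠ 0 := by
    intro z hz h0
    apply h'.area_ne_zero hG' hz
    rw [area_pullback, h0, zero_mul]
  -- In the connection form the Jacobians of dθ and of the area density cancel, so ω is natural
  -- under pullback; the Gauss equation dω = -K θ⁰∧θ¹ then transfers K.
  have hc : ∀ i, connForm (fun a => Bicons.pullback Θ (θ a)) i =ᶠ[𝓝 y]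
      Bicons.pullback Θ (connForm θ) i := by
    intro i
    filter_upwards [hG'.isOpen.mem_nhds hy] with z hz
    have hs := fun a => extD_pullback (h.smooth _ (hΘ.mapsTo hz) a) (hΘ.smooth z hz)
    have hA := h.area_ne_zero hG (hΘ.mapsTo hz)
    have hJz := hJ z hz
    simp only [connForm, area_pullback, hs, Bicons.pullback]
    field_simp
    ring
  have e1 := h'.gauss hG' hy
  have e2 := h.gauss hG (hΘ.mapsTo hy)
  rw [extD, partialD_congr (hc 0), partialD_congr (hc 1), ← extD,
    extD_pullback (h.smooth_connForm hG (hΘ.mapsTo hy)) (hΘ.smooth y hy), area_pullback] at e1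
  apply mul_right_cancel₀ (mul_ne_zero (hJ y hy) (h.area_ne_zero hG (hΘ.mapsTo hy)))
  linear_combination e1 - jacobian Θ y * e2

end Pullback

/-! ### Acceleration of curves -/

section Acceleration

variable {G : E2 → Matrix (Fin 2) (Fin 2) ℝ} {θ : Fin 2 → Fin 2 → E2 → ℝ} {Ω : Set E2}
  {ξ : ℝ → E2} {t : ℝ}

/-- The components of the covariant acceleration of a curve in coordinates. -/
def coordAcceleration (G : E2 → Matrix (Fin 2) (Fin 2) ℝ) (ξ : ℝ → E2) (t : ℝ) (k : Fin 2) : ℝ :=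
  deriv (deriv ξ) t k + ∑ i, ∑ j, christoffel G k i j (ξ t) * deriv ξ t i * deriv ξ t j

/-- The value of a one-form on the velocity of a curve. -/
def alongCurve (α : Fin 2 → E2 → ℝ) (ξ : ℝ → E2) (s : ℝ) : ℝ :=
  α 0 (ξ s) * deriv ξ s 0 + α 1 (ξ s) * deriv ξ s 1

theorem _root_.ContDiffAt.deriv_curve {W : Type*} [NormedAddCommGroup W] [NormedSpace ℝ W]
    {ξ : ℝ → W} {t : ℝ} (hξ : ContDiffAt ℝ ∞ ξ t) : ContDiffAt ℝ ∞ (deriv ξ) t :=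
  (hξ.fderiv_right (m := ∞) (by simp)).clm_apply contDiffAt_const

theorem hasDerivAt_alongCurve {α : Fin 2 → E2 → ℝ} (hα : ∀ i, ContDiffAt ℝ ∞ (α i) (ξ t))
    (hξ : ContDiffAt ℝ ∞ ξ t) : HasDerivAt (alongCurve α ξ)
      ((deriv ξ t 0 * partialD 0 (α 0) (ξ t) + deriv ξ t 1 * partialD 1 (α 0) (ξ t)) * deriv ξ t 0 +
        α 0 (ξ t) * deriv (deriv ξ) t 0 +
      ((deriv ξ t 0 * partialD 0 (α 1) (ξ t) + deriv ξ t 1 * partialD 1 (α 1) (ξ t)) * deriv ξ t 1 +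
        α 1 (ξ t) * deriv (deriv ξ) t 1)) t := by
  have h1 := hξ.diffAt.hasDerivAt
  have h2 := hξ.deriv_curve.diffAt.hasDerivAt
  have h2' : ∀ k, HasDerivAt (fun s => deriv ξ s k) (deriv (deriv ξ) t k) t := fun k =>
    (EuclideanSpace.proj k : E2 →L[ℝ] ℝ).hasFDerivAt.comp_hasDerivAt t h2
  have h3 := fun i => hasDerivAt_comp_curve (hα i).diffAt h1
  have := ((h3 0).mul (h2' 0)).add ((h3 1).mul (h2' 1))
  simp only [smul_eq_mul] at this
  exact this

/-- Differentiate the frame components θᵃ(ξ') of the velocity: the Christoffel terms are replaced by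
ω through ∇θ⁰ = ω ⊗ θ¹ and ∇θ¹ = -ω ⊗ θ⁰. -/
theorem IsCoframeOn.acceleration (h : IsCoframeOn G θ Ω) (hG : IsMetricOn G Ω) (ht : ξ t ∈ Ω)
    (hξ : ContDiffAt ℝ ∞ ξ t) :
    θ 0 0 (ξ t) * coordAcceleration G ξ t 0 + θ 0 1 (ξ t) * coordAcceleration G ξ t 1 =
        deriv (alongCurve (θ 0) ξ) t - alongCurve (connForm θ) ξ t * alongCurve (θ 1) ξ t ∧
      θ 1 0 (ξ t) * coordAcceleration G ξ t 0 + θ 1 1 (ξ t) * coordAcceleration G ξ t 1 =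
        deriv (alongCurve (θ 1) ξ) t + alongCurve (connForm θ) ξ t * alongCurve (θ 0) ξ t := by
  have c := fun i j => h.christoffel hG ht i j
  rw [(hasDerivAt_alongCurve (h.smooth _ ht 0) hξ).deriv,
    (hasDerivAt_alongCurve (h.smooth _ ht 1) hξ).deriv]
  simp only [coordAcceleration, alongCurve, Fin.sum_univ_two]
  constructor
  · linear_combination deriv ξ t 0 * deriv ξ t 0 * (c 0 0).1 + deriv ξ t 0 * deriv ξ t 1 * (c 0 1).1
      + deriv ξ t 1 * deriv ξ t 0 * (c 1 0).1 + deriv ξ t 1 * deriv ξ t 1 * (c 1 1).1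
  · linear_combination deriv ξ t 0 * deriv ξ t 0 * (c 0 0).2 + deriv ξ t 0 * deriv ξ t 1 * (c 0 1).2
      + deriv ξ t 1 * deriv ξ t 0 * (c 1 0).2 + deriv ξ t 1 * deriv ξ t 1 * (c 1 1).2

end Acceleration

/-! ### Surfaces in space forms in coordinates -/

section Form

variable {c : ℝ} {u v w : E4} {x : E2} {i : Fin 2}

theorem form_comm (c : ℝ) (u v : E4) : form c u v = form c v u := by
  simp only [form]; ring

theorem form_add_left : form c (u + v) w = form c u w + form c v w := by
  simp only [form, PiLp.add_apply]; ring

theorem form_add_right : form c w (u + v) = form c w u + form c w v := by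
  simp only [form, PiLp.add_apply]; ring

theorem form_sub_left : form c (u - v) w = form c u w - form c v w := by
  simp only [form, PiLp.sub_apply]; ring

theorem form_sub_right : form c w (u - v) = form c w u - form c w v := by
  simp only [form, PiLp.sub_apply]; ring

theorem form_smul_left {a : ℝ} : form c (a • u) w = a * form c u w := by
  simp only [form, PiLp.smul_apply, smul_eq_mul]; ring

theorem form_smul_right {a : ℝ} : form c w (a • u) = a * form c w u := by
  simp only [form, PiLp.smul_apply, smul_eq_mul]; ring

theorem form_zero_left : form c 0 w = 0 := by
  simp [form]

theorem _root_.ContDiffAt.form {F H : E2 → E4} (hF : ContDiffAt ℝ ∞ F x) (hH : ContDiffAt ℝ ∞ H x) :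
    ContDiffAt ℝ ∞ (fun y => form c (F y) (H y)) x := by
  unfold Bicons.form
  exact ((((hF.coord 0).mul (hH.coord 0)).add ((hF.coord 1).mul (hH.coord 1))).add
    ((hF.coord 2).mul (hH.coord 2))).add (contDiffAt_const.mul ((hF.coord 3).mul (hH.coord 3)))

theorem partialD_form {F H : E2 → E4} (hF : ContDiffAt ℝ ∞ F x) (hH : ContDiffAt ℝ ∞ H x) :
    partialD i (fun y => form c (F y) (H y)) x =
      form c (partialD i F x) (H x) + form c (F x) (partialD i H x) := by
  have f := fun k => (hF.coord k).diffAt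
  have h := fun k => (hH.coord k).diffAt
  have m := fun k => (f k).fun_mul (h k)
  unfold form
  rw [partialD_add (((m 0).fun_add (m 1)).fun_add (m 2)) ((m 3).const_mul _),
    partialD_add ((m 0).fun_add (m 1)) (m 2), partialD_add (m 0) (m 1), partialD_const_mul _ (m 3)]
  simp only [partialD_mul (f _) (h _), partialD_coord hF.diffAt, partialD_coord hH.diffAt]
  ring

/-- Four vectors with nondegenerate Gram matrix span the ambient space. -/
theorem eq_zero_of_form_eq_zero {n z : E4} (hd : form c u u * form c v v - form c u v ^ 2 ≠ 0)
    (hn : form c n n ≠ 0) (hz : form c z z ≠ 0) (hnu : form c n u = 0) (hnv : form c n v = 0)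
    (hzu : form c z u = 0) (hzv : form c z v = 0) (hzn : form c z n = 0)
    (hwu : form c w u = 0) (hwv : form c w v = 0) (hwn : form c w n = 0) (hwz : form c w z = 0) :
    w = 0 := by
  set A : Matrix (Fin 4) (Fin 4) ℝ := ![u, v, n, z] with hA
  set J : Matrix (Fin 4) (Fin 4) ℝ := Matrix.diagonal ![1, 1, 1, if c < 0 then -1 else 1] with hJ
  -- With the four vectors as rows of A, the product A J Aᵀ is their Gram matrix. It is block
  -- diagonal with nonzero determinant, so A J is injective, and the orthogonality of w says A J w =
  -- 0.
  have hB : A * J * Aᵀ = !![form c u u, form c u v, 0, 0; form c u v, form c v v, 0, 0;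
      0, 0, form c n n, 0; 0, 0, 0, form c z z] := by
    have e : ∀ a b : Fin 4, (A * J * Aᵀ) a b = form c (WithLp.toLp 2 (A a)) (WithLp.toLp 2 (A b)) := by
      intro a b
      simp only [Matrix.mul_apply, Matrix.transpose_apply, hJ, Fin.sum_univ_four, form]
      simp
    ext a b
    rw [e]
    fin_cases a <;> fin_cases b <;> simp [hA] <;>
      first | assumption | (rw [form_comm]; assumption) | rw [form_comm]
  have hdet : (A * J * Aᵀ).det ≠ 0 := by
    rw [hB]
    have : Matrix.det !![form c u u, form c u v, 0, 0; form c u v, form c v v, 0, 0;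
        0, 0, form c n n, 0; 0, 0, 0, form c z z] =
        (form c u u * form c v v - form c u v ^ 2) * (form c n n * form c z z) := by
      simp [Matrix.det_succ_row_zero, Fin.sum_univ_succ, Fin.succAbove]
      ring
    rw [this]
    exact mul_ne_zero hd (mul_ne_zero hn hz)
  have hAJ : (A * J).det ≠ 0 := by
    rw [Matrix.det_mul] at hdet
    exact left_ne_zero_of_mul hdet
  have hw : (A * J) *ᵥ w.ofLp = 0 := by
    have e : ∀ a : Fin 4, ((A * J) *ᵥ w.ofLp) a = form c w (WithLp.toLp 2 (A a)) := by
      intro a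
      simp only [Matrix.mulVec, dotProduct, hJ, Fin.sum_univ_four, form, Matrix.mul_diagonal]
      simp
      ring_nf
    ext a
    rw [e]
    fin_cases a <;> simp [hA] <;> assumption
  have := Matrix.eq_zero_of_mulVec_eq_zero hAJ hw
  ext k
  exact congrFun this k

end Form

/-- `Ψ` is an isometric immersion of `(Ω, G)` into the space form, with unit normal field `N`. -/
structure IsSurfaceOn (c : ℝ) (G : E2 → Matrix (Fin 2) (Fin 2) ℝ) (Ψ N : E2 → E4) (Ω : Set E2) :
    Prop where
  metric : IsMetricOn G Ω
  smooth : ∀ x ∈ Ω, ContDiffAt ℝ ∞ Ψ x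
  smooth_normal : ∀ x ∈ Ω, ContDiffAt ℝ ∞ N x
  mem : ∀ x ∈ Ω, Ψ x ∈ spaceForm c
  isom : ∀ x ∈ Ω, ∀ i j, form c (partialD i Ψ x) (partialD j Ψ x) = G x i j
  tangent : ∀ x ∈ Ω, N x ∈ spaceFormTangent c (Ψ x)
  normal : ∀ x ∈ Ω, ∀ i, form c (N x) (partialD i Ψ x) = 0
  unit : ∀ x ∈ Ω, form c (N x) (N x) = 1

/-- The second fundamental form in coordinates. -/
def sff (c : ℝ) (Ψ N : E2 → E4) (i j : Fin 2) (x : E2) : ℝ :=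
  -form c (partialD i N x) (partialD j Ψ x)

/-- The mean curvature function in coordinates. -/
def coordMeanCurvature (c : ℝ) (G : E2 → Matrix (Fin 2) (Fin 2) ℝ) (Ψ N : E2 → E4) (x : E2) : ℝ :=
  ∑ i, ∑ j, (G x)⁻¹ i j * sff c Ψ N i j x

namespace IsSurfaceOn

variable {c : ℝ} {G : E2 → Matrix (Fin 2) (Fin 2) ℝ} {Ψ N : E2 → E4} {Ω : Set E2} {x : E2}

theorem eventually (h : IsSurfaceOn c G Ψ N Ω) (hx : x ∈ Ω) : ∀ᶠ y in 𝓝 x, y ∈ Ω :=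
  h.metric.isOpen.mem_nhds hx

theorem form_position (h : IsSurfaceOn c G Ψ N Ω) (hx : x ∈ Ω) (i : Fin 2) :
    c * form c (partialD i Ψ x) (Ψ x) = 0 := by
  by_cases hc : c = 0
  · simp [hc]
  have h1 : partialD i (fun y => form c (Ψ y) (Ψ y)) x = 0 := by
    rw [partialD_congr (F' := fun _ => 1 / c), partialD_const]
    filter_upwards [h.eventually hx] with y hy
    have := h.mem y hy
    simp only [spaceForm, hc, if_false, mem_ofPred_eq] at this
    exact this.1
  rw [partialD_form (h.smooth x hx) (h.smooth x hx), form_comm c (Ψ x)] at h1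
  have : form c (partialD i Ψ x) (Ψ x) = 0 := by linarith
  rw [this, mul_zero]

theorem form_position_normal (h : IsSurfaceOn c G Ψ N Ω) (hx : x ∈ Ω) :
    c * form c (N x) (Ψ x) = 0 := by
  by_cases hc : c = 0
  · simp [hc]
  have := h.tangent x hx
  simp only [spaceFormTangent, hc, if_false, mem_ofPred_eq] at this
  rw [this, mul_zero]

/-- Derivative of `form_position`; it supplies the component of the second derivatives normal to the
space form. -/
theorem form_position_second (h : IsSurfaceOn c G Ψ N Ω) (hx : x ∈ Ω) (i j : Fin 2) :
    c * form c (partialD i (partialD j Ψ) x) (Ψ x) = -c * G x i j := by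
  have hs := h.smooth x hx
  have h1 : partialD i (fun y => c * form c (partialD j Ψ y) (Ψ y)) x = 0 := by
    rw [partialD_congr (F' := fun _ => 0), partialD_const]
    filter_upwards [h.eventually hx] with y hy using h.form_position hy j
  rw [partialD_const_mul _ ((hs.partialD j).form hs).diffAt, partialD_form (hs.partialD j) hs,
    h.isom x hx] at h1
  have := h.metric.symm x hx
  have h2 : G x j i = G x i j := by
    fin_cases i <;> fin_cases j <;> simp [this]
  rw [h2] at h1
  linarith

theorem form_dnormal_normal (h : IsSurfaceOn c G Ψ N Ω) (hx : x ∈ Ω) (i : Fin 2) :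
    form c (partialD i N x) (N x) = 0 := by
  have hs := h.smooth_normal x hx
  have h1 : partialD i (fun y => form c (N y) (N y)) x = 0 := by
    rw [partialD_congr (F' := fun _ => 1), partialD_const]
    filter_upwards [h.eventually hx] with y hy using h.unit y hy
  rw [partialD_form hs hs, form_comm c (N x)] at h1
  linarith

theorem form_dnormal_position (h : IsSurfaceOn c G Ψ N Ω) (hx : x ∈ Ω) (i : Fin 2) :
    c * form c (partialD i N x) (Ψ x) = 0 := by
  have hs := h.smooth_normal x hx
  have hs' := h.smooth x hx
  have h1 : partialD i (fun y => c * form c (N y) (Ψ y)) x = 0 := by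
    rw [partialD_congr (F' := fun _ => 0), partialD_const]
    filter_upwards [h.eventually hx] with y hy using h.form_position_normal hy
  rw [partialD_const_mul _ (hs.form hs').diffAt, partialD_form hs hs', h.normal x hx] at h1
  linarith

theorem form_second_normal (h : IsSurfaceOn c G Ψ N Ω) (hx : x ∈ Ω) (i j : Fin 2) :
    form c (partialD i (partialD j Ψ) x) (N x) = sff c Ψ N i j x := by
  have hs := h.smooth_normal x hx
  have hs' := (h.smooth x hx).partialD j
  have h1 : partialD i (fun y => form c (N y) (partialD j Ψ y)) x = 0 := by
    rw [partialD_congr (F' := fun _ => 0), partialD_const]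
    filter_upwards [h.eventually hx] with y hy using h.normal y hy j
  rw [partialD_form hs hs', form_comm c (N x)] at h1
  rw [sff]
  linarith

theorem sff_symm (h : IsSurfaceOn c G Ψ N Ω) (hx : x ∈ Ω) (i j : Fin 2) :
    sff c Ψ N i j x = sff c Ψ N j i x := by
  rw [← h.form_second_normal hx, ← h.form_second_normal hx, partialD_comm (h.smooth x hx)]

theorem partialD_metric (h : IsSurfaceOn c G Ψ N Ω) (hx : x ∈ Ω) (k i j : Fin 2) :
    partialD k (fun y => G y i j) x = form c (partialD k (partialD i Ψ) x) (partialD j Ψ x) +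
      form c (partialD k (partialD j Ψ) x) (partialD i Ψ x) := by
  have hs := fun i => (h.smooth x hx).partialD i
  rw [partialD_congr (F' := fun y => form c (partialD i Ψ y) (partialD j Ψ y)),
    partialD_form (hs i) (hs j), form_comm c (partialD i Ψ x)]
  filter_upwards [h.eventually hx] with y hy using (h.isom y hy i j).symm

/-- The Koszul computation: differentiate the metric coefficients and use the symmetry of second
derivatives. -/
theorem form_second (h : IsSurfaceOn c G Ψ N Ω) (hx : x ∈ Ω) (i j k : Fin 2) :
    form c (partialD i (partialD j Ψ) x) (partialD k Ψ x) =
      G x k 0 * christoffel G 0 i j x + G x k 1 * christoffel G 1 i j x := by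
  rw [h.metric.christoffel_lower hx, h.partialD_metric hx, h.partialD_metric hx,
    h.partialD_metric hx, partialD_comm (h.smooth x hx) j i, partialD_comm (h.smooth x hx) k j,
    partialD_comm (h.smooth x hx) k i]
  ring

/-- The tangent vectors, N and one further vector span ℝ⁴. That vector is Ψ for c ≠ 0 and the last
basis vector, normal to the hyperplane, for c = 0; hence the two alternative last conditions. -/
theorem eq_zero (h : IsSurfaceOn c G Ψ N Ω) (hx : x ∈ Ω) {V : E4}
    (h1 : ∀ k, form c V (partialD k Ψ x) = 0) (h2 : form c V (N x) = 0)
    (h3 : c * form c V (Ψ x) = 0) (h4 : c = 0 → V 3 = 0) : V = 0 := by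
  have hd : form c (partialD 0 Ψ x) (partialD 0 Ψ x) * form c (partialD 1 Ψ x) (partialD 1 Ψ x) -
      form c (partialD 0 Ψ x) (partialD 1 Ψ x) ^ 2 ≠ 0 := by
    simp only [h.isom x hx]; exact (h.metric.det_pos x hx).ne'
  have hn : form c (N x) (N x) ≠ 0 := by rw [h.unit x hx]; exact one_ne_zero
  by_cases hc : c = 0
  · subst hc
    have hf : ∀ w : E4, form 0 (EuclideanSpace.single 3 1) w = w 3 := fun w => by simp [form]
    have hΨ : ∀ k, partialD k Ψ x 3 = 0 := by
      intro k
      rw [← partialD_coord (h.smooth x hx).diffAt, partialD_congr (F' := fun _ => 0), partialD_const]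
      filter_upwards [h.eventually hx] with y hy
      simpa [spaceForm] using h.mem y hy
    refine eq_zero_of_form_eq_zero (z := EuclideanSpace.single 3 1) hd hn ?_ (h.normal x hx 0)
      (h.normal x hx 1) ?_ ?_ ?_ (h1 0) (h1 1) h2 ?_
    · rw [hf]; simp
    · rw [hf, hΨ]
    · rw [hf, hΨ]
    · rw [hf]; simpa [spaceFormTangent] using h.tangent x hx
    · rw [form_comm, hf, h4 rfl]
  · have hz : form c (Ψ x) (Ψ x) ≠ 0 := by
      have := h.mem x hx
      simp only [spaceForm, hc, if_false, mem_ofPred_eq] at this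
      rw [this.1]; exact one_div_ne_zero hc
    have hp := fun k => (mul_eq_zero.1 (h.form_position hx k)).resolve_left hc
    refine eq_zero_of_form_eq_zero hd hn hz (h.normal x hx 0) (h.normal x hx 1) ?_ ?_ ?_ (h1 0)
      (h1 1) h2 ((mul_eq_zero.1 h3).resolve_left hc)
    · rw [form_comm, hp]
    · rw [form_comm, hp]
    · rw [form_comm]; exact (mul_eq_zero.1 (h.form_position_normal hx)).resolve_left hc

theorem coord_three (h : IsSurfaceOn c G Ψ N Ω) (hc : c = 0) (hx : x ∈ Ω) : Ψ x 3 = 0 := by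
  simpa [spaceForm, hc] using h.mem x hx

theorem partialD_coord_three (h : IsSurfaceOn c G Ψ N Ω) (hc : c = 0) (hx : x ∈ Ω) (k : Fin 2) :
    partialD k Ψ x 3 = 0 := by
  rw [← partialD_coord (h.smooth x hx).diffAt, partialD_congr (F' := fun _ => 0), partialD_const]
  filter_upwards [h.eventually hx] with y hy using h.coord_three hc hy

/-- The Gauss formula. -/
theorem second_deriv (h : IsSurfaceOn c G Ψ N Ω) (hx : x ∈ Ω) (i j : Fin 2) :
    partialD i (partialD j Ψ) x = christoffel G 0 i j x • partialD 0 Ψ x +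
      christoffel G 1 i j x • partialD 1 Ψ x + sff c Ψ N i j x • N x - (c * G x i j) • Ψ x := by
  rw [← sub_eq_zero]
  have hcΨ : ∀ w, (c * G x i j) * form c (Ψ x) w = G x i j * (c * form c w (Ψ x)) := fun w => by
    rw [form_comm]; ring
  have hn := h.normal x hx
  apply h.eq_zero hx
  · intro k
    simp only [form_sub_left, form_add_left, form_smul_left, h.isom x hx, hn, hcΨ,
      h.form_position hx, h.form_second hx]
    have := h.metric.symm x hx
    fin_cases k <;> simp [this] <;> ring
  · have hn' := fun k => (form_comm c _ _).trans (hn k)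
    simp only [form_sub_left, form_add_left, form_smul_left, h.unit x hx, hcΨ,
      h.form_position_normal hx, h.form_second_normal hx, hn']
    ring
  · by_cases hc : c = 0
    · rw [hc, zero_mul]
    have h1 : c * form c (Ψ x) (Ψ x) = 1 := by
      have := h.mem x hx
      simp only [spaceForm, hc, if_false, mem_ofPred_eq] at this
      rw [this.1]; field_simp
    simp only [form_sub_left, form_add_left, form_smul_left]
    linear_combination h.form_position_second hx i j - christoffel G 0 i j x * h.form_position hx 0 -
      christoffel G 1 i j x * h.form_position hx 1 -
      sff c Ψ N i j x * h.form_position_normal hx + c * G x i j * h1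
  · intro hc
    have h1 : partialD i (partialD j Ψ) x 3 = 0 := by
      rw [← partialD_coord ((h.smooth x hx).partialD j).diffAt, partialD_congr (F' := fun _ => 0),
        partialD_const]
      filter_upwards [h.eventually hx] with y hy using h.partialD_coord_three hc hy j
    have h2 : N x 3 = 0 := by simpa [spaceFormTangent, hc] using h.tangent x hx
    simp [h1, h2, h.partialD_coord_three hc hx, h.coord_three hc hx]

theorem smooth_sff (h : IsSurfaceOn c G Ψ N Ω) (hx : x ∈ Ω) (i j : Fin 2) :
    ContDiffAt ℝ ∞ (sff c Ψ N i j) x :=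
  (((h.smooth_normal x hx).partialD i).form ((h.smooth x hx).partialD j)).neg

/-- The Gauss equation. -/
theorem gauss (h : IsSurfaceOn c G Ψ N Ω) (hx : x ∈ Ω) :
    coordGaussCurvature G x * (G x).det =
      sff c Ψ N 0 0 x * sff c Ψ N 1 1 x - sff c Ψ N 0 1 x ^ 2 + c * (G x).det := by
  have hG := h.metric
  have hs := fun i j => (((h.smooth x hx).partialD j).partialD i)
  have hs' := fun i => (h.smooth x hx).partialD i
  have hΓ := fun k i j => (hG.smooth_christoffel hx k i j).diffAt
  have hg := fun i j => (hG.smooth x hx i j).diffAt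
  -- Differentiate ⟨∂ᵢ∂ⱼΨ, ∂₀Ψ⟩, the lowered Christoffel symbol. The third derivatives of Ψ cancel
  -- between the index choices (0,1,1) and (1,0,1), leaving products of second derivatives, which
  -- the Gauss formula evaluates in `q`.
  have d : ∀ a i j : Fin 2,
      form c (partialD a (partialD i (partialD j Ψ)) x) (partialD 0 Ψ x) +
        form c (partialD i (partialD j Ψ) x) (partialD a (partialD 0 Ψ) x) =
      G x 0 0 * partialD a (christoffel G 0 i j) x +
        partialD a (fun y => G y 0 0) x * christoffel G 0 i j x +
      (G x 0 1 * partialD a (christoffel G 1 i j) x +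
        partialD a (fun y => G y 0 1) x * christoffel G 1 i j x) := by
    intro a i j
    rw [← partialD_mul (hg 0 0) (hΓ 0 i j), ← partialD_mul (hg 0 1) (hΓ 1 i j),
      ← partialD_add ((hg 0 0).fun_mul (hΓ 0 i j)) ((hg 0 1).fun_mul (hΓ 1 i j)),
      ← partialD_form (hs i j) (hs' 0)]
    apply partialD_congr
    filter_upwards [h.eventually hx] with y hy using h.form_second hy i j 0
  have q : ∀ i j k m : Fin 2,
      form c (partialD i (partialD j Ψ) x) (partialD k (partialD m Ψ) x) =
      christoffel G 0 k m x * (G x 0 0 * christoffel G 0 i j x + G x 0 1 * christoffel G 1 i j x) +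
      christoffel G 1 k m x * (G x 1 0 * christoffel G 0 i j x + G x 1 1 * christoffel G 1 i j x) +
      sff c Ψ N k m x * sff c Ψ N i j x + c * G x i j * G x k m := by
    intro i j k m
    rw [h.second_deriv hx k m]
    simp only [form_sub_right, form_add_right, form_smul_right, h.form_second hx,
      h.form_second_normal hx]
    linear_combination -G x k m * h.form_position_second hx i j
  have e1 := d 0 1 1
  have e2 := d 1 0 1
  have e3 : partialD 0 (partialD 1 (partialD 1 Ψ)) x = partialD 1 (partialD 0 (partialD 1 Ψ)) x :=
    partialD_comm (hs' 1) 0 1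
  rw [q, h.partialD_metric hx, h.partialD_metric hx] at e1 e2
  simp only [h.form_second hx] at e1 e2
  rw [e3] at e1
  rw [coordGaussCurvature, div_mul_cancel₀ _ (hG.det_ne_zero hx), hG.det_eq hx]
  have hsy := hG.symm x hx
  have c1 := fun k => hG.christoffel_symm hx k 1 0
  have c2 := h.sff_symm hx 1 0
  simp only [curvatureCoeff, Fin.sum_univ_two]
  rw [hsy] at e1 e2
  simp only [c1, c2] at e1 e2 ⊢
  linear_combination e2 - e1

/-- The Codazzi equation. -/
theorem codazzi (h : IsSurfaceOn c G Ψ N Ω) (hx : x ∈ Ω) (i j k : Fin 2) :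
    partialD i (sff c Ψ N j k) x - partialD j (sff c Ψ N i k) x =
      christoffel G 0 i k x * sff c Ψ N j 0 x + christoffel G 1 i k x * sff c Ψ N j 1 x -
      (christoffel G 0 j k x * sff c Ψ N i 0 x + christoffel G 1 j k x * sff c Ψ N i 1 x) := by
  have hN := h.smooth_normal x hx
  have hΨ := h.smooth x hx
  -- The term with ∂ᵢ∂ⱼN is symmetric in i and j and drops out of the difference. The Gauss formula
  -- contributes only its tangential part, since ∂ⱼN is orthogonal to N, and to Ψ when c ≠ 0.
  have key : ∀ i j, partialD i (sff c Ψ N j k) x =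
      -form c (partialD i (partialD j N) x) (partialD k Ψ x) +
      (christoffel G 0 i k x * sff c Ψ N j 0 x + christoffel G 1 i k x * sff c Ψ N j 1 x) := by
    intro i j
    unfold sff
    rw [partialD_neg, partialD_form (hN.partialD j) (hΨ.partialD k), h.second_deriv hx i k]
    simp only [form_sub_right, form_add_right, form_smul_right]
    linear_combination -sff c Ψ N i k x * h.form_dnormal_normal hx j +
      G x i k * h.form_dnormal_position hx j
  rw [key, key, partialD_comm hN j i]
  ring

end IsSurfaceOn

/-! ### The stress-bienergy tensor of a surface -/

namespace IsSurfaceOn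

variable {c : ℝ} {G : E2 → Matrix (Fin 2) (Fin 2) ℝ} {Ψ N : E2 → E4} {Ω : Set E2} {x : E2}

theorem smooth_meanCurvature (h : IsSurfaceOn c G Ψ N Ω) (hx : x ∈ Ω) :
    ContDiffAt ℝ ∞ (coordMeanCurvature c G Ψ N) x :=
  ContDiffAt.sum fun i _ => ContDiffAt.sum fun j _ =>
    (h.metric.smooth_inv hx i j).mul (h.smooth_sff hx i j)

theorem meanCurvature_mul_det (h : IsSurfaceOn c G Ψ N Ω) (hx : x ∈ Ω) :
    coordMeanCurvature c G Ψ N x * (G x).det = G x 1 1 * sff c Ψ N 0 0 x -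
      2 * (G x 0 1 * sff c Ψ N 0 1 x) + G x 0 0 * sff c Ψ N 1 1 x := by
  obtain ⟨h1, h2, h3, h4⟩ := inv_fin_two (G x)
  have hd := h.metric.det_ne_zero hx
  simp only [coordMeanCurvature, Fin.sum_univ_two, h1, h2, h3, h4, h.metric.symm x hx,
    h.sff_symm hx 1 0]
  field_simp
  ring

/-- By the Gauss formula, ∇dΨ is the second fundamental form times N: projection to the space form
removes the Ψ term and the Christoffel symbols remove the tangential part. -/
theorem tension_eq (h : IsSurfaceOn c G Ψ N Ω) (hx : x ∈ Ω) :
    tension c G Ψ x = coordMeanCurvature c G Ψ N x • N x := by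
  have key : ∀ i j, covAlong c Ψ i (partialD j Ψ) x - ∑ k, christoffel G k i j x • partialD k Ψ x =
      sff c Ψ N i j x • N x := by
    intro i j
    rw [covAlong, h.form_position_second hx, h.second_deriv hx i j, Fin.sum_univ_two]
    module
  simp only [tension, key, coordMeanCurvature, Finset.sum_smul, smul_smul]

/-- With τ = fN, the term ∂f · N and the correction along Ψ pair to zero with tangent vectors,
leaving f⟨∂ᵢN, ∂ₖΨ⟩. -/
theorem form_covAlong_tension (h : IsSurfaceOn c G Ψ N Ω) (hx : x ∈ Ω) (i k : Fin 2) :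
    form c (partialD k Ψ x) (covAlong c Ψ i (tension c G Ψ) x) =
      -(coordMeanCurvature c G Ψ N x * sff c Ψ N i k x) := by
  have hf := (h.smooth_meanCurvature hx).diffAt
  have hN := (h.smooth_normal x hx).diffAt
  have e : partialD i (tension c G Ψ) x = coordMeanCurvature c G Ψ N x • partialD i N x +
      partialD i (coordMeanCurvature c G Ψ N) x • N x := by
    rw [← partialD_smul hf hN]
    apply partialD_congr
    filter_upwards [h.eventually hx] with y hy using h.tension_eq hy
  rw [covAlong, form_sub_right, e, form_add_right, form_smul_right, form_smul_right,
    form_smul_right, form_comm c _ (N x), h.normal x hx, sff, form_comm c _ (partialD i N x)]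
  linear_combination -(form c (coordMeanCurvature c G Ψ N x • partialD i N x +
      partialD i (coordMeanCurvature c G Ψ N) x • N x) (Ψ x)) * h.form_position hx k

/-- The trace ⟨dΨ, ∇τ⟩ is -f², which changes the coefficient ½f² into -½f². -/
theorem stressBienergy_eq (h : IsSurfaceOn c G Ψ N Ω) (hx : x ∈ Ω) (i j : Fin 2) :
    stressBienergy c G Ψ i j x = -(1 / 2 * coordMeanCurvature c G Ψ N x ^ 2) * G x i j +
      2 * (coordMeanCurvature c G Ψ N x * sff c Ψ N i j x) := by
  have e : ∑ k, ∑ l, (G x)⁻¹ k l * form c (partialD k Ψ x) (covAlong c Ψ l (tension c G Ψ) x) =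
      -coordMeanCurvature c G Ψ N x ^ 2 := by
    have hi := fun k l => h.sff_symm hx k l
    have hm : coordMeanCurvature c G Ψ N x = ∑ i, ∑ j, (G x)⁻¹ i j * sff c Ψ N i j x := rfl
    simp only [h.form_covAlong_tension hx]
    simp only [Fin.sum_univ_two, hi 1 0] at hm ⊢
    linear_combination coordMeanCurvature c G Ψ N x * hm
  rw [stressBienergy, e, h.form_covAlong_tension hx, h.form_covAlong_tension hx, h.tension_eq hx,
    form_smul_left, form_smul_right, h.unit x hx, h.sff_symm hx j i]
  ring

/-- The covariant derivative of the second fundamental form. -/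
def covSff (c : ℝ) (G : E2 → Matrix (Fin 2) (Fin 2) ℝ) (Ψ N : E2 → E4) (i j k : Fin 2) (x : E2) :
    ℝ :=
  partialD i (sff c Ψ N j k) x -
    (christoffel G 0 i j x * sff c Ψ N 0 k x + christoffel G 1 i j x * sff c Ψ N 1 k x) -
    (christoffel G 0 i k x * sff c Ψ N j 0 x + christoffel G 1 i k x * sff c Ψ N j 1 x)

theorem partialD_sff_symm (h : IsSurfaceOn c G Ψ N Ω) (hx : x ∈ Ω) (i j k : Fin 2) :
    partialD i (sff c Ψ N j k) x = partialD i (sff c Ψ N k j) x := by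
  apply partialD_congr
  filter_upwards [h.eventually hx] with y hy using h.sff_symm hy j k

/-- Codazzi gives symmetry in the first two slots, symmetry of the second fundamental form gives it
in the last two. Together they make ∇h totally symmetric. -/
theorem covSff_symm (h : IsSurfaceOn c G Ψ N Ω) (hx : x ∈ Ω) (i j k : Fin 2) :
    covSff c G Ψ N i j k x = covSff c G Ψ N j i k x ∧
      covSff c G Ψ N i j k x = covSff c G Ψ N i k j x := by
  have hs := h.sff_symm hx
  constructor
  · have := h.codazzi hx i j k
    simp only [covSff, h.metric.christoffel_symm hx 0 i j, h.metric.christoffel_symm hx 1 i j]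
    linarith
  · simp only [covSff, h.partialD_sff_symm hx i j k, hs 0 k, hs 1 k, hs j 0, hs j 1]
    ring

theorem partialD_metric' (h : IsSurfaceOn c G Ψ N Ω) (hx : x ∈ Ω) (k i j : Fin 2) :
    partialD k (fun y => G y i j) x =
      G x j 0 * christoffel G 0 k i x + G x j 1 * christoffel G 1 k i x +
      (G x i 0 * christoffel G 0 k j x + G x i 1 * christoffel G 1 k j x) := by
  rw [h.partialD_metric hx, h.form_second hx, h.form_second hx]

/-- The metric is parallel, so the derivative of the trace is the trace of the covariant derivative.
Differentiating the identity with the determinant cleared avoids derivatives of the inverse metric.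
-/
theorem partialD_meanCurvature (h : IsSurfaceOn c G Ψ N Ω) (hx : x ∈ Ω) (k : Fin 2) :
    partialD k (coordMeanCurvature c G Ψ N) x * (G x).det =
      G x 1 1 * covSff c G Ψ N k 0 0 x - 2 * (G x 0 1 * covSff c G Ψ N k 0 1 x) +
        G x 0 0 * covSff c G Ψ N k 1 1 x := by
  have hf := (h.smooth_meanCurvature hx).diffAt
  have hh := fun i j => (h.smooth_sff hx i j).diffAt
  have hg := fun i j => (h.metric.smooth x hx i j).diffAt
  have e : partialD k (fun y => coordMeanCurvature c G Ψ N y *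
      (G y 0 0 * G y 1 1 - G y 0 1 * G y 0 1)) x =
      partialD k (fun y => G y 1 1 * sff c Ψ N 0 0 y -
      2 * (G y 0 1 * sff c Ψ N 0 1 y) + G y 0 0 * sff c Ψ N 1 1 y) x := by
    apply partialD_congr
    filter_upwards [h.eventually hx] with y hy
    rw [← h.meanCurvature_mul_det hy, h.metric.det_eq hy, sq]
  rw [partialD_mul hf (((hg 0 0).fun_mul (hg 1 1)).fun_sub ((hg 0 1).fun_mul (hg 0 1))),
    partialD_sub ((hg 0 0).fun_mul (hg 1 1)) ((hg 0 1).fun_mul (hg 0 1)),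
    partialD_mul (hg 0 0) (hg 1 1), partialD_mul (hg 0 1) (hg 0 1),
    partialD_add (((hg 1 1).fun_mul (hh 0 0)).fun_sub (((hg 0 1).fun_mul (hh 0 1)).const_mul 2))
      ((hg 0 0).fun_mul (hh 1 1)),
    partialD_sub ((hg 1 1).fun_mul (hh 0 0)) (((hg 0 1).fun_mul (hh 0 1)).const_mul 2),
    partialD_const_mul _ ((hg 0 1).fun_mul (hh 0 1)), partialD_mul (hg 1 1) (hh 0 0),
    partialD_mul (hg 0 1) (hh 0 1), partialD_mul (hg 0 0) (hh 1 1)] at e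
  simp only [h.partialD_metric' hx, h.metric.symm x hx] at e
  have t := h.meanCurvature_mul_det hx
  have hs := h.sff_symm hx 1 0
  rw [h.metric.det_eq hx] at t ⊢
  simp only [covSff, hs]
  linear_combination e - 2 * (christoffel G 0 k 0 x + christoffel G 1 k 1 x) * t

/-- The divergence of the stress-bienergy tensor is `2 A(∇f) + f ∇f`. -/
theorem divTensor_stressBienergy (h : IsSurfaceOn c G Ψ N Ω) (hx : x ∈ Ω) (k : Fin 2) :
    divTensor G (stressBienergy c G Ψ) k x =
      2 * (∑ i, ∑ j, (G x)⁻¹ i j * (partialD i (coordMeanCurvature c G Ψ N) x * sff c Ψ N j k x)) +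
        coordMeanCurvature c G Ψ N x * partialD k (coordMeanCurvature c G Ψ N) x := by
  have hf := (h.smooth_meanCurvature hx).diffAt
  have hh := fun i j => (h.smooth_sff hx i j).diffAt
  have hg := fun i j => (h.metric.smooth x hx i j).diffAt
  have hf2 : DifferentiableAt ℝ (fun y => -(1 / 2 * coordMeanCurvature c G Ψ N y ^ 2)) x := by
    simp only [sq]
    exact ((hf.fun_mul hf).const_mul _).neg
  have hf2' : ∀ i, partialD i (fun y => -(1 / 2 * coordMeanCurvature c G Ψ N y ^ 2)) x =
      -(coordMeanCurvature c G Ψ N x * partialD i (coordMeanCurvature c G Ψ N) x) := by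
    intro i
    simp only [sq]
    rw [partialD_neg, partialD_const_mul _ (hf.fun_mul hf), partialD_mul hf hf]
    ring
  have e : ∀ i j, partialD i (stressBienergy c G Ψ j k) x =
      -(1 / 2 * coordMeanCurvature c G Ψ N x ^ 2) * partialD i (fun y => G y j k) x +
      -(coordMeanCurvature c G Ψ N x * partialD i (coordMeanCurvature c G Ψ N) x) * G x j k +
      2 * (coordMeanCurvature c G Ψ N x * partialD i (sff c Ψ N j k) x +
        partialD i (coordMeanCurvature c G Ψ N) x * sff c Ψ N j k x) := by
    intro i j
    rw [← hf2', ← partialD_mul hf (hh j k), ← partialD_mul hf2 (hg j k),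
      ← partialD_const_mul _ (hf.fun_mul (hh j k)),
      ← partialD_add (hf2.fun_mul (hg j k)) ((hf.fun_mul (hh j k)).const_mul 2)]
    apply partialD_congr
    filter_upwards [h.eventually hx] with y hy using h.stressBienergy_eq hy j k
  have hd := h.metric.det_ne_zero hx
  have hsy := h.metric.symm x hx
  obtain ⟨h1, h2, h3, h4⟩ := inv_fin_two (G x)
  -- Total symmetry of ∇h turns the trace derivative into the divergence: div h = df.
  have tr : partialD k (coordMeanCurvature c G Ψ N) x * (G x).det =
      G x 1 1 * covSff c G Ψ N 0 0 k x - G x 0 1 * covSff c G Ψ N 0 1 k x -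
        G x 0 1 * covSff c G Ψ N 1 0 k x + G x 0 0 * covSff c G Ψ N 1 1 k x := by
    rw [h.partialD_meanCurvature hx]
    have a := h.covSff_symm hx
    rw [(a 0 0 k).2, (a 0 k 0).1, (a 0 1 k).2, (a 0 k 1).1, (a 1 0 k).1, (a 0 1 k).2, (a 0 k 1).1,
      (a 1 1 k).2, (a 1 k 1).1]
    ring
  have hs := h.sff_symm hx 1 0
  -- Covariant derivative of -½f²g + 2fh, with ∇g = 0; tracing it and using div h = df gives 2A(∇f)
  -- + f∇f.
  have key : ∀ i j, partialD i (stressBienergy c G Ψ j k) x -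
      (christoffel G 0 i j x * stressBienergy c G Ψ 0 k x +
        christoffel G 0 i k x * stressBienergy c G Ψ j 0 x +
       (christoffel G 1 i j x * stressBienergy c G Ψ 1 k x +
        christoffel G 1 i k x * stressBienergy c G Ψ j 1 x)) =
      -(coordMeanCurvature c G Ψ N x * partialD i (coordMeanCurvature c G Ψ N) x) * G x j k +
      2 * (coordMeanCurvature c G Ψ N x * covSff c G Ψ N i j k x +
        partialD i (coordMeanCurvature c G Ψ N) x * sff c Ψ N j k x) := by
    intro i j
    have hsym : ∀ a b, G x a b = G x b a := by
      intro a b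
      fin_cases a <;> fin_cases b <;> simp [hsy]
    rw [e, h.partialD_metric' hx]
    simp only [h.stressBienergy_eq hx, covSff, hsym k 0, hsym k 1]
    ring
  simp only [divTensor, Fin.sum_univ_two, key, h1, h2, h3, h4, hsy]
  have hdet := h.metric.det_eq hx
  generalize (G x).det = D at *
  field_simp
  fin_cases k <;> simp only [Fin.zero_eta, Fin.mk_one, Fin.isValue, hsy] at tr ⊢
  · linear_combination (-2 * coordMeanCurvature c G Ψ N x) * tr + (coordMeanCurvature c G Ψ N x *
      partialD 0 (coordMeanCurvature c G Ψ N) x) * hdet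
  · linear_combination (-2 * coordMeanCurvature c G Ψ N x) * tr + (coordMeanCurvature c G Ψ N x *
      partialD 1 (coordMeanCurvature c G Ψ N) x) * hdet

end IsSurfaceOn

/-! ### Structure equations of biconservative surfaces -/

section Structure

variable {c : ℝ} {G : E2 → Matrix (Fin 2) (Fin 2) ℝ} {Ψ N : E2 → E4} {Ω : Set E2} {x : E2}
  {θ : Fin 2 → Fin 2 → E2 → ℝ} {f s : E2 → ℝ}

theorem IsCoframeOn.inv_eq (h : IsCoframeOn G θ Ω) (hG : IsMetricOn G Ω) (hx : x ∈ Ω) :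
    (G x)⁻¹ 0 0 = (θ 0 1 x ^ 2 + θ 1 1 x ^ 2) / area θ x ^ 2 ∧
    (G x)⁻¹ 0 1 = -(θ 0 0 x * θ 0 1 x + θ 1 0 x * θ 1 1 x) / area θ x ^ 2 ∧
    (G x)⁻¹ 1 0 = -(θ 0 0 x * θ 0 1 x + θ 1 0 x * θ 1 1 x) / area θ x ^ 2 ∧
    (G x)⁻¹ 1 1 = (θ 0 0 x ^ 2 + θ 1 0 x ^ 2) / area θ x ^ 2 := by
  obtain ⟨h1, h2, h3, h4⟩ := inv_fin_two (G x)
  rw [h1, h2, h3, h4, hG.det_eq hx, h.area_sq hx]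
  simp only [h.gram x hx]
  refine ⟨?_, ?_, ?_, ?_⟩ <;> congr 1 <;> first | trivial | ring

/-- The shape operator of a biconservative surface is diagonal in the coframe adapted to its mean
curvature function, with eigenvalues `-f/2` and `3f/2`. -/
theorem IsSurfaceOn.sff_eq (h : IsSurfaceOn c G Ψ N Ω) (hθ : IsCoframeOn G θ Ω) (hx : x ∈ Ω)
    (hs : s x ≠ 0) (hf : ∀ i, partialD i (coordMeanCurvature c G Ψ N) x = s x * θ 0 i x)
    (hB : ∀ k, 2 * (∑ i, ∑ j, (G x)⁻¹ i j *
      (partialD i (coordMeanCurvature c G Ψ N) x * sff c Ψ N j k x)) +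
        coordMeanCurvature c G Ψ N x * partialD k (coordMeanCurvature c G Ψ N) x = 0) (i j : Fin 2) :
    sff c Ψ N i j x = -(coordMeanCurvature c G Ψ N x / 2) * (θ 0 i x * θ 0 j x) +
      3 * coordMeanCurvature c G Ψ N x / 2 * (θ 1 i x * θ 1 j x) := by
  have hA := hθ.area_ne_zero h.metric hx
  obtain ⟨h1, h2, h3, h4⟩ := hθ.inv_eq h.metric hx
  have tr : coordMeanCurvature c G Ψ N x = ∑ i, ∑ j, (G x)⁻¹ i j * sff c Ψ N i j x := rfl
  have hsym := h.sff_symm hx 1 0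
  have b0 := hB 0
  have b1 := hB 1
  simp only [hf, Fin.sum_univ_two, h1, h2, h3, h4, hsym] at tr b0 b1
  have hA' : θ 0 0 x * θ 1 1 x - θ 0 1 x * θ 1 0 x ≠ 0 := hA
  have hAe : area θ x = θ 0 0 x * θ 1 1 x - θ 0 1 x * θ 1 0 x := rfl
  generalize area θ x = D at *
  generalize coordMeanCurvature c G Ψ N x = f at *
  -- The field dual to θ⁰ is E₁ = (θ¹₁, -θ¹₀)/D. This and `b1'` are the components of h(E₁, ·) =
  -- -(f/2) θ⁰, multiplied by D.
  have b0' : θ 1 1 x * sff c Ψ N 0 0 x - θ 1 0 x * sff c Ψ N 0 1 x = -(f / 2) * θ 0 0 x * D := by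
    field_simp at b0
    apply mul_left_cancel₀ (mul_ne_zero two_ne_zero (mul_ne_zero hs hA))
    rw [hAe] at b0 ⊢
    linear_combination b0
  have b1' : θ 1 1 x * sff c Ψ N 0 1 x - θ 1 0 x * sff c Ψ N 1 1 x = -(f / 2) * θ 0 1 x * D := by
    field_simp at b1
    apply mul_left_cancel₀ (mul_ne_zero two_ne_zero (mul_ne_zero hs hA))
    rw [hAe] at b1 ⊢
    linear_combination b1
  have tr' : (θ 0 1 x ^ 2 + θ 1 1 x ^ 2) * sff c Ψ N 0 0 x -
      2 * (θ 0 0 x * θ 0 1 x + θ 1 0 x * θ 1 1 x) * sff c Ψ N 0 1 x +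
      (θ 0 0 x ^ 2 + θ 1 0 x ^ 2) * sff c Ψ N 1 1 x = f * D ^ 2 := by
    field_simp at tr
    linear_combination -tr
  -- With E₂ = (-θ⁰₁, θ⁰₀)/D this is D² h(E₂, E₂), obtained by subtracting h(E₁, E₁) from the trace.
  have t2 : θ 0 1 x ^ 2 * sff c Ψ N 0 0 x - 2 * (θ 0 0 x * θ 0 1 x) * sff c Ψ N 0 1 x +
      θ 0 0 x ^ 2 * sff c Ψ N 1 1 x = 3 / 2 * f * D ^ 2 := by
    have : f * D ^ 2 = f * D * (θ 0 0 x * θ 1 1 x - θ 0 1 x * θ 1 0 x) := by rw [hAe]; ring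
    linear_combination tr' - θ 1 1 x * b0' + θ 1 0 x * b1' - this / 2
  apply mul_left_cancel₀ (pow_ne_zero 2 hA)
  have key : ∀ p q p' q' : ℝ, D ^ 2 * (p * p' * (-(f / 2)) + q * q' * (3 / 2 * f)) =
      p * p' * (θ 1 1 x ^ 2 * sff c Ψ N 0 0 x - 2 * θ 1 1 x * θ 1 0 x * sff c Ψ N 0 1 x +
        θ 1 0 x ^ 2 * sff c Ψ N 1 1 x) +
      (p * q' + q * p') * (-θ 1 1 x * θ 0 1 x * sff c Ψ N 0 0 x +
        (θ 1 1 x * θ 0 0 x + θ 1 0 x * θ 0 1 x) * sff c Ψ N 0 1 x -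
        θ 1 0 x * θ 0 0 x * sff c Ψ N 1 1 x) +
      q * q' * (θ 0 1 x ^ 2 * sff c Ψ N 0 0 x - 2 * (θ 0 0 x * θ 0 1 x) * sff c Ψ N 0 1 x +
        θ 0 0 x ^ 2 * sff c Ψ N 1 1 x) := by
    intro p q p' q'
    have e : f * D ^ 2 = f * D * (θ 0 0 x * θ 1 1 x - θ 0 1 x * θ 1 0 x) := by rw [hAe]; ring
    linear_combination (-p * p') * (θ 1 1 x * b0' - θ 1 0 x * b1' + e / 2) -
      (p * q' + q * p') * (-θ 0 1 x * b0' + θ 0 0 x * b1') - q * q' * t2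
  have k := key (θ 0 i x) (θ 1 i x) (θ 0 j x) (θ 1 j x)
  rw [show D ^ 2 * (-(f / 2) * (θ 0 i x * θ 0 j x) + 3 * f / 2 * (θ 1 i x * θ 1 j x)) =
    D ^ 2 * (θ 0 i x * θ 0 j x * (-(f / 2)) + θ 1 i x * θ 1 j x * (3 / 2 * f)) by ring, k, hAe]
  clear k key tr tr' b0 b1 b0' b1' t2
  fin_cases i <;> fin_cases j <;> simp only [Fin.zero_eta, Fin.mk_one, Fin.isValue, hsym] <;> ring

/-- The covariant derivative of the second fundamental form in an adapted coframe. -/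
theorem IsSurfaceOn.covSff_eq (h : IsSurfaceOn c G Ψ N Ω) (hθ : IsCoframeOn G θ Ω) (hx : x ∈ Ω)
    (hf : ∀ i, partialD i (coordMeanCurvature c G Ψ N) x = s x * θ 0 i x)
    (hA : ∀ x ∈ Ω, ∀ i j, sff c Ψ N i j x =
      -(coordMeanCurvature c G Ψ N x / 2) * (θ 0 i x * θ 0 j x) +
      3 * coordMeanCurvature c G Ψ N x / 2 * (θ 1 i x * θ 1 j x)) (i j k : Fin 2) :
    covSff c G Ψ N i j k x = -(s x / 2) * θ 0 i x * (θ 0 j x * θ 0 k x) +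
      3 * s x / 2 * θ 0 i x * (θ 1 j x * θ 1 k x) - 2 * coordMeanCurvature c G Ψ N x *
      connForm θ i x * (θ 1 j x * θ 0 k x + θ 0 j x * θ 1 k x) := by
  have hm := (h.smooth_meanCurvature hx).diffAt
  have ht := fun a i => (hθ.smooth x hx a i).diffAt
  have htt := fun a => (ht a j).fun_mul (ht a k)
  have e : partialD i (sff c Ψ N j k) x =
      -(1 / 2) * (coordMeanCurvature c G Ψ N x * (θ 0 j x * partialD i (θ 0 k) x +
        partialD i (θ 0 j) x * θ 0 k x) + s x * θ 0 i x * (θ 0 j x * θ 0 k x)) +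
      3 / 2 * (coordMeanCurvature c G Ψ N x * (θ 1 j x * partialD i (θ 1 k) x +
        partialD i (θ 1 j) x * θ 1 k x) + s x * θ 0 i x * (θ 1 j x * θ 1 k x)) := by
    rw [← hf, ← partialD_mul (ht 0 j) (ht 0 k), ← partialD_mul (ht 1 j) (ht 1 k),
      ← partialD_mul hm (htt 0), ← partialD_mul hm (htt 1),
      ← partialD_const_mul _ (hm.fun_mul (htt 0)), ← partialD_const_mul _ (hm.fun_mul (htt 1)),
      ← partialD_add ((hm.fun_mul (htt 0)).const_mul _) ((hm.fun_mul (htt 1)).const_mul _)]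
    apply partialD_congr
    filter_upwards [h.eventually hx] with y hy
    rw [hA y hy]
    ring
  have cj := hθ.christoffel h.metric hx i j
  have ck := hθ.christoffel h.metric hx i k
  simp only [covSff, e, hA x hx]
  linear_combination (coordMeanCurvature c G Ψ N x / 2 * θ 0 k x) * cj.1 -
    (3 * coordMeanCurvature c G Ψ N x / 2 * θ 1 k x) * cj.2 +
    (coordMeanCurvature c G Ψ N x / 2 * θ 0 j x) * ck.1 -
    (3 * coordMeanCurvature c G Ψ N x / 2 * θ 1 j x) * ck.2

/-- The Codazzi equation of a biconservative surface in an adapted coframe. -/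
theorem IsSurfaceOn.structure_eq (h : IsSurfaceOn c G Ψ N Ω) (hθ : IsCoframeOn G θ Ω) (hx : x ∈ Ω)
    (hf : ∀ i, partialD i (coordMeanCurvature c G Ψ N) x = s x * θ 0 i x)
    (h0 : coordMeanCurvature c G Ψ N x ≠ 0)
    (hA : ∀ x ∈ Ω, ∀ i j, sff c Ψ N i j x =
      -(coordMeanCurvature c G Ψ N x / 2) * (θ 0 i x * θ 0 j x) +
      3 * coordMeanCurvature c G Ψ N x / 2 * (θ 1 i x * θ 1 j x)) :
    extD (θ 0) x = 0 ∧
      extD (θ 1) x = -(3 * s x / (4 * coordMeanCurvature c G Ψ N x)) * area θ x := by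
  have key := fun k => (h.covSff_symm hx 0 1 k).1
  have hD := hθ.area_ne_zero h.metric hx
  simp only [h.covSff_eq hθ hx hf hA] at key
  have w1 : connForm θ 0 x * θ 1 1 x - connForm θ 1 x * θ 1 0 x = extD (θ 0) x := by
    simp only [connForm]; field_simp; simp only [area]; ring
  have w0 : connForm θ 0 x * θ 0 1 x - connForm θ 1 x * θ 0 0 x = -extD (θ 1) x := by
    simp only [connForm]; field_simp; simp only [area]; ring
  -- Codazzi sorted into its θ⁰ and θ¹ parts; independence of the two forms makes both coefficients
  -- vanish.
  have k : ∀ k, θ 0 k x * (2 * coordMeanCurvature c G Ψ N x * extD (θ 0) x) =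
      θ 1 k x * (3 / 2 * s x * area θ x + 2 * coordMeanCurvature c G Ψ N x * extD (θ 1) x) := by
    intro k
    simp only [area]
    linear_combination (-2 * coordMeanCurvature c G Ψ N x * θ 0 k x) * w1 -
      (2 * coordMeanCurvature c G Ψ N x * θ 1 k x) * w0 - key k
  have k0 := k 0
  have k1 := k 1
  constructor
  · apply mul_left_cancel₀ (mul_ne_zero hD (mul_ne_zero two_ne_zero h0))
    rw [mul_zero]
    nth_rw 1 [area]
    linear_combination θ 1 1 x * k0 - θ 1 0 x * k1
  · have : area θ x * (3 / 2 * s x * area θ x + 2 * coordMeanCurvature c G Ψ N x * extD (θ 1) x) = 0 := by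
      nth_rw 1 [area]
      linear_combination θ 0 1 x * k0 - θ 0 0 x * k1
    have := (mul_eq_zero.1 this).resolve_left hD
    field_simp
    linear_combination 2 * this

/-- The Gauss equation of a biconservative surface. -/
theorem IsSurfaceOn.curvature_eq (h : IsSurfaceOn c G Ψ N Ω) (hθ : IsCoframeOn G θ Ω) (hx : x ∈ Ω)
    (hA : ∀ i j, sff c Ψ N i j x =
      -(coordMeanCurvature c G Ψ N x / 2) * (θ 0 i x * θ 0 j x) +
      3 * coordMeanCurvature c G Ψ N x / 2 * (θ 1 i x * θ 1 j x)) :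
    coordGaussCurvature G x = c - 3 / 4 * coordMeanCurvature c G Ψ N x ^ 2 := by
  have e := h.gauss hx
  apply mul_right_cancel₀ (h.metric.det_ne_zero hx)
  rw [e, h.metric.det_eq hx, hθ.area_sq hx]
  simp only [hA, area]
  ring

/-- In an adapted coframe of `f` with closed first form, `|∇f|` is constant along level curves
of `f`. -/
theorem wedge_eq_zero (hθ : ∀ i, ContDiffAt ℝ ∞ (θ 0 i) x) (hsm : ContDiffAt ℝ ∞ s x)
    (hfs : ContDiffAt ℝ ∞ f x)
    (hf : ∀ᶠ y in 𝓝 x, ∀ i, partialD i f y = s y * θ 0 i y) (h0 : extD (θ 0) x = 0) :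
    partialD 0 s x * θ 0 1 x - partialD 1 s x * θ 0 0 x = 0 := by
  have e : ∀ i j, partialD i (partialD j f) x =
      s x * partialD i (θ 0 j) x + partialD i s x * θ 0 j x := by
    intro i j
    rw [← partialD_mul hsm.diffAt (hθ j).diffAt]
    apply partialD_congr
    filter_upwards [hf] with y hy using hy j
  have := partialD_comm hfs 0 1
  rw [e, e] at this
  rw [extD] at h0
  linear_combination this - s x * h0

/-- Under the structure equations, unit speed level curves have curvature `3|∇f|/(4f)`. -/
theorem IsCoframeOn.acceleration_level_curve (h : IsCoframeOn G θ Ω) (hG : IsMetricOn G Ω)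
    {ξ : ℝ → E2} {t κ : ℝ} (ht : ξ t ∈ Ω) (hξ : ContDiffAt ℝ ∞ ξ t)
    (h0 : extD (θ 0) (ξ t) = 0) (h1 : extD (θ 1) (ξ t) = -κ * area θ (ξ t))
    (hu : ∀ᶠ τ in 𝓝 t, alongCurve (θ 0) ξ τ = 0 ∧ alongCurve (θ 1) ξ τ ^ 2 = 1) :
    coordAcceleration G ξ t 0 = κ * (θ 1 1 (ξ t) / area θ (ξ t)) ∧
      coordAcceleration G ξ t 1 = κ * (-θ 1 0 (ξ t) / area θ (ξ t)) := by
  have hD := h.area_ne_zero hG ht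
  obtain ⟨a0, a1⟩ := h.acceleration hG ht hξ
  obtain ⟨u0, u1⟩ := hu.self_of_nhds
  have d0 : deriv (alongCurve (θ 0) ξ) t = 0 := by
    rw [Filter.EventuallyEq.deriv_eq (f := fun _ => 0) (hu.mono fun _ h => h.1)]
    simp
  have d1 : deriv (alongCurve (θ 1) ξ) t = 0 := by
    have hd := (hasDerivAt_alongCurve (h.smooth _ ht 1) hξ).differentiableAt.hasDerivAt
    have e : deriv (fun τ => alongCurve (θ 1) ξ τ ^ 2) t = 0 := by
      rw [Filter.EventuallyEq.deriv_eq (f := fun _ => 1) (hu.mono fun _ h => h.2)]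
      simp
    rw [(hd.fun_pow 2).deriv] at e
    have : alongCurve (θ 1) ξ t ≠ 0 := by
      intro h0
      simp [h0] at u1
    simpa [this] using e
  -- The structure equations say ω = -κ θ¹. With θ¹(ξ') = ±1 the sign is squared away, so both
  -- orientations of the curve give the same acceleration.
  have hw : alongCurve (connForm θ) ξ t = -κ * alongCurve (θ 1) ξ t := by
    simp only [alongCurve, connForm, h0, h1]
    field_simp
    ring
  rw [d0, hw] at a0
  rw [d1, u0] at a1
  have a0' : θ 0 0 (ξ t) * coordAcceleration G ξ t 0 + θ 0 1 (ξ t) * coordAcceleration G ξ t 1 = κ := by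
    linear_combination a0 + κ * u1
  constructor
  · field_simp
    simp only [area]
    linear_combination θ 1 1 (ξ t) * a0' - θ 0 1 (ξ t) * a1
  · field_simp
    simp only [area]
    linear_combination θ 0 0 (ξ t) * a1 - θ 1 0 (ξ t) * a0'

/-- The second structure equation, read off from the acceleration of an integral curve of the
second dual vector field. -/
theorem IsCoframeOn.extD_of_acceleration (h : IsCoframeOn G θ Ω) (hG : IsMetricOn G Ω)
    {ξ : ℝ → E2} {t κ : ℝ} (ht : ξ t ∈ Ω) (hξ : ContDiffAt ℝ ∞ ξ t)
    (hu : ∀ᶠ τ in 𝓝 t, alongCurve (θ 0) ξ τ = 0 ∧ alongCurve (θ 1) ξ τ = 1)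
    (ha : θ 0 0 (ξ t) * coordAcceleration G ξ t 0 + θ 0 1 (ξ t) * coordAcceleration G ξ t 1 = κ) :
    extD (θ 1) (ξ t) = -κ * area θ (ξ t) := by
  have hD := h.area_ne_zero hG ht
  obtain ⟨a0, -⟩ := h.acceleration hG ht hξ
  obtain ⟨u0, u1⟩ := hu.self_of_nhds
  have d0 : deriv (alongCurve (θ 0) ξ) t = 0 := by
    rw [Filter.EventuallyEq.deriv_eq (f := fun _ => 0) (hu.mono fun _ h => h.1)]
    simp
  have hw : alongCurve (connForm θ) ξ t = extD (θ 0) (ξ t) / area θ (ξ t) * alongCurve (θ 0) ξ t +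
      extD (θ 1) (ξ t) / area θ (ξ t) * alongCurve (θ 1) ξ t := by
    simp only [alongCurve, connForm]
    ring
  rw [ha, d0, hw, u0, u1] at a0
  field_simp at a0
  linear_combination a0

end Structure

/-! ### Charts of a Riemannian surface -/

section Charts

variable {M : Type*} [TopologicalSpace M] [ChartedSpace E2 M]

/-- The differential of an inverse chart, as a linear map of the plane. -/
def chartD (φ : OpenPartialHomeomorph M E2) (x : E2) : E2 →L[ℝ] E2 :=
  mfderiv (𝓡 2) (𝓡 2) φ.symm x

/-- The domain of the coordinate change from the chart at `p` to the chart at `q`. -/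
def overlap (p q : M) : Set E2 :=
  (chartAt E2 p).target ∩ (chartAt E2 p).symm ⁻¹' (chartAt E2 q).source

/-- The coordinate change from the chart at `p` to the chart at `q`. -/
def transition (p q : M) (x : E2) : E2 := chartAt E2 q ((chartAt E2 p).symm x)

variable {p q : M} {x : E2}

theorem isOpen_overlap : IsOpen (overlap p q) :=
  (chartAt E2 p).isOpen_inter_preimage_symm (chartAt E2 q).open_source

theorem mem_overlap_self (hx : x ∈ (chartAt E2 p).target) :
    x ∈ overlap p ((chartAt E2 p).symm x) :=
  ⟨hx, mem_chart_source E2 _⟩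

theorem mapsTo_transition : MapsTo (transition p q) (overlap p q) (chartAt E2 q).target :=
  fun _ hx => (chartAt E2 q).map_source hx.2

variable [IsManifold (𝓡 2) ∞ M]

theorem contMDiffAt_chart_symm (hx : x ∈ (chartAt E2 p).target) :
    ContMDiffAt (𝓡 2) (𝓡 2) ∞ (chartAt E2 p).symm x :=
  contMDiffAt_symm_of_mem_maximalAtlas (IsManifold.chart_mem_maximalAtlas p) hx

theorem contMDiffAt_chart {y : M} (hy : y ∈ (chartAt E2 p).source) :
    ContMDiffAt (𝓡 2) (𝓡 2) ∞ (chartAt E2 p) y :=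
  contMDiffAt_of_mem_maximalAtlas (IsManifold.chart_mem_maximalAtlas p) hy

theorem contDiffAt_transition (hx : x ∈ overlap p q) : ContDiffAt ℝ ∞ (transition p q) x := by
  have := (contMDiffAt_chart hx.2).comp x (contMDiffAt_chart_symm hx.1)
  exact this.contDiffAt

/-- Vectors of the tangent space at q are by construction written in the preferred chart at q, so
pointwise definitions and coordinate formulas agree there without a change of basis. -/
theorem chartD_self : chartD (chartAt E2 q) (chartAt E2 q q) = ContinuousLinearMap.id ℝ E2 := by
  have := mfderivWithin_range_extChartAt_symm (I := 𝓡 2) (x := q)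
  simp only [mfld_simps, mfderivWithin_univ] at this
  exact this

theorem fderiv_comp_chart_symm {W : Type*} [NormedAddCommGroup W] [NormedSpace ℝ W] {F : M → W}
    (hx : x ∈ (chartAt E2 p).target)
    (hF : MDifferentiableAt (𝓡 2) 𝓘(ℝ, W) F ((chartAt E2 p).symm x)) (v : E2) :
    fderiv ℝ (F ∘ (chartAt E2 p).symm) x v =
      mfderiv (𝓡 2) 𝓘(ℝ, W) F ((chartAt E2 p).symm x) (chartD (chartAt E2 p) x v) := by
  have h1 := (contMDiffAt_chart_symm hx).mdifferentiableAt (by simp)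
  have := mfderiv_comp x hF h1
  rw [← mfderiv_eq_fderiv, this]
  rfl

theorem chartD_eq (hx : x ∈ overlap p q) (v : E2) :
    chartD (chartAt E2 p) x v = chartD (chartAt E2 q) (transition p q x)
      (fderiv ℝ (transition p q) x v) := by
  have h1 := (contMDiffAt_chart_symm (mapsTo_transition hx)).mdifferentiableAt (by simp)
  have h2 : MDifferentiableAt (𝓡 2) (𝓡 2) (transition p q) x :=
    (contDiffAt_transition hx).diffAt.mdifferentiableAt
  have e : (chartAt E2 q).symm ∘ transition p q =ᶠ[𝓝 x] (chartAt E2 p).symm := by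
    filter_upwards [isOpen_overlap.mem_nhds hx] with y hy
    exact (chartAt E2 q).left_inv hy.2
  have := mfderiv_comp x h1 h2
  rw [← mfderiv_eq_fderiv]
  unfold chartD
  rw [← e.mfderiv_eq, this]
  rfl

variable (g : SurfaceMetric M)

/-- The metric on a tangent space, as a bilinear form on the plane. -/
def ip (q : M) : E2 →L[ℝ] E2 →L[ℝ] ℝ := g.inner q

theorem ip_apply_map {L : E2 →L[ℝ] E2} (v w : E2) :
    ip g q (L v) (L w) = ∑ i, ∑ j, v i * ip g q (L (e i)) (L (e j)) * w j := by
  have h : ∀ v : E2, v = v 0 • e 0 + v 1 • e 1 := by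
    intro v
    ext k
    fin_cases k <;> simp [e]
  conv_lhs => rw [h v, h w]
  simp only [map_add, map_smul, _root_.add_apply, _root_.smul_apply,
    Fin.sum_univ_two, smul_eq_mul]
  ring

theorem metricCoeff_eq (φ : OpenPartialHomeomorph M E2) (x : E2) (i j : Fin 2) :
    metricCoeff g φ x i j = ip g (φ.symm x) (chartD φ x (e i)) (chartD φ x (e j)) := rfl

theorem gram_eq (q : M) : gram g q = metricCoeff g (chartAt E2 q) (chartAt E2 q q) := by
  ext i j
  rw [metricCoeff_eq, chartD_self, (chartAt E2 q).left_inv (mem_chart_source E2 q)]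
  rfl

theorem ip_chartD (φ : OpenPartialHomeomorph M E2) (x : E2) (v w : E2) :
    ip g (φ.symm x) (chartD φ x v) (chartD φ x w) = ∑ i, ∑ j, v i * metricCoeff g φ x i j * w j :=
  ip_apply_map g v w

/-- Smoothness of g is a statement about a bundle section. It is evaluated on the coordinate fields,
which are smooth sections along the inverse chart because they come from its tangent map. -/
theorem contDiffAt_metricCoeff (hx : x ∈ (chartAt E2 p).target) (i j : Fin 2) :
    ContDiffAt ℝ ∞ (fun y => metricCoeff g (chartAt E2 p) y i j) x := by
  have hφ : ContMDiffAt (𝓡 2) (𝓡 2) ∞ (chartAt E2 p).symm x := contMDiffAt_chart_symm hx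
  have hv : ∀ i, ContMDiffAt (𝓡 2) (𝓡 2).tangent ∞
      (fun y => (⟨(chartAt E2 p).symm y, mfderiv (𝓡 2) (𝓡 2) (chartAt E2 p).symm y (e i)⟩ :
        TangentBundle (𝓡 2) M)) x := by
    intro i
    have h1 : ContMDiffOn (𝓡 2) (𝓡 2) ∞ (chartAt E2 p).symm (chartAt E2 p).target :=
      fun y hy => (contMDiffAt_chart_symm hy).contMDiffWithinAt
    have h2 := h1.contMDiffOn_tangentMapWithin (m := ∞) (by simp)
      (chartAt E2 p).open_target.uniqueMDiffOn
    have h3 : ContMDiffAt (𝓡 2) (𝓡 2).tangent ∞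
        (fun y : E2 => (⟨y, e i⟩ : TangentBundle (𝓡 2) E2)) x :=
      contMDiffAt_vectorSpace_iff_contDiffAt.2 contDiffAt_const
    have h4 : ContMDiffAt (𝓡 2).tangent (𝓡 2).tangent ∞
        (tangentMapWithin (𝓡 2) (𝓡 2) (chartAt E2 p).symm (chartAt E2 p).target)
        (⟨x, e i⟩ : TangentBundle (𝓡 2) E2) := by
      refine (h2 _ hx).contMDiffAt ?_
      exact ((chartAt E2 p).open_target.preimage
        (FiberBundle.continuous_proj E2 (TangentSpace (𝓡 2)))).mem_nhds hx
    have h5 := ContMDiffAt.comp x h4 h3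
    refine h5.congr_of_eventuallyEq ?_
    filter_upwards [(chartAt E2 p).open_target.mem_nhds hx] with y hy
    simp only [Function.comp, tangentMapWithin]
    rw [mfderivWithin_of_isOpen (chartAt E2 p).open_target hy]
  have hg : ContMDiffAt (𝓡 2) ((𝓡 2).prod 𝓘(ℝ, E2 →L[ℝ] E2 →L[ℝ] ℝ)) ∞
      (fun y => TotalSpace.mk' (E2 →L[ℝ] E2 →L[ℝ] ℝ)
        (E := fun b : M => TangentSpace (𝓡 2) b →L[ℝ] TangentSpace (𝓡 2) b →L[ℝ] ℝ)
        ((chartAt E2 p).symm y) (g.inner ((chartAt E2 p).symm y))) x :=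
    ContMDiffAt.comp x g.contMDiff.contMDiffAt hφ
  have key : ContMDiffAt (𝓡 2) ((𝓡 2).prod 𝓘(ℝ)) ∞
      (fun y => TotalSpace.mk' ℝ (E := Bundle.Trivial M ℝ) ((chartAt E2 p).symm y)
        (g.inner ((chartAt E2 p).symm y) (mfderiv (𝓡 2) (𝓡 2) (chartAt E2 p).symm y (e i))
          (mfderiv (𝓡 2) (𝓡 2) (chartAt E2 p).symm y (e j)))) x :=
    ContMDiffAt.clm_bundle_apply₂ (F₁ := E2) (F₂ := E2) hg (hv i) (hv j)
  rw [contMDiffAt_totalSpace] at key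
  exact key.2.contDiffAt

end Charts

/-! ### Behaviour under isometries of coordinate domains -/

section Covariance

variable {c : ℝ} {G G' : E2 → Matrix (Fin 2) (Fin 2) ℝ} {Θ : E2 → E2} {Ω Ω' : Set E2} {y : E2}
  {Ψ N Ψ' N' : E2 → E4}

theorem IsIsometryOn.det_eq (hΘ : IsIsometryOn G G' Θ Ω Ω') (hy : y ∈ Ω') :
    (G' y).det = jacobian Θ y ^ 2 * (G (Θ y)).det := by
  simp only [Matrix.det_fin_two, hΘ.eq y hy, Fin.sum_univ_two, jacobian]
  ring

theorem IsIsometryOn.jacobian_ne_zero (hΘ : IsIsometryOn G G' Θ Ω Ω') (hG' : IsMetricOn G' Ω')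
    (hy : y ∈ Ω') : jacobian Θ y ≠ 0 := by
  intro h
  apply hG'.det_ne_zero hy
  rw [hΘ.det_eq hy, h]
  simp

theorem IsIsometryOn.dualNormSq_pullback (hΘ : IsIsometryOn G G' Θ Ω Ω') (hG : IsMetricOn G Ω)
    (hG' : IsMetricOn G' Ω') (hy : y ∈ Ω') {α α' : Fin 2 → E2 → ℝ}
    (hα : ∀ i, α' i y = pullback Θ α i y) :
    dualNormSq G' α' y = dualNormSq G α (Θ y) := by
  have hJ := hΘ.jacobian_ne_zero hG' hy
  have hd := hG.det_ne_zero (hΘ.mapsTo hy)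
  have e1 := hG'.dualNormSq_mul_det (α := α') hy
  have e2 := hG.dualNormSq_mul_det (α := α) (hΘ.mapsTo hy)
  have hs := hG.symm _ (hΘ.mapsTo hy)
  apply mul_right_cancel₀ (hG'.det_ne_zero hy)
  rw [e1, hΘ.det_eq hy]
  simp only [hα, hΘ.eq y hy, Fin.sum_univ_two, pullback, hs]
  simp only [jacobian]
  linear_combination (-(partialD 0 Θ y 0 * partialD 1 Θ y 1 - partialD 1 Θ y 0 * partialD 0 Θ y 1) ^ 2)
    * e2

theorem partialD_comp_of_eventuallyEq {W : Type*} [NormedAddCommGroup W] [NormedSpace ℝ W]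
    {F F' : E2 → W} (hF : DifferentiableAt ℝ F (Θ y)) (hΘ : DifferentiableAt ℝ Θ y)
    (h : F' =ᶠ[𝓝 y] F ∘ Θ) (i : Fin 2) : partialD i F' y =
      partialD i Θ y 0 • partialD 0 F (Θ y) + partialD i Θ y 1 • partialD 1 F (Θ y) := by
  rw [partialD_congr h, ← partialD_comp_map hF hΘ]
  rfl

theorem sff_comp (hΘ : DifferentiableAt ℝ Θ y) (hΨ : DifferentiableAt ℝ Ψ (Θ y))
    (hN : DifferentiableAt ℝ N (Θ y)) (hΨ' : Ψ' =ᶠ[𝓝 y] Ψ ∘ Θ) (hN' : N' =ᶠ[𝓝 y] N ∘ Θ)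
    (i j : Fin 2) : sff c Ψ' N' i j y =
      ∑ k, ∑ l, partialD i Θ y k * sff c Ψ N k l (Θ y) * partialD j Θ y l := by
  simp only [sff, partialD_comp_of_eventuallyEq hΨ hΘ hΨ',
    partialD_comp_of_eventuallyEq hN hΘ hN', form_add_left, form_add_right, form_smul_left,
    form_smul_right, Fin.sum_univ_two]
  ring

theorem IsMetricOn.coordMeanCurvature_mul_det (hG : IsMetricOn G Ω) (hy : y ∈ Ω) :
    coordMeanCurvature c G Ψ N y * (G y).det = G y 1 1 * sff c Ψ N 0 0 y -
      G y 0 1 * (sff c Ψ N 0 1 y + sff c Ψ N 1 0 y) + G y 0 0 * sff c Ψ N 1 1 y := by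
  obtain ⟨h1, h2, h3, h4⟩ := inv_fin_two (G y)
  have hd := hG.det_ne_zero hy
  simp only [coordMeanCurvature, Fin.sum_univ_two, h1, h2, h3, h4, hG.symm y hy]
  field_simp
  ring

/-- Both the metric and the second fundamental form are pulled back by Θ. After multiplication by
the determinants the two traces differ by the squared Jacobian. -/
theorem IsIsometryOn.coordMeanCurvature_eq (hΘ : IsIsometryOn G G' Θ Ω Ω') (hG : IsMetricOn G Ω)
    (hG' : IsMetricOn G' Ω') (hy : y ∈ Ω') (hΨ : DifferentiableAt ℝ Ψ (Θ y))
    (hN : DifferentiableAt ℝ N (Θ y)) (hΨ' : Ψ' =ᶠ[𝓝 y] Ψ ∘ Θ) (hN' : N' =ᶠ[𝓝 y] N ∘ Θ) :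
    coordMeanCurvature c G' Ψ' N' y = coordMeanCurvature c G Ψ N (Θ y) := by
  have e2 := hG.coordMeanCurvature_mul_det (c := c) (Ψ := Ψ) (N := N) (hΘ.mapsTo hy)
  have hs := hG.symm _ (hΘ.mapsTo hy)
  apply mul_right_cancel₀ (hG'.det_ne_zero hy)
  rw [hG'.coordMeanCurvature_mul_det hy, hΘ.det_eq hy]
  simp only [sff_comp (hΘ.smooth y hy).diffAt hΨ hN hΨ' hN', hΘ.eq y hy, Fin.sum_univ_two, hs]
  simp only [jacobian]
  linear_combination (-(partialD 0 Θ y 0 * partialD 1 Θ y 1 - partialD 1 Θ y 0 * partialD 0 Θ y 1) ^ 2)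
    * e2

/-- The one-form `2 A(∇f) + f ∇f`, the divergence of the stress-bienergy tensor. -/
def biconsForm (c : ℝ) (G : E2 → Matrix (Fin 2) (Fin 2) ℝ) (Ψ N : E2 → E4) (k : Fin 2) (x : E2) : ℝ :=
  2 * (∑ i, ∑ j, (G x)⁻¹ i j * (partialD i (coordMeanCurvature c G Ψ N) x * sff c Ψ N j k x)) +
    coordMeanCurvature c G Ψ N x * partialD k (coordMeanCurvature c G Ψ N) x

theorem IsMetricOn.biconsForm_mul_det (hG : IsMetricOn G Ω) (hy : y ∈ Ω) (k : Fin 2) :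
    biconsForm c G Ψ N k y * (G y).det =
      2 * (G y 1 1 * (partialD 0 (coordMeanCurvature c G Ψ N) y * sff c Ψ N 0 k y) -
      G y 0 1 * (partialD 0 (coordMeanCurvature c G Ψ N) y * sff c Ψ N 1 k y +
        partialD 1 (coordMeanCurvature c G Ψ N) y * sff c Ψ N 0 k y) +
      G y 0 0 * (partialD 1 (coordMeanCurvature c G Ψ N) y * sff c Ψ N 1 k y)) +
      (G y).det * (coordMeanCurvature c G Ψ N y * partialD k (coordMeanCurvature c G Ψ N) y) := by
  obtain ⟨h1, h2, h3, h4⟩ := inv_fin_two (G y)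
  have hd := hG.det_ne_zero hy
  simp only [biconsForm, Fin.sum_univ_two, h1, h2, h3, h4, hG.symm y hy]
  field_simp
  ring

theorem IsIsometryOn.biconsForm_eq (hΘ : IsIsometryOn G G' Θ Ω Ω') (hG : IsMetricOn G Ω)
    (hG' : IsMetricOn G' Ω') (hy : y ∈ Ω') (hΨ : DifferentiableAt ℝ Ψ (Θ y))
    (hN : DifferentiableAt ℝ N (Θ y)) (hΨ' : Ψ' =ᶠ[𝓝 y] Ψ ∘ Θ) (hN' : N' =ᶠ[𝓝 y] N ∘ Θ)
    (hf : DifferentiableAt ℝ (coordMeanCurvature c G Ψ N) (Θ y))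
    (hff : coordMeanCurvature c G' Ψ' N' =ᶠ[𝓝 y] coordMeanCurvature c G Ψ N ∘ Θ) (k : Fin 2) :
    biconsForm c G' Ψ' N' k y = partialD k Θ y 0 * biconsForm c G Ψ N 0 (Θ y) +
      partialD k Θ y 1 * biconsForm c G Ψ N 1 (Θ y) := by
  have hT := (hΘ.smooth y hy).diffAt
  have e0 := hG.biconsForm_mul_det (c := c) (Ψ := Ψ) (N := N) (hΘ.mapsTo hy) 0
  have e1 := hG.biconsForm_mul_det (c := c) (Ψ := Ψ) (N := N) (hΘ.mapsTo hy) 1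
  have hs := hG.symm _ (hΘ.mapsTo hy)
  apply mul_right_cancel₀ (hG'.det_ne_zero hy)
  rw [hG'.biconsForm_mul_det hy, hΘ.det_eq hy, hff.self_of_nhds]
  simp only [sff_comp hT hΨ hN hΨ' hN', partialD_comp_of_eventuallyEq hf hT hff, hΘ.eq y hy,
    Fin.sum_univ_two, hs, smul_eq_mul, Function.comp]
  simp only [jacobian]
  linear_combination (-(partialD 0 Θ y 0 * partialD 1 Θ y 1 - partialD 1 Θ y 0 * partialD 0 Θ y 1) ^ 2)
    * (partialD k Θ y 0 * e0 + partialD k Θ y 1 * e1)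

end Covariance

/-! ### Geometric quantities in charts -/

section Charts

variable {M : Type*} [TopologicalSpace M] [ChartedSpace E2 M] [IsManifold (𝓡 2) ∞ M]
  {g : SurfaceMetric M} {p q : M} {x : E2}

theorem chartD_injective (hx : x ∈ (chartAt E2 p).target) :
    Function.Injective (chartD (chartAt E2 p) x) :=
  (mdifferentiable_chart (I := 𝓡 2) p).symm.mfderiv_injective hx

theorem ip_symm (v w : E2) : ip g q v w = ip g q w v := g.symm q v w

theorem ip_pos {v : E2} (hv : v ≠ 0) : 0 < ip g q v v := g.pos q v hv

theorem isMetricOn_metricCoeff (g : SurfaceMetric M) (p : M) :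
    IsMetricOn (metricCoeff g (chartAt E2 p)) (chartAt E2 p).target := by
  have hs : ∀ x, metricCoeff g (chartAt E2 p) x 1 0 = metricCoeff g (chartAt E2 p) x 0 1 :=
    fun x => ip_symm _ _
  have hp : ∀ x ∈ (chartAt E2 p).target, ∀ v : E2, v ≠ 0 →
      0 < v 0 * metricCoeff g (chartAt E2 p) x 0 0 * v 0 +
        2 * (v 0 * metricCoeff g (chartAt E2 p) x 0 1 * v 1) +
        v 1 * metricCoeff g (chartAt E2 p) x 1 1 * v 1 := by
    intro x hx v hv
    have h1 : chartD (chartAt E2 p) x v ≠ 0 := by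
      rw [Ne, map_eq_zero_iff _ (chartD_injective hx)]
      exact hv
    have h2 := ip_pos (g := g) (q := (chartAt E2 p).symm x) h1
    rw [ip_chartD] at h2
    simp only [Fin.sum_univ_two, hs] at h2
    linarith
  have h0 : ∀ x ∈ (chartAt E2 p).target, 0 < metricCoeff g (chartAt E2 p) x 0 0 := by
    intro x hx
    have hv : e 0 ≠ 0 := fun h => by simpa [e] using congrArg (fun v : E2 => v 0) h
    have := hp x hx (e 0) hv
    simpa [e] using this
  refine ⟨(chartAt E2 p).open_target, fun x hx => contDiffAt_metricCoeff g hx, fun x _ => hs x, h0,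
    fun x hx => ?_⟩
  have h00 := h0 x hx
  -- On this vector the quadratic form takes the value g₀₀ · det.
  have hv : !₂[-metricCoeff g (chartAt E2 p) x 0 1, metricCoeff g (chartAt E2 p) x 0 0] ≠ 0 := by
    intro h
    have := congrArg (fun v : E2 => v 1) h
    simp at this
    exact h00.ne' this
  have := hp x hx _ hv
  simp at this
  refine pos_of_mul_pos_right (a := metricCoeff g (chartAt E2 p) x 0 0) ?_ h00.le
  linarith

theorem isIsometryOn_transition (g : SurfaceMetric M) (p q : M) :
    IsIsometryOn (metricCoeff g (chartAt E2 q)) (metricCoeff g (chartAt E2 p)) (transition p q)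
      (chartAt E2 q).target (overlap p q) := by
  refine ⟨mapsTo_transition, fun x hx => contDiffAt_transition hx, fun x hx i j => ?_⟩
  have h : (chartAt E2 p).symm x = (chartAt E2 q).symm (transition p q x) :=
    ((chartAt E2 q).left_inv hx.2).symm
  rw [metricCoeff_eq, chartD_eq hx, chartD_eq hx, h, ip_chartD]
  rfl

theorem isMetricOn_overlap (g : SurfaceMetric M) (p q : M) :
    IsMetricOn (metricCoeff g (chartAt E2 p)) (overlap p q) :=
  (isMetricOn_metricCoeff g p).mono inter_subset_left isOpen_overlap

omit [IsManifold (𝓡 2) ∞ M] in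
theorem transition_self (x : E2) :
    transition p ((chartAt E2 p).symm x) x =
      chartAt E2 ((chartAt E2 p).symm x) ((chartAt E2 p).symm x) := rfl

/-- The definition switches charts from point to point. This expresses K near p in a single chart,
which is what makes it differentiable by formula. -/
theorem gaussCurvature_eq (hx : x ∈ (chartAt E2 p).target) :
    gaussCurvature g ((chartAt E2 p).symm x) =
      coordGaussCurvature (metricCoeff g (chartAt E2 p)) x :=
  ((isIsometryOn_transition g p _).coordGaussCurvature_eq (isMetricOn_metricCoeff g _)
    (isMetricOn_overlap g p _) (mem_overlap_self hx)).symm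

section Functions

variable {W : Type*} [NormedAddCommGroup W] [NormedSpace ℝ W] {F : M → W}

theorem contMDiffAt_of_chart (hx : x ∈ (chartAt E2 p).target)
    (hF : ContDiffAt ℝ ∞ (F ∘ (chartAt E2 p).symm) x) :
    ContMDiffAt (𝓡 2) 𝓘(ℝ, W) ∞ F ((chartAt E2 p).symm x) := by
  have h1 := contMDiffAt_chart ((chartAt E2 p).map_target hx)
  have h2 : ContMDiffAt (𝓡 2) 𝓘(ℝ, W) ∞ (F ∘ (chartAt E2 p).symm)
      (chartAt E2 p ((chartAt E2 p).symm x)) := by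
    rw [(chartAt E2 p).right_inv hx]
    exact hF.contMDiffAt
  refine (h2.comp _ h1).congr_of_eventuallyEq ?_
  filter_upwards [(chartAt E2 p).open_source.mem_nhds ((chartAt E2 p).map_target hx)] with y hy
  simp [(chartAt E2 p).left_inv hy]

theorem contDiffAt_comp_chart (hx : x ∈ (chartAt E2 p).target)
    (hF : ContMDiffAt (𝓡 2) 𝓘(ℝ, W) ∞ F ((chartAt E2 p).symm x)) :
    ContDiffAt ℝ ∞ (F ∘ (chartAt E2 p).symm) x :=
  (hF.comp x (contMDiffAt_chart_symm hx)).contDiffAt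

theorem mfderiv_eq_partialD
    (hF : MDifferentiableAt (𝓡 2) 𝓘(ℝ, W) F q) (i : Fin 2) :
    mfderiv (𝓡 2) 𝓘(ℝ, W) F q (e i) = partialD i (F ∘ (chartAt E2 q).symm) (chartAt E2 q q) := by
  have h := (chartAt E2 q).left_inv (mem_chart_source E2 q)
  have := fderiv_comp_chart_symm (F := F) (mem_chart_target E2 q) (by rwa [h]) (e i)
  rw [chartD_self, h] at this
  exact this.symm

omit [IsManifold (𝓡 2) ∞ M] [NormedAddCommGroup W] [NormedSpace ℝ W] in
theorem comp_chart_eventuallyEq (F : M → W) (hx : x ∈ overlap p q) :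
    F ∘ (chartAt E2 p).symm =ᶠ[𝓝 x] (F ∘ (chartAt E2 q).symm) ∘ transition p q := by
  filter_upwards [isOpen_overlap.mem_nhds hx] with y hy
  simp [transition, (chartAt E2 q).left_inv hy.2]

omit [IsManifold (𝓡 2) ∞ M] in
theorem symm_transition (hx : x ∈ overlap p q) :
    (chartAt E2 q).symm (transition p q x) = (chartAt E2 p).symm x :=
  (chartAt E2 q).left_inv hx.2

theorem contDiffAt_transition_iff (hx : x ∈ overlap p q)
    (hF : ContDiffAt ℝ ∞ (F ∘ (chartAt E2 p).symm) x) :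
    ContDiffAt ℝ ∞ (F ∘ (chartAt E2 q).symm) (transition p q x) := by
  apply contDiffAt_comp_chart (mapsTo_transition hx)
  rw [symm_transition hx]
  exact contMDiffAt_of_chart hx.1 hF

end Functions

/-- The components of the differential of a function in the basis `e 0`, `e 1`. -/
def dcomp (u : M → ℝ) (q : M) (i : Fin 2) : ℝ := mfderiv (𝓡 2) 𝓘(ℝ, ℝ) u q (e i)

/-- The gradient of a function, as a vector of the plane. -/
def gradE (g : SurfaceMetric M) (u : M → ℝ) (q : M) : E2 := grad g u q

theorem gnorm_grad_eq (u : M → ℝ) :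
    gnorm g (grad g u q) = √(ip g q (gradE g u q) (gradE g u q)) := rfl

theorem ip_grad {u : M → ℝ} (v : E2) :
    ip g q (gradE g u q) v = ∑ i, dcomp u q i * v i := by
  have hG := isMetricOn_metricCoeff g q
  have hx := mem_chart_target E2 q
  have h := ip_apply_map g (q := q) (L := ContinuousLinearMap.id ℝ E2) (gradE g u q) v
  have hg : ∀ i j, ip g q (e i) (e j) = gram g q i j := fun _ _ => rfl
  simp only [ContinuousLinearMap.id_apply, hg] at h
  rw [h]
  obtain ⟨h1, h2, h3, h4⟩ := inv_fin_two (gram g q)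
  have hd : (gram g q).det ≠ 0 := by rw [gram_eq]; exact hG.det_ne_zero hx
  have hs : gram g q 1 0 = gram g q 0 1 := by rw [gram_eq]; exact hG.symm _ hx
  have hgr : ∀ i, (gradE g u q) i = ∑ j, (gram g q)⁻¹ i j * dcomp u q j :=
    fun i => rfl
  simp only [Fin.sum_univ_two, hgr, h1, h2, h3, h4, hs]
  have hdet : (gram g q).det = gram g q 0 0 * gram g q 1 1 - gram g q 0 1 ^ 2 := by
    rw [Matrix.det_fin_two, hs]; ring
  generalize (gram g q).det = D at *
  field_simp
  rw [hdet]
  ring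

theorem gnorm_grad_own (u : M → ℝ) :
    ip g q (gradE g u q) (gradE g u q) =
      dualNormSq (metricCoeff g (chartAt E2 q)) (fun i _ => dcomp u q i) (chartAt E2 q q) := by
  rw [ip_grad]
  have hgr : ∀ i, (gradE g u q) i = ∑ j, (gram g q)⁻¹ i j * dcomp u q j := fun i => rfl
  simp only [hgr, dualNormSq, ← gram_eq, Finset.mul_sum]
  exact Finset.sum_congr rfl fun i _ => Finset.sum_congr rfl fun j _ => by ring

theorem gnorm_grad {u : M → ℝ} (hx : x ∈ (chartAt E2 p).target)
    (hu : ContDiffAt ℝ ∞ (u ∘ (chartAt E2 p).symm) x) :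
    gnorm g (grad g u ((chartAt E2 p).symm x)) =
      √(dualNormSq (metricCoeff g (chartAt E2 p))
        (fun i => partialD i (u ∘ (chartAt E2 p).symm)) x) := by
  have ho := mem_overlap_self hx
  have hu' := contDiffAt_transition_iff ho hu
  have h1 := (contMDiffAt_of_chart hx hu).mdifferentiableAt (by simp)
  rw [gnorm_grad_eq, gnorm_grad_own]
  congr 1
  rw [(isIsometryOn_transition g p ((chartAt E2 p).symm x)).dualNormSq_pullback
    (isMetricOn_metricCoeff g _) (isMetricOn_overlap g p _) ho
    (α := fun i _ => dcomp u ((chartAt E2 p).symm x) i)]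
  · rfl
  · intro i
    rw [partialD_comp_of_eventuallyEq hu'.diffAt (contDiffAt_transition ho).diffAt
      (comp_chart_eventuallyEq u ho)]
    have h2 := fun i => mfderiv_eq_partialD h1 i
    simp only [pullback, smul_eq_mul, dcomp, h2, transition_self]
    ring

/-- The gradient and the differential have the same norm, which is chart independent, and both norms
are definite. -/
theorem gradE_ne_zero_iff {u : M → ℝ} (hx : x ∈ (chartAt E2 p).target)
    (hu : ContDiffAt ℝ ∞ (u ∘ (chartAt E2 p).symm) x) :
    gradE g u ((chartAt E2 p).symm x) ≠ 0 ↔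
      partialD 0 (u ∘ (chartAt E2 p).symm) x ≠ 0 ∨ partialD 1 (u ∘ (chartAt E2 p).symm) x ≠ 0 := by
  have h1 := (contMDiffAt_of_chart hx hu).mdifferentiableAt (by simp)
  have hG := isMetricOn_metricCoeff g p
  have e : √(dualNormSq (metricCoeff g (chartAt E2 p))
        (fun i => partialD i (u ∘ (chartAt E2 p).symm)) x) =
      √(ip g ((chartAt E2 p).symm x) (gradE g u ((chartAt E2 p).symm x))
        (gradE g u ((chartAt E2 p).symm x))) := (gnorm_grad hx hu).symm
  constructor
  · intro h
    by_contra h0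
    push Not at h0
    have h2 := ip_pos (g := g) (q := (chartAt E2 p).symm x) h
    rw [← Real.sqrt_pos, ← e] at h2
    simp [dualNormSq, h0] at h2
  · intro h h0
    have h2 := Real.sqrt_pos.2 (hG.dualNormSq_pos hx
      (α := fun i => partialD i (u ∘ (chartAt E2 p).symm)) h)
    simp [e, h0] at h2

end Charts

/-! ### Surfaces in space forms in charts -/

section ChartSurface

variable {M : Type*} [TopologicalSpace M] [ChartedSpace E2 M] [IsManifold (𝓡 2) ∞ M]
  {g : SurfaceMetric M} {c : ℝ} {ψ η : M → E4} {U : Set M} {p q : M} {x : E2}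

/-- The part of the domain of coordinates of the chart at `p` that corresponds to `U`. -/
def chartDom (p : M) (U : Set M) : Set E2 :=
  (chartAt E2 p).target ∩ (chartAt E2 p).symm ⁻¹' U

omit [IsManifold (𝓡 2) ∞ M] in
theorem isOpen_chartDom (hU : IsOpen U) : IsOpen (chartDom p U) :=
  (chartAt E2 p).isOpen_inter_preimage_symm hU

theorem diff_chartD {F : M → E4} (hx : x ∈ (chartAt E2 p).target)
    (hF : MDifferentiableAt (𝓡 2) 𝓘(ℝ, E4) F ((chartAt E2 p).symm x)) (i : Fin 2) :
    diff F ((chartAt E2 p).symm x) (chartD (chartAt E2 p) x (e i)) =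
      partialD i (F ∘ (chartAt E2 p).symm) x :=
  (fderiv_comp_chart_symm hx hF (e i)).symm

/-- A surface in a space form, in the coordinates of a chart. -/
theorem isSurfaceOn_of_embedding (hU : IsOpen U) (hψ : IsIsometricEmbeddingOn g c ψ U)
    (hη : IsUnitNormalOn c ψ η U) (p : M) :
    IsSurfaceOn c (metricCoeff g (chartAt E2 p)) (ψ ∘ (chartAt E2 p).symm)
      (η ∘ (chartAt E2 p).symm) (chartDom p U) := by
  have h1 : ∀ x ∈ chartDom p U, ContMDiffAt (𝓡 2) 𝓘(ℝ, E4) ∞ ψ ((chartAt E2 p).symm x) :=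
    fun x hx => hψ.smooth.contMDiffAt (hU.mem_nhds hx.2)
  have h2 : ∀ x ∈ chartDom p U, ContMDiffAt (𝓡 2) 𝓘(ℝ, E4) ∞ η ((chartAt E2 p).symm x) :=
    fun x hx => hη.smooth.contMDiffAt (hU.mem_nhds hx.2)
  have h3 := fun x (hx : x ∈ chartDom p U) i =>
    diff_chartD hx.1 ((h1 x hx).mdifferentiableAt (by simp)) i
  refine ⟨(isMetricOn_metricCoeff g p).mono inter_subset_left (isOpen_chartDom hU),
    fun x hx => contDiffAt_comp_chart hx.1 (h1 x hx), fun x hx => contDiffAt_comp_chart hx.1 (h2 x hx),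
    fun x hx => hψ.mapsTo hx.2, fun x hx i j => ?_, fun x hx => hη.tangent _ hx.2,
    fun x hx i => ?_, fun x hx => hη.unit _ hx.2⟩
  · rw [← h3 x hx, ← h3 x hx]
    exact hψ.isometric _ hx.2 _ _
  · rw [← h3 x hx]
    exact hη.normal _ hx.2 _

theorem meanCurvature_own (hψ : MDifferentiableAt (𝓡 2) 𝓘(ℝ, E4) ψ q)
    (hη : MDifferentiableAt (𝓡 2) 𝓘(ℝ, E4) η q) :
    meanCurvature g c ψ η q = coordMeanCurvature c (metricCoeff g (chartAt E2 q))
      (ψ ∘ (chartAt E2 q).symm) (η ∘ (chartAt E2 q).symm) (chartAt E2 q q) := by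
  have hs : ∀ i j, secondFundForm c ψ η q i j =
      sff c (ψ ∘ (chartAt E2 q).symm) (η ∘ (chartAt E2 q).symm) i j (chartAt E2 q q) := by
    intro i j
    rw [sff, ← mfderiv_eq_partialD hψ, ← mfderiv_eq_partialD hη]
    rfl
  have hG := (isMetricOn_metricCoeff g q).symm _ (mem_chart_target E2 q)
  obtain ⟨-, h2, h3, -⟩ := inv_fin_two (metricCoeff g (chartAt E2 q) (chartAt E2 q q))
  rw [hG] at h3
  simp only [meanCurvature, Matrix.trace, Matrix.diag, Matrix.mul_apply, hs, gram_eq,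
    coordMeanCurvature, Fin.sum_univ_two, h2, h3]
  ring

theorem meanCurvature_eq (hU : IsOpen U) (hψ : IsIsometricEmbeddingOn g c ψ U)
    (hη : IsUnitNormalOn c ψ η U) (hx : x ∈ chartDom p U) :
    meanCurvature g c ψ η ((chartAt E2 p).symm x) =
      coordMeanCurvature c (metricCoeff g (chartAt E2 p)) (ψ ∘ (chartAt E2 p).symm)
        (η ∘ (chartAt E2 p).symm) x := by
  have ho := mem_overlap_self hx.1
  have h1 := hψ.smooth.contMDiffAt (hU.mem_nhds hx.2)
  have h2 := hη.smooth.contMDiffAt (hU.mem_nhds hx.2)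
  have h3 := contDiffAt_transition_iff ho (contDiffAt_comp_chart hx.1 h1)
  have h4 := contDiffAt_transition_iff ho (contDiffAt_comp_chart hx.1 h2)
  rw [meanCurvature_own (h1.mdifferentiableAt (by simp)) (h2.mdifferentiableAt (by simp))]
  exact ((isIsometryOn_transition g p _).coordMeanCurvature_eq (isMetricOn_metricCoeff g _)
    (isMetricOn_overlap g p _) ho h3.diffAt h4.diffAt (comp_chart_eventuallyEq ψ ho)
    (comp_chart_eventuallyEq η ho)).symm

omit [IsManifold (𝓡 2) ∞ M] in
theorem transition_mem_chartDom (hx : x ∈ chartDom p U) (ho : x ∈ overlap p q) :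
    transition p q x ∈ chartDom q U :=
  ⟨mapsTo_transition ho, by
    rw [mem_preimage, symm_transition ho]
    exact hx.2⟩

/-- The divergence of the stress-bienergy tensor vanishes in all charts as soon as it does in
one. -/
theorem divTensor_eq_zero_iff (hU : IsOpen U) (hψ : IsIsometricEmbeddingOn g c ψ U)
    (hη : IsUnitNormalOn c ψ η U) (hx : x ∈ chartDom p U) :
    (∀ k, biconsForm c (metricCoeff g (chartAt E2 p)) (ψ ∘ (chartAt E2 p).symm)
        (η ∘ (chartAt E2 p).symm) k x = 0) ↔
      ∀ k, divTensor (metricCoeff g (chartAt E2 ((chartAt E2 p).symm x)))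
        (stressBienergy c (metricCoeff g (chartAt E2 ((chartAt E2 p).symm x)))
        (ψ ∘ (chartAt E2 ((chartAt E2 p).symm x)).symm)) k
        (chartAt E2 ((chartAt E2 p).symm x) ((chartAt E2 p).symm x)) = 0 := by
  have ho := mem_overlap_self hx.1
  set q := (chartAt E2 p).symm x with hq
  have hS := isSurfaceOn_of_embedding hU hψ hη p
  have hS' := isSurfaceOn_of_embedding hU hψ hη q
  have hy := transition_mem_chartDom hx ho
  have hI := isIsometryOn_transition g p q
  have hG := isMetricOn_metricCoeff g q
  have hG' := isMetricOn_overlap g p q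
  have hf : coordMeanCurvature c (metricCoeff g (chartAt E2 p)) (ψ ∘ (chartAt E2 p).symm)
      (η ∘ (chartAt E2 p).symm) =ᶠ[𝓝 x] coordMeanCurvature c (metricCoeff g (chartAt E2 q))
      (ψ ∘ (chartAt E2 q).symm) (η ∘ (chartAt E2 q).symm) ∘ transition p q := by
    filter_upwards [isOpen_overlap.mem_nhds ho, (isOpen_chartDom hU).mem_nhds hx] with z hz hz'
    rw [← meanCurvature_eq hU hψ hη hz', Function.comp,
      ← meanCurvature_eq hU hψ hη (transition_mem_chartDom hz' hz), symm_transition hz]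
  have key := hI.biconsForm_eq hG hG' ho (hS'.smooth _ hy).diffAt (hS'.smooth_normal _ hy).diffAt
    (comp_chart_eventuallyEq ψ ho) (comp_chart_eventuallyEq η ho)
    (hS'.smooth_meanCurvature hy).diffAt hf
  have hJ := hI.jacobian_ne_zero hG' ho
  have e : ∀ k, divTensor (metricCoeff g (chartAt E2 q)) (stressBienergy c
      (metricCoeff g (chartAt E2 q)) (ψ ∘ (chartAt E2 q).symm)) k (chartAt E2 q q) =
      biconsForm c (metricCoeff g (chartAt E2 q)) (ψ ∘ (chartAt E2 q).symm)
        (η ∘ (chartAt E2 q).symm) k (transition p q x) :=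
    fun k => hS'.divTensor_stressBienergy hy k
  simp only [e, key]
  constructor
  · intro h
    -- The transpose of the invertible Jacobian matrix annihilates only the zero form.
    have h0 := h 0
    have h1 := h 1
    intro k
    apply mul_left_cancel₀ hJ
    rw [mul_zero, jacobian]
    fin_cases k
    · simp only [Fin.zero_eta]
      linear_combination partialD 1 (transition p q) x 1 * h0 - partialD 0 (transition p q) x 1 * h1
    · simp only [Fin.mk_one]
      linear_combination partialD 0 (transition p q) x 0 * h1 - partialD 1 (transition p q) x 0 * h0
  · intro h k
    simp [h]

end ChartSurface

/-! ### The local geometric condition -/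

section Special

variable {c : ℝ} {G : E2 → Matrix (Fin 2) (Fin 2) ℝ} {Ψ N : E2 → E4} {Ω : Set E2} {x : E2}
  {θ : Fin 2 → Fin 2 → E2 → ℝ} {f s : E2 → ℝ}

/-- The metric `G` has curvature `c - 3f²/4`, and `θ` is an orthonormal coframe adapted to the
positive function `f` with `df = s θ⁰`. -/
structure IsAdaptedOn (c : ℝ) (G : E2 → Matrix (Fin 2) (Fin 2) ℝ) (θ : Fin 2 → Fin 2 → E2 → ℝ)
    (f s : E2 → ℝ) (Ω : Set E2) : Prop where
  metric : IsMetricOn G Ω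
  coframe : IsCoframeOn G θ Ω
  smooth : ∀ x ∈ Ω, ContDiffAt ℝ ∞ f x
  smooth_speed : ∀ x ∈ Ω, ContDiffAt ℝ ∞ s x
  pos : ∀ x ∈ Ω, 0 < f x
  speed_pos : ∀ x ∈ Ω, 0 < s x
  partialD_eq : ∀ x ∈ Ω, ∀ i, partialD i f x = s x * θ 0 i x
  curvature : ∀ x ∈ Ω, coordGaussCurvature G x = c - 3 / 4 * f x ^ 2

/-- The level curves of `f` have geodesic curvature `3|∇f|/(4f)`, which is expressed by the
structure equations of the adapted coframe. -/
structure IsSpecialOn (c : ℝ) (G : E2 → Matrix (Fin 2) (Fin 2) ℝ) (θ : Fin 2 → Fin 2 → E2 → ℝ)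
    (f s : E2 → ℝ) (Ω : Set E2) : Prop extends IsAdaptedOn c G θ f s Ω where
  closed : ∀ x ∈ Ω, extD (θ 0) x = 0
  extD_eq : ∀ x ∈ Ω, extD (θ 1) x = -(3 * s x / (4 * f x)) * area θ x

theorem IsMetricOn.sqrt_dualNormSq_mul (hG : IsMetricOn G Ω) (hx : x ∈ Ω) {α : Fin 2 → E2 → ℝ}
    (h0 : α 0 x ≠ 0 ∨ α 1 x ≠ 0) (i : Fin 2) :
    α i x = √(dualNormSq G α x) * Bicons.adaptedCoframe G α 0 i x := by
  have := (Real.sqrt_pos.2 (hG.dualNormSq_pos hx h0)).ne'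
  rw [adaptedCoframe_zero]
  field_simp

/-- Collects, in the coframe adapted to the mean curvature function, the eigenvalues of A, the
Codazzi equation and the Gauss equation; from here on the immersion is no longer used. -/
theorem IsSurfaceOn.isSpecialOn (h : IsSurfaceOn c G Ψ N Ω)
    (hf : ∀ x ∈ Ω, 0 < coordMeanCurvature c G Ψ N x)
    (hd : ∀ x ∈ Ω, partialD 0 (coordMeanCurvature c G Ψ N) x ≠ 0 ∨
      partialD 1 (coordMeanCurvature c G Ψ N) x ≠ 0)
    (hB : ∀ x ∈ Ω, ∀ k, biconsForm c G Ψ N k x = 0) :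
    IsSpecialOn c G (adaptedCoframe G fun i => partialD i (coordMeanCurvature c G Ψ N))
      (coordMeanCurvature c G Ψ N)
      (fun x => √(dualNormSq G (fun i => partialD i (coordMeanCurvature c G Ψ N)) x)) Ω := by
  have hs := fun x (hx : x ∈ Ω) => h.smooth_meanCurvature hx
  have hW := fun x (hx : x ∈ Ω) => h.metric.dualNormSq_pos
    (α := fun i => partialD i (coordMeanCurvature c G Ψ N)) hx (hd x hx)
  have hθ := h.metric.adaptedCoframe (fun x hx i => (hs x hx).partialD i) hd
  have hp : ∀ x ∈ Ω, ∀ i, partialD i (coordMeanCurvature c G Ψ N) x =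
      √(dualNormSq G (fun i => partialD i (coordMeanCurvature c G Ψ N)) x) *
        adaptedCoframe G (fun i => partialD i (coordMeanCurvature c G Ψ N)) 0 i x :=
    fun x hx i => h.metric.sqrt_dualNormSq_mul
      (α := fun i => partialD i (coordMeanCurvature c G Ψ N)) hx (hd x hx) i
  have hA := fun x hx i j => h.sff_eq (s := fun x => √(dualNormSq G
    (fun i => partialD i (coordMeanCurvature c G Ψ N)) x)) hθ hx
    (Real.sqrt_pos.2 (hW x hx)).ne' (hp x hx) (hB x hx) i j
  have hstr := fun x hx => h.structure_eq (s := fun x => √(dualNormSq G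
    (fun i => partialD i (coordMeanCurvature c G Ψ N)) x)) hθ hx (hp x hx) (hf x hx).ne' hA
  exact ⟨⟨h.metric, hθ, hs, fun x hx => (h.metric.smooth_dualNormSq hx
    (fun i => (hs x hx).partialD i)).sqrt (hW x hx).ne', hf, fun x hx => Real.sqrt_pos.2 (hW x hx),
    hp, fun x hx => h.curvature_eq hθ hx (hA x hx)⟩, fun x hx => (hstr x hx).1,
    fun x hx => (hstr x hx).2⟩

theorem IsCoframeOn.dualNormSq_smul (h : IsCoframeOn G θ Ω) (hG : IsMetricOn G Ω) (hx : x ∈ Ω)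
    {α : Fin 2 → E2 → ℝ} {a : ℝ} (hα : ∀ i, α i x = a * θ 0 i x) :
    dualNormSq G α x = a ^ 2 := by
  have hD := h.area_ne_zero hG hx
  obtain ⟨h1, h2, h3, h4⟩ := h.inv_eq hG hx
  simp only [dualNormSq, Fin.sum_univ_two, h1, h2, h3, h4, hα]
  have hA : area θ x = θ 0 0 x * θ 1 1 x - θ 0 1 x * θ 1 0 x := rfl
  generalize area θ x = D at *
  field_simp
  rw [hA]
  ring

/-- Raising the index of a θ⁰ gives a E₁, with E₁ = (θ¹₁, -θ¹₀)/area. -/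
theorem IsCoframeOn.inv_mulVec (h : IsCoframeOn G θ Ω) (hG : IsMetricOn G Ω) (hx : x ∈ Ω)
    {α : Fin 2 → ℝ} {a : ℝ} (hα : ∀ i, α i = a * θ 0 i x) :
    ((G x)⁻¹ *ᵥ α) 0 = a * (θ 1 1 x / area θ x) ∧ ((G x)⁻¹ *ᵥ α) 1 = a * (-θ 1 0 x / area θ x) := by
  have hD := h.area_ne_zero hG hx
  obtain ⟨h1, h2, h3, h4⟩ := h.inv_eq hG hx
  simp only [Matrix.mulVec, dotProduct, Fin.sum_univ_two, h1, h2, h3, h4, hα]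
  have hA : area θ x = θ 0 0 x * θ 1 1 x - θ 0 1 x * θ 1 0 x := rfl
  generalize area θ x = D at *
  constructor <;> field_simp <;> rw [hA] <;> ring

theorem IsAdaptedOn.mono (h : IsAdaptedOn c G θ f s Ω) {Ω' : Set E2} (hs : Ω' ⊆ Ω)
    (ho : IsOpen Ω') : IsAdaptedOn c G θ f s Ω' :=
  ⟨h.metric.mono hs ho, ⟨fun x hx => h.coframe.smooth x (hs hx), fun x hx => h.coframe.gram x (hs hx)⟩,
    fun x hx => h.smooth x (hs hx), fun x hx => h.smooth_speed x (hs hx), fun x hx => h.pos x (hs hx),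
    fun x hx => h.speed_pos x (hs hx), fun x hx => h.partialD_eq x (hs hx),
    fun x hx => h.curvature x (hs hx)⟩

namespace IsAdaptedOn

variable (h : IsAdaptedOn c G θ f s Ω)
include h

theorem partialD_curvature (hx : x ∈ Ω) (i : Fin 2) :
    partialD i (coordGaussCurvature G) x = -(3 / 2 * f x * s x) * θ 0 i x := by
  have hf := (h.smooth x hx).diffAt
  have e : coordGaussCurvature G =ᶠ[𝓝 x] fun y => c - 3 / 4 * (f y * f y) := by
    filter_upwards [h.metric.isOpen.mem_nhds hx] with y hy
    rw [h.curvature y hy, sq]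
  rw [partialD_congr e, partialD_sub (differentiableAt_const c) ((hf.fun_mul hf).const_mul _),
    partialD_const, partialD_const_mul _ (hf.fun_mul hf), partialD_mul hf hf, h.partialD_eq x hx]
  ring

theorem sqrt_dualNormSq (hx : x ∈ Ω) :
    √(dualNormSq G (fun i => partialD i (coordGaussCurvature G)) x) = 3 / 2 * f x * s x := by
  have := h.pos x hx
  have := h.speed_pos x hx
  rw [h.coframe.dualNormSq_smul (α := fun i => partialD i (coordGaussCurvature G)) h.metric hx
    (h.partialD_curvature hx), neg_sq,
    Real.sqrt_sq (by positivity)]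

/-- A unit speed curve in a level set of the curvature is tangent to the kernel of `θ⁰`. -/
theorem alongCurve_of_level {ξ : ℝ → E2} {t : ℝ} (ht : ξ t ∈ Ω) (hξ : ContDiffAt ℝ ∞ ξ t)
    {k : ℝ} (hk : ∀ᶠ τ in 𝓝 t, coordGaussCurvature G (ξ τ) = k) : alongCurve (θ 0) ξ t = 0 := by
  have hd := hasDerivAt_comp_curve (h.metric.smooth_curvature ht).diffAt hξ.diffAt.hasDerivAt
  have h0 := hd.unique ((hasDerivAt_const t k).congr_of_eventuallyEq hk)
  simp only [h.partialD_curvature ht, smul_eq_mul] at h0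
  have hf := (h.pos _ ht).ne'
  have hs := (h.speed_pos _ ht).ne'
  have : 3 / 2 * f (ξ t) * s (ξ t) * alongCurve (θ 0) ξ t = 0 := by
    rw [alongCurve]
    linear_combination -h0
  simpa [hf, hs] using this

end IsAdaptedOn

/-- On the kernel of θ⁰ both df = s θ⁰ and ds vanish, the latter because ds ∧ θ⁰ = 0. -/
theorem IsSpecialOn.alongCurve_speed (h : IsSpecialOn c G θ f s Ω)
    {ξ : ℝ → E2} {t : ℝ} (ht : ξ t ∈ Ω) (hξ : ContDiffAt ℝ ∞ ξ t)
    (hu : alongCurve (θ 0) ξ t = 0) : HasDerivAt (fun τ => 3 * s (ξ τ) / (4 * f (ξ τ))) 0 t := by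
  have hf := (h.pos _ ht).ne'
  have d1 := hasDerivAt_comp_curve (h.smooth_speed _ ht).diffAt hξ.diffAt.hasDerivAt
  have d2 := hasDerivAt_comp_curve (h.smooth _ ht).diffAt hξ.diffAt.hasDerivAt
  have w := wedge_eq_zero (h.coframe.smooth _ ht 0) (h.smooth_speed _ ht) (h.smooth _ ht)
    (by filter_upwards [h.metric.isOpen.mem_nhds ht] with y hy using h.partialD_eq y hy)
    (h.closed _ ht)
  have hD := h.coframe.area_ne_zero h.metric ht
  simp only [smul_eq_mul] at d1 d2
  rw [alongCurve] at hu
  have e2 : deriv ξ t 0 * partialD 0 f (ξ t) + deriv ξ t 1 * partialD 1 f (ξ t) = 0 := by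
    rw [h.partialD_eq _ ht, h.partialD_eq _ ht]
    linear_combination s (ξ t) * hu
  have e1 : deriv ξ t 0 * partialD 0 s (ξ t) + deriv ξ t 1 * partialD 1 s (ξ t) = 0 := by
    apply mul_left_cancel₀ hD
    rw [mul_zero, area]
    linear_combination (partialD 0 s (ξ t) * θ 1 1 (ξ t) - partialD 1 s (ξ t) * θ 1 0 (ξ t)) * hu +
      (θ 1 0 (ξ t) * deriv ξ t 0 + θ 1 1 (ξ t) * deriv ξ t 1) * (-w)
  rw [e1] at d1
  rw [e2] at d2
  have := (d1.const_mul 3).fun_div (d2.const_mul 4) (by simpa using hf)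
  simpa using this

end Special

/-! ### Level curves of the curvature -/

section LevelCurves

variable {M : Type*} [TopologicalSpace M] [ChartedSpace E2 M] [IsManifold (𝓡 2) ∞ M]
  {g : SurfaceMetric M} {c : ℝ} {p q : M} {x : E2} {γ : ℝ → M} {t : ℝ}

/-- The metric `g` satisfies the local geometric condition near `p`. -/
def IsSpecialAt (g : SurfaceMetric M) (c : ℝ) (p : M) : Prop :=
  ∃ (Ω : Set E2) (θ : Fin 2 → Fin 2 → E2 → ℝ) (f s : E2 → ℝ), Ω ⊆ (chartAt E2 p).target ∧
    chartAt E2 p p ∈ Ω ∧ IsSpecialOn c (metricCoeff g (chartAt E2 p)) θ f s Ω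

/-- Moves the four parts of the embedding hypothesis into the chart at p, where the coordinate
theory of surfaces applies. -/
theorem LocallyEmbedsBiconservatively.isSpecialAt (h : LocallyEmbedsBiconservatively g c) (p : M) :
    IsSpecialAt g c p := by
  obtain ⟨U, hU, hp, ψ, η, hψ, hη, hB, hf⟩ := h p
  have hS := isSurfaceOn_of_embedding hU hψ hη p
  refine ⟨chartDom p U, _, _, _, inter_subset_left, ⟨mem_chart_target E2 p, ?_⟩,
    hS.isSpecialOn ?_ ?_ ?_⟩
  · rwa [mem_preimage, (chartAt E2 p).left_inv (mem_chart_source E2 p)]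
  · intro x hx
    rw [← meanCurvature_eq hU hψ hη hx]
    exact (hf _ hx.2).1
  · intro x hx
    have e : meanCurvature g c ψ η ∘ (chartAt E2 p).symm =ᶠ[𝓝 x]
        coordMeanCurvature c (metricCoeff g (chartAt E2 p)) (ψ ∘ (chartAt E2 p).symm)
          (η ∘ (chartAt E2 p).symm) := by
      filter_upwards [(isOpen_chartDom hU).mem_nhds hx] with y hy
      exact meanCurvature_eq hU hψ hη hy
    have := (gradE_ne_zero_iff (g := g) hx.1
      ((hS.smooth_meanCurvature hx).congr_of_eventuallyEq e)).1 (hf _ hx.2).2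
    rwa [partialD_congr e, partialD_congr e] at this
  · intro x hx
    exact (divTensor_eq_zero_iff hU hψ hη hx).2 (hB _ hx.2)

/-- The velocity of a curve, as a vector of the plane. -/
def velE (γ : ℝ → M) (t : ℝ) : E2 := velocity γ t

theorem velE_eq (hγ : MDifferentiableAt 𝓘(ℝ, ℝ) (𝓡 2) γ t) (ht : γ t ∈ (chartAt E2 p).source) :
    velE γ t = chartD (chartAt E2 p) (chartAt E2 p (γ t))
      (deriv (fun τ => chartAt E2 p (γ τ)) t) := by
  have hx := (chartAt E2 p).map_source ht
  have h1 := (contMDiffAt_chart_symm hx).mdifferentiableAt (by simp)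
  have h2 : MDifferentiableAt 𝓘(ℝ, ℝ) (𝓡 2) (fun τ => chartAt E2 p (γ τ)) t :=
    ((contMDiffAt_chart ht).mdifferentiableAt (by simp)).comp t hγ
  have e : (chartAt E2 p).symm ∘ (fun τ => chartAt E2 p (γ τ)) =ᶠ[𝓝 t] γ := by
    filter_upwards [hγ.continuousAt.preimage_mem_nhds ((chartAt E2 p).open_source.mem_nhds ht)]
      with τ hτ
    exact (chartAt E2 p).left_inv hτ
  have h3 := mfderiv_comp t h1 h2
  rw [← fderiv_apply_one_eq_deriv, ← mfderiv_eq_fderiv, velE, velocity, ← e.mfderiv_eq, h3]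
  rfl

theorem gnorm_velocity : gnorm g (velocity γ t) = √(ip g (γ t) (velE γ t) (velE γ t)) := rfl

/-- The acceleration of a curve, as a vector of the plane. -/
def accE (g : SurfaceMetric M) (γ : ℝ → M) (t : ℝ) : E2 := acceleration g γ t

theorem accE_apply (k : Fin 2) : (accE g γ t) k =
    coordAcceleration (metricCoeff g (chartAt E2 (γ t))) (fun τ => chartAt E2 (γ t) (γ τ)) t k := rfl

theorem contDiffAt_chart_curve (hγ : ContMDiffAt 𝓘(ℝ, ℝ) (𝓡 2) ∞ γ t)
    (ht : γ t ∈ (chartAt E2 p).source) : ContDiffAt ℝ ∞ (fun τ => chartAt E2 p (γ τ)) t :=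
  ((contMDiffAt_chart ht).comp t hγ).contDiffAt

theorem ip_velE {Ω : Set E2} {θ : Fin 2 → Fin 2 → E2 → ℝ}
    (hθ : IsCoframeOn (metricCoeff g (chartAt E2 p)) θ Ω)
    (hγ : MDifferentiableAt 𝓘(ℝ, ℝ) (𝓡 2) γ t) (ht : γ t ∈ (chartAt E2 p).source)
    (hΩ : chartAt E2 p (γ t) ∈ Ω) : ip g (γ t) (velE γ t) (velE γ t) =
      alongCurve (θ 0) (fun τ => chartAt E2 p (γ τ)) t ^ 2 +
        alongCurve (θ 1) (fun τ => chartAt E2 p (γ τ)) t ^ 2 := by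
  rw [velE_eq hγ ht]
  conv_lhs => rw [show ip g (γ t) = ip g ((chartAt E2 p).symm (chartAt E2 p (γ t))) by
    rw [(chartAt E2 p).left_inv ht]]
  rw [ip_chartD]
  simp only [Fin.sum_univ_two, hθ.gram _ hΩ, alongCurve]
  ring

theorem gaussCurvature_comp_eventuallyEq (hx : x ∈ (chartAt E2 p).target) :
    gaussCurvature g ∘ (chartAt E2 p).symm =ᶠ[𝓝 x]
      coordGaussCurvature (metricCoeff g (chartAt E2 p)) := by
  filter_upwards [(chartAt E2 p).open_target.mem_nhds hx] with y hy
  exact gaussCurvature_eq hy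

theorem contDiffAt_gaussCurvature (hx : x ∈ (chartAt E2 p).target) :
    ContDiffAt ℝ ∞ (gaussCurvature g ∘ (chartAt E2 p).symm) x :=
  ((isMetricOn_metricCoeff g p).smooth_curvature hx).congr_of_eventuallyEq
    (gaussCurvature_comp_eventuallyEq hx)

theorem dcomp_gaussCurvature (i : Fin 2) : dcomp (gaussCurvature g) p i =
    partialD i (coordGaussCurvature (metricCoeff g (chartAt E2 p))) (chartAt E2 p p) := by
  have hx := mem_chart_target E2 p
  have h := contMDiffAt_of_chart hx (contDiffAt_gaussCurvature (g := g) hx)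
  rw [(chartAt E2 p).left_inv (mem_chart_source E2 p)] at h
  rw [dcomp, mfderiv_eq_partialD (h.mdifferentiableAt (by simp)),
    partialD_congr (gaussCurvature_comp_eventuallyEq hx)]

/-- The function `3|∇K|/(8(c - K))`. -/
def levelCurvature (g : SurfaceMetric M) (c : ℝ) (q : M) : ℝ :=
  3 * gnorm g (grad g (gaussCurvature g) q) / (8 * (c - gaussCurvature g q))

section

variable {Ω : Set E2} {θ : Fin 2 → Fin 2 → E2 → ℝ} {f s : E2 → ℝ}
  (h : IsAdaptedOn c (metricCoeff g (chartAt E2 p)) θ f s Ω)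
include h

theorem IsAdaptedOn.gnorm_grad_gaussCurvature (hx : x ∈ Ω) (hΩ : Ω ⊆ (chartAt E2 p).target) :
    gnorm g (grad g (gaussCurvature g) ((chartAt E2 p).symm x)) = 3 / 2 * f x * s x := by
  have e : ∀ i, partialD i (gaussCurvature g ∘ (chartAt E2 p).symm) x =
      partialD i (coordGaussCurvature (metricCoeff g (chartAt E2 p))) x :=
    fun i => partialD_congr (gaussCurvature_comp_eventuallyEq (hΩ hx))
  rw [gnorm_grad (hΩ hx) (contDiffAt_gaussCurvature (hΩ hx)), ← h.sqrt_dualNormSq hx]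
  simp only [dualNormSq, e]

/-- Since |∇K| = 3fs/2 and c - K = 3f²/4, the quotient 3|∇K|/(8(c - K)) is (9fs/2)/(6f²). -/
theorem IsAdaptedOn.levelCurvature_eq (hx : x ∈ Ω) (hΩ : Ω ⊆ (chartAt E2 p).target) :
    levelCurvature g c ((chartAt E2 p).symm x) = 3 * s x / (4 * f x) := by
  have hf := (h.pos x hx).ne'
  rw [levelCurvature, h.gnorm_grad_gaussCurvature hx hΩ, gaussCurvature_eq (hΩ hx),
    h.curvature x hx]
  rw [sub_sub_cancel]
  field_simp
  ring

/-- K decreases as f grows, so ∇K is a negative multiple of E₁; this is the source of the sign in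
the normal -∇K/|∇K|. -/
theorem IsAdaptedOn.gradE_gaussCurvature (hp : chartAt E2 p p ∈ Ω) :
    (gradE g (gaussCurvature g) p) 0 = -(3 / 2 * f (chartAt E2 p p) * s (chartAt E2 p p)) *
        (θ 1 1 (chartAt E2 p p) / area θ (chartAt E2 p p)) ∧
      (gradE g (gaussCurvature g) p) 1 = -(3 / 2 * f (chartAt E2 p p) * s (chartAt E2 p p)) *
        (-θ 1 0 (chartAt E2 p p) / area θ (chartAt E2 p p)) := by
  have := h.coframe.inv_mulVec h.metric hp (α := dcomp (gaussCurvature g) p)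
    fun i => (dcomp_gaussCurvature i).trans (h.partialD_curvature hp i)
  rwa [← gram_eq] at this

end

theorem IsSpecialAt.pos (h : IsSpecialAt g c p) : 0 < c - gaussCurvature g p := by
  obtain ⟨Ω, θ, f, s, -, hp, h⟩ := h
  have e : gaussCurvature g p = _ := h.curvature _ hp
  have := h.pos _ hp
  rw [e, sub_sub_cancel]
  positivity

theorem IsSpecialAt.gradE_ne_zero (h : IsSpecialAt g c p) : gradE g (gaussCurvature g) p ≠ 0 := by
  obtain ⟨Ω, θ, f, s, hΩ, hp, h⟩ := h
  intro h0
  have e := h.gnorm_grad_gaussCurvature hp hΩ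
  have h1 := h.pos _ hp
  have h2 := h.speed_pos _ hp
  have h3 : 0 < 3 / 2 * f (chartAt E2 p p) * s (chartAt E2 p p) := by positivity
  rw [(chartAt E2 p).left_inv (mem_chart_source E2 p), gnorm_grad_eq, h0] at e
  simp [← e] at h3

theorem gnorm_normal {u : M → ℝ} (h : gradE g u q ≠ 0) :
    gnorm g (-(gnorm g (grad g u q))⁻¹ • grad g u q) = 1 := by
  have hp := ip_pos (g := g) (q := q) h
  have hn : gnorm g (grad g u q) = √(ip g q (gradE g u q) (gradE g u q)) := rfl
  have : gnorm g (-(gnorm g (grad g u q))⁻¹ • grad g u q) =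
    √(ip g q (-(gnorm g (grad g u q))⁻¹ • gradE g u q) (-(gnorm g (grad g u q))⁻¹ • gradE g u q)) := rfl
  rw [this, hn]
  have h2 := Real.sq_sqrt hp.le
  have h3 := (Real.sqrt_pos.2 hp).ne'
  simp only [map_smul, _root_.smul_apply, smul_eq_mul]
  rw [Real.sqrt_eq_one]
  nth_rw 3 [← h2]
  field_simp

theorem levelCurvesAreCircles_of_isSpecialAt (h : ∀ p, IsSpecialAt g c p) :
    LevelCurvesAreCircles g (gaussCurvature g) (levelCurvature g c) := by
  intro γ a b hab hγ ⟨k, hk⟩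
  have hsm : ∀ t ∈ Ioo a b, ContMDiffAt 𝓘(ℝ, ℝ) (𝓡 2) ∞ γ t :=
    fun t ht => hγ.1.contMDiffAt (isOpen_Ioo.mem_nhds ht)
  -- Pointwise in t, in the chart at γ t: a level curve satisfies θ⁰(γ') = 0 and θ¹(γ')² = 1, which
  -- is all that the structure equations need.
  have key : ∀ t ∈ Ioo a b, HasDerivAt (fun τ => levelCurvature g c (γ τ)) 0 t ∧
      ip g (γ t) (gradE g (gaussCurvature g) (γ t)) (velE γ t) = 0 ∧
      accE g γ t = levelCurvature g c (γ t) •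
        (-(gnorm g (grad g (gaussCurvature g) (γ t)))⁻¹ • gradE g (gaussCurvature g) (γ t)) := by
    intro t ht
    obtain ⟨Ω, θ, f, s, hΩ, hp, hS⟩ := h (γ t)
    set ξ : ℝ → E2 := fun τ => chartAt E2 (γ t) (γ τ) with hξdef
    have hξ : ContDiffAt ℝ ∞ ξ t := contDiffAt_chart_curve (hsm t ht) (mem_chart_source E2 _)
    have hev : ∀ᶠ τ in 𝓝 t, τ ∈ Ioo a b ∧ γ τ ∈ (chartAt E2 (γ t)).source ∧ ξ τ ∈ Ω := by
      filter_upwards [isOpen_Ioo.mem_nhds ht, (hsm t ht).continuousAt.preimage_mem_nhds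
        ((chartAt E2 (γ t)).open_source.mem_nhds (mem_chart_source E2 _)),
        hξ.continuousAt.preimage_mem_nhds (hS.metric.isOpen.mem_nhds hp)] with τ h1 h2 h3
      exact ⟨h1, h2, h3⟩
    have hinv : ∀ τ, γ τ ∈ (chartAt E2 (γ t)).source → (chartAt E2 (γ t)).symm (ξ τ) = γ τ :=
      fun τ hτ => (chartAt E2 (γ t)).left_inv hτ
    have hK : ∀ᶠ τ in 𝓝 t, coordGaussCurvature (metricCoeff g (chartAt E2 (γ t))) (ξ τ) = k := by
      filter_upwards [hev] with τ hτ
      rw [← gaussCurvature_eq (hΩ hτ.2.2), hinv τ hτ.2.1]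
      exact hk τ hτ.1
    have hu : ∀ᶠ τ in 𝓝 t, alongCurve (θ 0) ξ τ = 0 ∧ alongCurve (θ 1) ξ τ ^ 2 = 1 := by
      filter_upwards [hev, hK.eventually_nhds] with τ hτ hτK
      have h0 : alongCurve (θ 0) ξ τ = 0 := hS.alongCurve_of_level hτ.2.2
        (contDiffAt_chart_curve (hsm τ hτ.1) hτ.2.1) hτK
      refine ⟨h0, ?_⟩
      have h1 : √(ip g (γ τ) (velE γ τ) (velE γ τ)) = 1 := hγ.2 τ hτ.1
      rw [Real.sqrt_eq_one, ip_velE hS.coframe ((hsm τ hτ.1).mdifferentiableAt (by simp)) hτ.2.1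
        hτ.2.2] at h1
      have h2 : alongCurve (θ 0) ξ τ ^ 2 + alongCurve (θ 1) ξ τ ^ 2 = 1 := h1
      rw [h0] at h2
      linarith
    have hf : f (ξ t) ≠ 0 := (hS.pos _ hp).ne'
    have hs : s (ξ t) ≠ 0 := (hS.speed_pos _ hp).ne'
    obtain ⟨g0, g1⟩ : _ = -(3 / 2 * f (ξ t) * s (ξ t)) * (θ 1 1 (ξ t) / area θ (ξ t)) ∧
      _ = -(3 / 2 * f (ξ t) * s (ξ t)) * (-θ 1 0 (ξ t) / area θ (ξ t)) :=
      hS.gradE_gaussCurvature hp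
    have hx0 : (chartAt E2 (γ t)).symm (chartAt E2 (γ t) (γ t)) = γ t :=
      (chartAt E2 (γ t)).left_inv (mem_chart_source E2 _)
    refine ⟨?_, ?_, ?_⟩
    · refine (hS.alongCurve_speed hp hξ hu.self_of_nhds.1).congr_of_eventuallyEq ?_
      filter_upwards [hev] with τ hτ
      rw [← hS.levelCurvature_eq hτ.2.2 hΩ, hinv τ hτ.2.1]
    · rw [ip_grad, velE_eq ((hsm t ht).mdifferentiableAt (by simp)) (mem_chart_source E2 (γ t)),
        chartD_self]
      have := hu.self_of_nhds.1
      rw [alongCurve] at this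
      simp only [dcomp_gaussCurvature, hS.partialD_curvature hp, Fin.sum_univ_two,
        ContinuousLinearMap.id_apply]
      linear_combination -(3 / 2 * f (ξ t) * s (ξ t)) * this
    · obtain ⟨a0, a1⟩ := hS.coframe.acceleration_level_curve hS.metric hp hξ (hS.closed _ hp)
        (hS.extD_eq _ hp) hu
      have e1 : _ = 3 / 2 * f (ξ t) * s (ξ t) := hS.gnorm_grad_gaussCurvature hp hΩ
      have e2 : _ = 3 * s (ξ t) / (4 * f (ξ t)) := hS.levelCurvature_eq hp hΩ
      rw [hx0] at e1 e2
      rw [e1, e2]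
      ext i
      rw [accE_apply]
      fin_cases i
      · refine a0.trans ?_
        simp only [Fin.zero_eta, PiLp.smul_apply, smul_eq_mul, g0]
        field_simp
      · refine a1.trans ?_
        simp only [Fin.mk_one, PiLp.smul_apply, smul_eq_mul, g1]
        field_simp
  obtain ⟨t0, ht0⟩ := nonempty_Ioo.2 hab
  have hconst : ∀ t ∈ Ioo a b, levelCurvature g c (γ t) = levelCurvature g c (γ t0) := by
    intro t ht
    exact isOpen_Ioo.is_const_of_deriv_eq_zero isPreconnected_Ioo
      (fun τ hτ => (key τ hτ).1.differentiableAt.differentiableWithinAt)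
      (fun τ hτ => (key τ hτ).1.deriv) ht ht0
  refine ⟨levelCurvature g c (γ t0), hconst, hγ, fun t ht => ⟨gnorm_normal (h (γ t)).gradE_ne_zero,
    ?_, ?_⟩⟩
  · have h1 := (key t ht).2.1
    have h2 : ip g (γ t) (-(gnorm g (grad g (gaussCurvature g) (γ t)))⁻¹ •
        gradE g (gaussCurvature g) (γ t)) (velE γ t) = 0 := by
      simp [h1]
    exact h2
  · rw [← hconst t ht]
    exact (key t ht).2.2

end LevelCurves

/-! ### Integral curves -/

/-- A smooth vector field has smooth integral curves. -/
theorem exists_smooth_integralCurve {E : Type*} [NormedAddCommGroup E] [NormedSpace ℝ E]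
    [CompleteSpace E] {V : E → E} {Ω : Set E} {x : E} (hΩ : IsOpen Ω)
    (hV : ∀ y ∈ Ω, ContDiffAt ℝ ∞ V y) (hx : x ∈ Ω) :
    ∃ (ξ : ℝ → E) (ε : ℝ), 0 < ε ∧ ξ 0 = x ∧ ∀ t ∈ Ioo (-ε) ε,
      ξ t ∈ Ω ∧ ContDiffAt ℝ ∞ ξ t ∧ HasDerivAt ξ (V (ξ t)) t := by
  obtain ⟨ξ, h0, δ, hδ, hd⟩ :=
    ((hV x hx).of_le
      (by exact_mod_cast le_top)).exists_forall_mem_closedBall_exists_eq_forall_mem_Ioo_hasDerivAt₀ 0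
  simp only [zero_sub, zero_add] at hd
  have hc : ContinuousAt ξ 0 := (hd 0 ⟨by linarith, hδ⟩).continuousAt
  obtain ⟨ε', hε', hε⟩ := Metric.mem_nhds_iff.1
    (hc.preimage_mem_nhds (hΩ.mem_nhds (by rwa [h0])))
  rw [Real.ball_eq_Ioo, zero_sub, zero_add] at hε
  set ε := min δ ε' with hεdef
  have hI : ∀ t ∈ Ioo (-ε) ε, ξ t ∈ Ω ∧ HasDerivAt ξ (V (ξ t)) t := by
    intro t ht
    have h1 := min_le_left δ ε'
    have h2 := min_le_right δ ε'
    exact ⟨hε ⟨by linarith [ht.1], by linarith [ht.2]⟩, hd t ⟨by linarith [ht.1], by linarith [ht.2]⟩⟩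
  -- Bootstrapping: if ξ is Cⁿ, so is ξ' = V ∘ ξ, and then ξ is Cⁿ⁺¹.
  have hn : ∀ n : ℕ, ContDiffOn ℝ n ξ (Ioo (-ε) ε) := by
    intro n
    induction n with
    | zero =>
      exact contDiffOn_zero.2 fun t ht => (hI t ht).2.continuousAt.continuousWithinAt
    | succ n ih =>
      push_cast
      rw [contDiffOn_succ_iff_deriv_of_isOpen isOpen_Ioo]
      refine ⟨fun t ht => (hI t ht).2.differentiableAt.differentiableWithinAt, by simp, ?_⟩
      have : ContDiffOn ℝ n (V ∘ ξ) (Ioo (-ε) ε) := fun t ht =>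
        ((hV _ (hI t ht).1).of_le (by exact_mod_cast le_top)).comp_contDiffWithinAt t (ih t ht)
      exact this.congr fun t ht => (hI t ht).2.deriv
  refine ⟨ξ, ε, lt_min hδ hε', h0, fun t ht => ⟨(hI t ht).1, ?_, (hI t ht).2⟩⟩
  exact (contDiffOn_infty.2 hn).contDiffAt (isOpen_Ioo.mem_nhds ht)

/-! ### From the curvature function to an adapted coframe -/

section Converse

variable {c : ℝ} {G G' : E2 → Matrix (Fin 2) (Fin 2) ℝ} {Ω Ω' : Set E2} {x : E2} {Θ : E2 → E2}
  {θ : Fin 2 → Fin 2 → E2 → ℝ} {f s : E2 → ℝ}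

theorem IsAdaptedOn.pullback (h : IsAdaptedOn c G θ f s Ω) (hΘ : IsIsometryOn G G' Θ Ω Ω')
    (hG' : IsMetricOn G' Ω') :
    IsAdaptedOn c G' (fun a => Bicons.pullback Θ (θ a)) (fun y => f (Θ y)) (fun y => s (Θ y)) Ω' := by
  refine ⟨hG', h.coframe.pullback hΘ, fun y hy => (h.smooth _ (hΘ.mapsTo hy)).comp y (hΘ.smooth y hy),
    fun y hy => (h.smooth_speed _ (hΘ.mapsTo hy)).comp y (hΘ.smooth y hy),
    fun y hy => h.pos _ (hΘ.mapsTo hy), fun y hy => h.speed_pos _ (hΘ.mapsTo hy), fun y hy i => ?_,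
    fun y hy => ?_⟩
  · rw [partialD_comp_map (h.smooth _ (hΘ.mapsTo hy)).diffAt (hΘ.smooth y hy).diffAt,
      h.partialD_eq _ (hΘ.mapsTo hy), h.partialD_eq _ (hΘ.mapsTo hy), Bicons.pullback]
    simp only [smul_eq_mul]
    ring
  · rw [hΘ.coordGaussCurvature_eq h.metric hG' hy, h.curvature _ (hΘ.mapsTo hy)]

/-- The coframe adapted to the curvature. -/
theorem IsMetricOn.isAdaptedOn (hG : IsMetricOn G Ω) (hK : ∀ x ∈ Ω, 0 < c - coordGaussCurvature G x)
    (hd : ∀ x ∈ Ω, partialD 0 (coordGaussCurvature G) x ≠ 0 ∨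
      partialD 1 (coordGaussCurvature G) x ≠ 0) :
    ∃ θ f s, IsAdaptedOn c G θ f s Ω := by
  -- The only positive f compatible with the Gauss equation K = c - 3f²/4.
  set f : E2 → ℝ := fun x => √(4 / 3 * (c - coordGaussCurvature G x)) with hf
  have hpos : ∀ x ∈ Ω, 0 < 4 / 3 * (c - coordGaussCurvature G x) :=
    fun x hx => by have := hK x hx; positivity
  have hfp : ∀ x ∈ Ω, 0 < f x := fun x hx => Real.sqrt_pos.2 (hpos x hx)
  have hfs : ∀ x ∈ Ω, ContDiffAt ℝ ∞ f x := fun x hx =>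
    (contDiffAt_const.mul (contDiffAt_const.sub (hG.smooth_curvature hx))).sqrt (hpos x hx).ne'
  have hcurv : ∀ x ∈ Ω, coordGaussCurvature G x = c - 3 / 4 * f x ^ 2 := by
    intro x hx
    rw [hf, Real.sq_sqrt (hpos x hx).le]
    ring
  have hdf : ∀ x ∈ Ω, ∀ i, partialD i (coordGaussCurvature G) x = -(3 / 2 * f x) * partialD i f x := by
    intro x hx i
    have hfd := (hfs x hx).diffAt
    have e : coordGaussCurvature G =ᶠ[𝓝 x] fun y => c - 3 / 4 * (f y * f y) := by
      filter_upwards [hG.isOpen.mem_nhds hx] with y hy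
      rw [hcurv y hy, sq]
    rw [partialD_congr e, partialD_sub (differentiableAt_const c) ((hfd.fun_mul hfd).const_mul _),
      partialD_const, partialD_const_mul _ (hfd.fun_mul hfd), partialD_mul hfd hfd]
    ring
  have hdf' : ∀ x ∈ Ω, partialD 0 f x ≠ 0 ∨ partialD 1 f x ≠ 0 := by
    intro x hx
    refine (hd x hx).imp ?_ ?_ <;> intro h h0 <;> apply h <;> rw [hdf x hx, h0, mul_zero]
  have hW := fun x (hx : x ∈ Ω) => hG.dualNormSq_pos (α := fun i => partialD i f) hx (hdf' x hx)
  exact ⟨_, f, _, hG, hG.adaptedCoframe (fun x hx i => (hfs x hx).partialD i) hdf', hfs,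
    fun x hx => (hG.smooth_dualNormSq hx (fun i => (hfs x hx).partialD i)).sqrt (hW x hx).ne', hfp,
    fun x hx => Real.sqrt_pos.2 (hW x hx), fun x hx i => hG.sqrt_dualNormSq_mul
      (α := fun i => partialD i f) hx (hdf' x hx) i, hcurv⟩

/-- From 0 = d(df) = ds ∧ θ⁰ + s dθ⁰ with s > 0; this reverses `wedge_eq_zero`. -/
theorem IsAdaptedOn.extD_eq_zero (h : IsAdaptedOn c G θ f s Ω) (hx : x ∈ Ω)
    (hw : partialD 0 s x * θ 0 1 x - partialD 1 s x * θ 0 0 x = 0) : extD (θ 0) x = 0 := by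
  have e : ∀ i j, partialD i (partialD j f) x =
      s x * partialD i (θ 0 j) x + partialD i s x * θ 0 j x := by
    intro i j
    rw [← partialD_mul (h.smooth_speed x hx).diffAt (h.coframe.smooth x hx 0 j).diffAt]
    apply partialD_congr
    filter_upwards [h.metric.isOpen.mem_nhds hx] with y hy using h.partialD_eq y hy j
  have := partialD_comm (h.smooth x hx) 0 1
  rw [e, e] at this
  apply mul_left_cancel₀ (h.speed_pos x hx).ne'
  rw [extD]
  linear_combination this - hw

/-- The vector field dual to the second form of a coframe. -/
def secondField (θ : Fin 2 → Fin 2 → E2 → ℝ) (x : E2) : E2 :=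
  !₂[-θ 0 1 x / area θ x, θ 0 0 x / area θ x]

theorem IsCoframeOn.smooth_secondField (h : IsCoframeOn G θ Ω) (hG : IsMetricOn G Ω) (hx : x ∈ Ω) :
    ContDiffAt ℝ ∞ (secondField θ) x := by
  have hD := h.area_ne_zero hG hx
  rw [contDiffAt_euclidean]
  intro i
  fin_cases i
  · exact (h.smooth x hx 0 1).neg.div (h.smooth_area hx) hD
  · exact (h.smooth x hx 0 0).div (h.smooth_area hx) hD

theorem IsCoframeOn.alongCurve_secondField (h : IsCoframeOn G θ Ω) (hG : IsMetricOn G Ω)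
    {ξ : ℝ → E2} {t : ℝ} (ht : ξ t ∈ Ω) (hξ : HasDerivAt ξ (secondField θ (ξ t)) t) :
    alongCurve (θ 0) ξ t = 0 ∧ alongCurve (θ 1) ξ t = 1 := by
  have hD := h.area_ne_zero hG ht
  simp only [alongCurve, hξ.deriv, secondField]
  have hA : area θ (ξ t) = θ 0 0 (ξ t) * θ 1 1 (ξ t) - θ 0 1 (ξ t) * θ 1 0 (ξ t) := rfl
  generalize area θ (ξ t) = D at *
  constructor
  · simp; field_simp; ring
  · simp; field_simp; rw [hA]; ring

end Converse

/-! ### Structure equations from the circle condition -/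

section

variable {M : Type*} [TopologicalSpace M] [ChartedSpace E2 M] [IsManifold (𝓡 2) ∞ M]
  {g : SurfaceMetric M} {c : ℝ} {p q : M} {x : E2}

/-- The chart in which the acceleration is written depends on γ t; this lets it be read in the chart
at a point that is only propositionally equal to γ t. -/
theorem accE_apply' {γ : ℝ → M} {t : ℝ} (h : γ t = q) (k : Fin 2) : (accE g γ t) k =
    coordAcceleration (metricCoeff g (chartAt E2 q)) (fun τ => chartAt E2 q (γ τ)) t k := by
  subst h
  rfl

/-- If the level curves of the curvature are circles of curvature `3|∇K|/(8(c - K))`, the adapted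
coframe satisfies the structure equations. -/
theorem LevelCurvesAreCircles.structure_eq
    (hL : LevelCurvesAreCircles g (gaussCurvature g) (levelCurvature g c))
    {Ω : Set E2} {θ : Fin 2 → Fin 2 → E2 → ℝ} {f s : E2 → ℝ} (hΩ : Ω ⊆ (chartAt E2 q).target)
    (h : IsAdaptedOn c (metricCoeff g (chartAt E2 q)) θ f s Ω) (hq : chartAt E2 q q ∈ Ω) :
    extD (θ 0) (chartAt E2 q q) = 0 ∧ extD (θ 1) (chartAt E2 q q) =
      -(3 * s (chartAt E2 q q) / (4 * f (chartAt E2 q q))) * area θ (chartAt E2 q q) := by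
  -- The test curve is the integral curve of E₂ through q: unit speed and tangent to the kernel of
  -- df, hence contained in a level set of K.
  obtain ⟨ξ, ε, hε, h0, hξ⟩ := exists_smooth_integralCurve h.metric.isOpen
    (fun y hy => h.coframe.smooth_secondField h.metric hy) hq
  set γ : ℝ → M := fun t => (chartAt E2 q).symm (ξ t) with hγ
  have hmem : (0 : ℝ) ∈ Ioo (-ε) ε := ⟨by linarith, hε⟩
  have hsm : ∀ t ∈ Ioo (-ε) ε, ContMDiffAt 𝓘(ℝ, ℝ) (𝓡 2) ∞ γ t := fun t ht =>
    (contMDiffAt_chart_symm (hΩ (hξ t ht).1)).comp t (hξ t ht).2.1.contMDiffAt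
  have hev : ∀ t ∈ Ioo (-ε) ε, (fun τ => chartAt E2 q (γ τ)) =ᶠ[𝓝 t] ξ := by
    intro t ht
    filter_upwards [isOpen_Ioo.mem_nhds ht] with τ hτ
    exact (chartAt E2 q).right_inv (hΩ (hξ τ hτ).1)
  have hu := fun t (ht : t ∈ Ioo (-ε) ε) =>
    h.coframe.alongCurve_secondField h.metric (hξ t ht).1 (hξ t ht).2.2
  have hK : ∀ t ∈ Ioo (-ε) ε, HasDerivAt (fun τ => f (ξ τ)) 0 t := by
    intro t ht
    have := hasDerivAt_comp_curve (h.smooth _ (hξ t ht).1).diffAt (hξ t ht).2.2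
    rw [h.partialD_eq _ (hξ t ht).1, h.partialD_eq _ (hξ t ht).1, ← (hξ t ht).2.2.deriv] at this
    refine this.congr_deriv ?_
    have e := (hu t ht).1
    rw [alongCurve] at e
    simp only [smul_eq_mul]
    linear_combination s (ξ t) * e
  have hf : ∀ t ∈ Ioo (-ε) ε, f (ξ t) = f (ξ 0) := fun t ht =>
    isOpen_Ioo.is_const_of_deriv_eq_zero isPreconnected_Ioo
      (fun τ hτ => (hK τ hτ).differentiableAt.differentiableWithinAt)
      (fun τ hτ => (hK τ hτ).deriv) ht hmem
  have hunit : IsUnitSpeedOn g γ (-ε) ε := by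
    refine ⟨fun t ht => (hsm t ht).contMDiffWithinAt, fun t ht => ?_⟩
    have hs : γ t ∈ (chartAt E2 q).source := (chartAt E2 q).map_target (hΩ (hξ t ht).1)
    have e1 : chartAt E2 q (γ t) = ξ t := (hev t ht).eq_of_nhds
    have e2 := ip_velE h.coframe ((hsm t ht).mdifferentiableAt (by simp)) hs
      (by rw [e1]; exact (hξ t ht).1)
    simp only [alongCurve, e1, (hev t ht).deriv_eq] at e2
    have e3 := hu t ht
    simp only [alongCurve] at e3
    rw [e3.1, e3.2] at e2
    rw [gnorm_velocity, e2]
    norm_num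
  obtain ⟨κ, hκ, -, hcirc⟩ := hL γ (-ε) ε (by linarith) hunit ⟨c - 3 / 4 * f (ξ 0) ^ 2, fun t ht => by
    rw [hγ, gaussCurvature_eq (hΩ (hξ t ht).1), h.curvature _ (hξ t ht).1, hf t ht]⟩
  have hκ' : ∀ t ∈ Ioo (-ε) ε, 3 * s (ξ t) / (4 * f (ξ t)) = κ := fun t ht => by
    rw [← h.levelCurvature_eq (hξ t ht).1 hΩ]
    exact hκ t ht
  have hf0 := (h.pos _ hq).ne'
  have hs0 := (h.speed_pos _ hq).ne'
  have hD := h.coframe.area_ne_zero h.metric hq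
  have hγ0 : γ 0 = q := by rw [hγ]; simp only [h0]; exact (chartAt E2 q).left_inv (mem_chart_source E2 q)
  constructor
  · apply h.extD_eq_zero hq
    have d1 := hasDerivAt_comp_curve (h.smooth_speed _ (hξ 0 hmem).1).diffAt (hξ 0 hmem).2.2
    -- Along the curve s = 4κf/3 with κ constant by hypothesis and f constant because the curve is a
    -- level curve.
    have d2 : HasDerivAt (fun τ => s (ξ τ)) 0 0 := by
      refine (hasDerivAt_const 0 (κ * (4 * f (ξ 0)) / 3)).congr_of_eventuallyEq ?_
      filter_upwards [isOpen_Ioo.mem_nhds hmem] with τ hτ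
      have hfp := (h.pos _ (hξ τ hτ).1).ne'
      rw [← hκ' τ hτ, ← hf τ hτ]
      field_simp
    have e := d1.unique d2
    rw [h0] at e
    simp only [secondField, smul_eq_mul] at e
    simp at e
    field_simp at e
    linear_combination -e
  · have ha : accE g γ 0 = κ • (-(gnorm g (grad g (gaussCurvature g) q))⁻¹ •
        gradE g (gaussCurvature g) q) := by
      have : accE g γ 0 = κ • (-(gnorm g (grad g (gaussCurvature g) (γ 0)))⁻¹ •
        gradE g (gaussCurvature g) (γ 0)) := (hcirc 0 hmem).2.2
      rw [hγ0] at this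
      exact this
    have hn := h.gnorm_grad_gaussCurvature hq hΩ
    rw [(chartAt E2 q).left_inv (mem_chart_source E2 q)] at hn
    obtain ⟨g0, g1⟩ := h.gradE_gaussCurvature hq
    have e1 : chartAt E2 q (γ 0) = chartAt E2 q q := by rw [hγ0]
    have key := h.coframe.extD_of_acceleration (ξ := fun τ => chartAt E2 q (γ τ)) (t := 0) (κ := κ)
      h.metric (by rw [e1]; exact hq)
      ((hξ 0 hmem).2.1.congr_of_eventuallyEq (hev 0 hmem)) ?_ ?_
    · simp only [e1] at key
      have e2 := hκ' 0 hmem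
      rw [h0] at e2
      rw [e2]
      exact key
    · filter_upwards [isOpen_Ioo.mem_nhds hmem] with τ hτ
      have := hu τ hτ
      have e3 : chartAt E2 q (γ τ) = ξ τ := (hev τ hτ).eq_of_nhds
      simpa only [alongCurve, (hev τ hτ).deriv_eq, e3] using this
    -- The prescribed normal -∇K/|∇K| is E₁, so θ⁰ of the acceleration is κ.
    · rw [← accE_apply' hγ0, ← accE_apply' hγ0, ha, hn]
      simp only [e1, PiLp.smul_apply, smul_eq_mul, g0, g1]
      have hA : area θ (chartAt E2 q q) = θ 0 0 (chartAt E2 q q) * θ 1 1 (chartAt E2 q q) -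
        θ 0 1 (chartAt E2 q q) * θ 1 0 (chartAt E2 q q) := rfl
      generalize area θ (chartAt E2 q q) = D at *
      field_simp
      rw [hA]
      ring

/-- The structure equations are available only at the centre of a preferred chart. At each x the
coframe is therefore pulled back to the chart centred at the corresponding point q, and the
equations return by naturality of d and of the area density. -/
theorem isSpecialAt_of_levelCurvesAreCircles (hpos : ∀ p, 0 < c - gaussCurvature g p)
    (hd : ∀ p, gradE g (gaussCurvature g) p ≠ 0)
    (hL : LevelCurvesAreCircles g (gaussCurvature g) (levelCurvature g c)) (p : M) :
    IsSpecialAt g c p := by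
  have hG := isMetricOn_metricCoeff g p
  obtain ⟨θ, f, s, h⟩ := hG.isAdaptedOn (c := c)
    (fun x hx => by rw [← gaussCurvature_eq hx]; exact hpos _)
    (fun x hx => by
      have := (gradE_ne_zero_iff hx (contDiffAt_gaussCurvature (g := g) hx)).1 (hd _)
      rwa [partialD_congr (gaussCurvature_comp_eventuallyEq hx),
        partialD_congr (gaussCurvature_comp_eventuallyEq hx)] at this)
  have key : ∀ x ∈ (chartAt E2 p).target, extD (θ 0) x = 0 ∧
      extD (θ 1) x = -(3 * s x / (4 * f x)) * area θ x := by
    intro x hx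
    set q := (chartAt E2 p).symm x with hqdef
    have hI := isIsometryOn_transition g q p
    have hG' := isMetricOn_overlap g q p
    have hq : chartAt E2 q q ∈ overlap q p := by
      refine ⟨mem_chart_target E2 q, ?_⟩
      rw [mem_preimage, (chartAt E2 q).left_inv (mem_chart_source E2 q)]
      exact (chartAt E2 p).map_target hx
    have hx' : transition q p (chartAt E2 q q) = x := by
      rw [transition, (chartAt E2 q).left_inv (mem_chart_source E2 q)]
      exact (chartAt E2 p).right_inv hx
    have hP := hL.structure_eq inter_subset_left (h.pullback hI hG') hq
    have hJ := hI.jacobian_ne_zero hG' hq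
    simp only [area_pullback, extD_pullback (h.coframe.smooth _ (hI.mapsTo hq) _) (hI.smooth _ hq),
      hx'] at hP
    refine ⟨(mul_eq_zero.1 hP.1).resolve_left hJ, mul_left_cancel₀ hJ ?_⟩
    linear_combination hP.2
  exact ⟨_, θ, f, s, Subset.rfl, mem_chart_target E2 p, h, fun x hx => (key x hx).1,
    fun x hx => (key x hx).2⟩

end

/-! ### Coordinates adapted to a special coframe -/

section Calculus

variable {Ω : Set E2} {x : E2}

/-- A closed one-form on an open convex set has a smooth primitive. -/
theorem exists_primitive {β : Fin 2 → E2 → ℝ} (hΩ : IsOpen Ω) (hc : Convex ℝ Ω)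
    (hβ : ∀ x ∈ Ω, ∀ i, ContDiffAt ℝ ∞ (β i) x) (hd : ∀ x ∈ Ω, extD β x = 0) :
    ∃ u : E2 → ℝ, ∀ x ∈ Ω, ContDiffAt ℝ ∞ u x ∧ ∀ i, partialD i u x = β i x := by
  let L : Fin 2 → E2 →L[ℝ] ℝ := fun i => EuclideanSpace.proj i
  let B : E2 → E2 →L[ℝ] ℝ := fun x => β 0 x • L 0 + β 1 x • L 1
  have hB : ∀ x ∈ Ω, ContDiffAt ℝ ∞ B x := fun x hx =>
    ((hβ x hx 0).smul contDiffAt_const).add ((hβ x hx 1).smul contDiffAt_const)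
  have hB' : ∀ x ∈ Ω, ∀ v z : E2, fderiv ℝ B x v z =
      fderiv ℝ (β 0) x v * z 0 + fderiv ℝ (β 1) x v * z 1 := by
    intro x hx v z
    have h0 := (hβ x hx 0).diffAt.hasFDerivAt.smul_const (L 0)
    have h1 := (hβ x hx 1).diffAt.hasFDerivAt.smul_const (L 1)
    have h2 : HasFDerivAt B _ x := h0.add h1
    rw [h2.fderiv]
    simp [L]
  obtain ⟨u, hu⟩ := hc.exists_forall_hasFDerivAt_of_fderiv_symmetric hΩ
    (fun x hx => (hB x hx).diffAt.differentiableWithinAt) (fun x hx v z => by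
      have := hd x hx
      rw [extD] at this
      simp only [hB' x hx, fderiv_eq_partialD (x := x) (β 0), fderiv_eq_partialD (x := x) (β 1),
        smul_eq_mul]
      linear_combination (v 0 * z 1 - z 0 * v 1) * this)
  refine ⟨u, fun x hx => ⟨?_, fun i => ?_⟩⟩
  · have h1 : fderiv ℝ u =ᶠ[𝓝 x] B := by
      filter_upwards [hΩ.mem_nhds hx] with y hy using (hu y hy).fderiv
    -- The differential of u agrees near x with the smooth form, so u is of class Cⁿ⁺¹ for every n.
    rw [contDiffAt_infty]
    intro n
    have h2 : ContDiffAt ℝ (n + 1) u x := by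
      refine contDiffAt_succ_iff_hasFDerivAt.2 ⟨fderiv ℝ u, ⟨Ω, hΩ.mem_nhds hx, fun y hy => ?_⟩,
        ((hB x hx).congr_of_eventuallyEq h1).of_le (by exact_mod_cast le_top)⟩
      exact (hu y hy).differentiableAt.hasFDerivAt
    exact h2.of_le (by exact_mod_cast Nat.le_succ n)
  · rw [partialD, (hu x hx).fderiv]
    fin_cases i <;> simp [B, L, e]

/-- The inverse function theorem in the plane. -/
theorem exists_local_diffeomorph {w : E2 → E2} (hΩ : IsOpen Ω)
    (hw : ∀ x ∈ Ω, ContDiffAt ℝ ∞ w x) (hJ : ∀ x ∈ Ω, jacobian w x ≠ 0) (hx : x ∈ Ω) :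
    ∃ e : OpenPartialHomeomorph E2 E2, x ∈ e.source ∧ e.source ⊆ Ω ∧ (∀ y, e y = w y) ∧
      ∀ y ∈ e.target, ContDiffAt ℝ ∞ e.symm y := by
  have hinj : ∀ y ∈ Ω, Function.Injective (fderiv ℝ w y : E2 →ₗ[ℝ] E2) := by
    intro y hy
    rw [← LinearMap.ker_eq_bot, LinearMap.ker_eq_bot']
    intro v hv
    have hv' : fderiv ℝ w y v = 0 := hv
    rw [fderiv_eq_partialD] at hv'
    have e0 := congrArg (fun z : E2 => z 0) hv'
    have e1 := congrArg (fun z : E2 => z 1) hv'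
    simp only [PiLp.add_apply, PiLp.smul_apply, smul_eq_mul, PiLp.zero_apply] at e0 e1
    ext i
    apply mul_left_cancel₀ (hJ y hy)
    rw [PiLp.zero_apply, mul_zero, jacobian]
    fin_cases i
    · simp only [Fin.zero_eta]
      linear_combination partialD 1 w y 1 * e0 - partialD 1 w y 0 * e1
    · simp only [Fin.mk_one]
      linear_combination partialD 0 w y 0 * e1 - partialD 0 w y 1 * e0
  have heq : ∀ y ∈ Ω, ∃ w' : E2 ≃L[ℝ] E2, HasFDerivAt w (w' : E2 →L[ℝ] E2) y := by
    intro y hy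
    refine ⟨(LinearEquiv.ofInjectiveEndo _ (hinj y hy)).toContinuousLinearEquiv, ?_⟩
    have : (((LinearEquiv.ofInjectiveEndo _ (hinj y hy)).toContinuousLinearEquiv : E2 ≃L[ℝ] E2) :
        E2 →L[ℝ] E2) = fderiv ℝ w y := by
      ext1 v
      rfl
    rw [this]
    exact (hw y hy).diffAt.hasFDerivAt
  obtain ⟨w', hw'⟩ := heq x hx
  let e₀ := (hw x hx).toOpenPartialHomeomorph w hw' (by simp)
  have h0 : x ∈ e₀.source := (hw x hx).mem_toOpenPartialHomeomorph_source hw' (by simp)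
  refine ⟨e₀.restrOpen Ω hΩ, ⟨h0, hx⟩, fun y hy => hy.2, fun y => rfl, fun y hy => ?_⟩
  have hy' := (e₀.restrOpen Ω hΩ).map_target hy
  obtain ⟨w'', hw''⟩ := heq _ hy'.2
  exact (e₀.restrOpen Ω hΩ).contDiffAt_symm hy hw'' (hw _ hy'.2)

theorem contDiff_vec {a b : ℝ → ℝ} {t : ℝ} (ha : ContDiffAt ℝ ∞ a t) (hb : ContDiffAt ℝ ∞ b t) :
    ContDiffAt ℝ ∞ (fun τ => (!₂[a τ, b τ] : E2)) t := by
  rw [contDiffAt_euclidean]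
  intro i
  fin_cases i
  · exact ha
  · exact hb

end Calculus

/-! ### The one-variable profile of a special metric -/

section Profile

variable {c : ℝ} {G : E2 → Matrix (Fin 2) (Fin 2) ℝ} {Ω : Set E2} {x : E2}
  {θ : Fin 2 → Fin 2 → E2 → ℝ} {f s : E2 → ℝ}

/-- The Gauss equation in terms of the curvature of the level curves. -/
theorem IsSpecialOn.riccati (h : IsSpecialOn c G θ f s Ω) (hx : x ∈ Ω) {m : ℝ}
    (hm : ∀ i, partialD i (fun y => 3 * s y / (4 * f y)) x = m * θ 0 i x) :
    m = (3 * s x / (4 * f x)) ^ 2 + c - 3 / 4 * f x ^ 2 := by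
  have hf := (h.pos x hx).ne'
  have hD := h.coframe.area_ne_zero h.metric hx
  have hg := h.coframe.gauss h.metric hx
  -- Since dθ⁰ = 0, ω = -κ θ¹; expanding dω by the product rule turns the Gauss equation into the
  -- Riccati relation.
  have e : ∀ i, connForm θ i =ᶠ[𝓝 x] fun y => -(3 * s y / (4 * f y) * θ 1 i y) := by
    intro i
    filter_upwards [h.metric.isOpen.mem_nhds hx] with y hy
    have := h.coframe.area_ne_zero h.metric hy
    rw [connForm, h.closed y hy, h.extD_eq y hy]
    field_simp
    ring
  have hκ : DifferentiableAt ℝ (fun y => 3 * s y / (4 * f y)) x :=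
    ((contDiffAt_const.mul (h.smooth_speed x hx)).div (contDiffAt_const.mul (h.smooth x hx))
      (by simpa using hf)).diffAt
  have h1 := fun i => (h.coframe.smooth x hx 1 i).diffAt
  have hs := h.extD_eq x hx
  rw [extD, partialD_congr (e 1), partialD_congr (e 0), partialD_neg, partialD_neg,
    partialD_mul hκ (h1 1), partialD_mul hκ (h1 0), hm, hm, h.curvature x hx] at hg
  rw [extD] at hs
  apply mul_right_cancel₀ hD
  rw [show area θ x = θ 0 0 x * θ 1 1 x - θ 0 1 x * θ 1 0 x from rfl] at hg hs ⊢
  generalize 3 * s x / (4 * f x) = κ at *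
  linear_combination -hg - κ * hs

theorem IsAdaptedOn.hasDerivAt_curve (h : IsAdaptedOn c G θ f s Ω) {u : E2 → ℝ}
    {ζ : ℝ → E2} {t m : ℝ} (ht : ζ t ∈ Ω) (hζ : DifferentiableAt ℝ ζ t)
    (hu : DifferentiableAt ℝ u (ζ t)) (hd : ∀ i, partialD i u (ζ t) = θ 0 i (ζ t))
    (hm : HasDerivAt (fun τ => u (ζ τ)) m t) : HasDerivAt (fun τ => f (ζ τ)) (s (ζ t) * m) t := by
  have h1 := hasDerivAt_comp_curve hu hζ.hasDerivAt
  have h2 := hasDerivAt_comp_curve (h.smooth _ ht).diffAt hζ.hasDerivAt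
  refine h2.congr_deriv ?_
  rw [← h1.unique hm]
  simp only [h.partialD_eq _ ht, hd, smul_eq_mul]
  ring

/-- A special metric is determined by a function of one variable. -/
theorem IsSpecialOn.exists_profile (h : IsSpecialOn c G θ f s Ω) (hx : x ∈ Ω) :
    ∃ (Ω' : Set E2) (u v : E2 → ℝ) (A : ℝ → ℝ) (δ : ℝ), IsOpen Ω' ∧ x ∈ Ω' ∧ Ω' ⊆ Ω ∧ 0 < δ ∧
      u x = 0 ∧ v x = 0 ∧
      (∀ y ∈ Ω', u y ∈ Ioo (-δ) δ ∧ ContDiffAt ℝ ∞ u y ∧ ContDiffAt ℝ ∞ v y ∧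
        (∀ i, partialD i u y = θ 0 i y) ∧ (∀ i, partialD i v y = f y ^ (3 / 4 : ℝ) * θ 1 i y) ∧
        f y = A (u y)) ∧
      ∀ t ∈ Ioo (-δ) δ, ContDiffAt ℝ ∞ A t ∧ 0 < A t ∧
        HasDerivAt (fun τ => 3 * deriv A τ / (4 * A τ))
          ((3 * deriv A t / (4 * A t)) ^ 2 + c - 3 / 4 * A t ^ 2) t := by
  obtain ⟨r, hr, hB⟩ := Metric.isOpen_iff.1 h.metric.isOpen x hx
  obtain ⟨u₀, hu₀⟩ := exists_primitive (β := θ 0) Metric.isOpen_ball (convex_ball x r)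
    (fun y hy => h.coframe.smooth y (hB hy) 0) (fun y hy => h.closed y (hB hy))
  have hρ : ∀ y ∈ Ω, ContDiffAt ℝ ∞ (fun z => f z ^ (3 / 4 : ℝ)) y := fun y hy =>
    (h.smooth y hy).rpow_const_of_ne (h.pos y hy).ne'
  -- The power 3/4 is the integrating factor: d(f^(3/4)) = f^(3/4) κ θ⁰ cancels dθ¹ = -κ θ⁰∧θ¹.
  obtain ⟨v₀, hv₀⟩ := exists_primitive (β := fun i y => f y ^ (3 / 4 : ℝ) * θ 1 i y)
    Metric.isOpen_ball (convex_ball x r)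
    (fun y hy i => (hρ y (hB hy)).mul (h.coframe.smooth y (hB hy) 1 i)) (fun y hy => by
      have hy' := hB hy
      have hf := h.pos y hy'
      have h1 := fun i => (h.coframe.smooth y hy' 1 i).diffAt
      have hd : ∀ i, partialD i (fun z => f z ^ (3 / 4 : ℝ)) y =
          f y ^ (3 / 4 : ℝ) * (3 * s y / (4 * f y)) * θ 0 i y := by
        intro i
        rw [partialD_comp (Real.hasDerivAt_rpow_const (Or.inl hf.ne')) (h.smooth y hy').diffAt,
          h.partialD_eq y hy', Real.rpow_sub_one hf.ne']
        field_simp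
      have hs := h.extD_eq y hy'
      rw [extD] at hs ⊢
      rw [partialD_mul (hρ y hy').diffAt (h1 1), partialD_mul (hρ y hy').diffAt (h1 0), hd, hd]
      rw [area] at hs
      linear_combination f y ^ (3 / 4 : ℝ) * hs)
  set w : E2 → E2 := fun y => !₂[u₀ y - u₀ x, v₀ y - v₀ x] with hw
  have hw0 : ∀ y, w y 0 = u₀ y - u₀ x := fun y => rfl
  have hw1 : ∀ y, w y 1 = v₀ y - v₀ x := fun y => rfl
  have hws : ∀ y ∈ Metric.ball x r, ContDiffAt ℝ ∞ w y := by
    intro y hy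
    rw [contDiffAt_euclidean]
    intro i
    fin_cases i
    · exact (hu₀ y hy).1.sub contDiffAt_const
    · exact (hv₀ y hy).1.sub contDiffAt_const
  have hwp : ∀ y ∈ Metric.ball x r, ∀ i, partialD i w y 0 = θ 0 i y ∧
      partialD i w y 1 = f y ^ (3 / 4 : ℝ) * θ 1 i y := by
    intro y hy i
    rw [← partialD_coord (hws y hy).diffAt, ← partialD_coord (hws y hy).diffAt]
    simp only [hw0, hw1]
    rw [partialD_sub (hu₀ y hy).1.diffAt (differentiableAt_const _),
      partialD_sub (hv₀ y hy).1.diffAt (differentiableAt_const _), partialD_const, partialD_const,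
      (hu₀ y hy).2, (hv₀ y hy).2, sub_zero, sub_zero]
    exact ⟨rfl, rfl⟩
  obtain ⟨e, hxe, heΩ, hew, hes⟩ := exists_local_diffeomorph Metric.isOpen_ball hws
    (fun y hy => by
      have h1 := hwp y hy
      have h2 := h.coframe.area_ne_zero h.metric (hB hy)
      have h3 := (Real.rpow_pos_of_pos (h.pos y (hB hy)) (3 / 4)).ne'
      rw [jacobian, (h1 0).1, (h1 0).2, (h1 1).1, (h1 1).2]
      have := mul_ne_zero h3 h2
      rw [area] at this
      convert this using 1
      ring) (Metric.mem_ball_self hr)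
  have hwx : w x = !₂[0, 0] := by simp [hw]
  -- A square in the (u, v) coordinates, so that the curves of constant u are connected and f can be
  -- shown to depend on u only.
  obtain ⟨δ, hδ, hbox⟩ : ∃ δ > 0, ∀ a ∈ Ioo (-δ) δ, ∀ b ∈ Ioo (-δ) δ, !₂[a, b] ∈ e.target := by
    have hc : Continuous (fun ab : ℝ × ℝ => (!₂[ab.1, ab.2] : E2)) := by fun_prop
    have hm : (fun ab : ℝ × ℝ => (!₂[ab.1, ab.2] : E2)) ⁻¹' e.target ∈ 𝓝 ((0 : ℝ), (0 : ℝ)) := by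
      refine (e.open_target.preimage hc).mem_nhds ?_
      rw [mem_preimage, ← hwx, ← hew]
      exact e.map_source hxe
    obtain ⟨δ, hδ, hb⟩ := Metric.mem_nhds_iff.1 hm
    refine ⟨δ, hδ, fun a ha b hb' => ?_⟩
    refine hb (?_ : ((a, b) : ℝ × ℝ) ∈ _)
    rw [← ball_prod_same, Real.ball_eq_Ioo, zero_sub, zero_add]
    exact ⟨ha, hb'⟩
  have hz0 : (0 : ℝ) ∈ Ioo (-δ) δ := ⟨by linarith, hδ⟩
  set Θ : ℝ → ℝ → E2 := fun a b => e.symm !₂[a, b] with hΘ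
  have hsrc : ∀ a ∈ Ioo (-δ) δ, ∀ b ∈ Ioo (-δ) δ, Θ a b ∈ e.source :=
    fun a ha b hb => e.map_target (hbox a ha b hb)
  have hinv : ∀ a ∈ Ioo (-δ) δ, ∀ b ∈ Ioo (-δ) δ, w (Θ a b) = !₂[a, b] := by
    intro a ha b hb
    rw [← hew]
    exact e.right_inv (hbox a ha b hb)
  have hu : ∀ a ∈ Ioo (-δ) δ, ∀ b ∈ Ioo (-δ) δ, u₀ (Θ a b) - u₀ x = a := by
    intro a ha b hb
    rw [← hw0, hinv a ha b hb]
    rfl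
  have hv : ∀ a ∈ Ioo (-δ) δ, ∀ b ∈ Ioo (-δ) δ, v₀ (Θ a b) - v₀ x = b := by
    intro a ha b hb
    rw [← hw1, hinv a ha b hb]
    rfl
  have hcΘ : ∀ {a b : ℝ → ℝ} {t : ℝ}, ContDiffAt ℝ ∞ a t → ContDiffAt ℝ ∞ b t →
      a t ∈ Ioo (-δ) δ → b t ∈ Ioo (-δ) δ → ContDiffAt ℝ ∞ (fun τ => Θ (a τ) (b τ)) t :=
    fun {a b t} ha hb hat hbt => ContDiffAt.comp (f := fun τ => (!₂[a τ, b τ] : E2)) t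
      (hes _ (hbox _ hat _ hbt)) (contDiff_vec ha hb)
  have hder : ∀ {ζ : ℝ → E2} {t m : ℝ}, ζ t ∈ e.source → ContDiffAt ℝ ∞ ζ t →
      HasDerivAt (fun τ => u₀ (ζ τ) - u₀ x) m t → HasDerivAt (fun τ => f (ζ τ)) (s (ζ t) * m) t := by
    intro ζ t m ht hζ hm
    refine h.hasDerivAt_curve (u := fun y => u₀ y - u₀ x) (hB (heΩ ht)) hζ.diffAt
      ((hu₀ _ (heΩ ht)).1.diffAt.sub_const _) (fun i => ?_) hm
    rw [partialD_sub (hu₀ _ (heΩ ht)).1.diffAt (differentiableAt_const _), partialD_const, sub_zero,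
      (hu₀ _ (heΩ ht)).2]
  have hA : ∀ a ∈ Ioo (-δ) δ, ∀ b ∈ Ioo (-δ) δ, f (Θ a b) = f (Θ a 0) := by
    intro a ha b hb
    have hd : ∀ τ ∈ Ioo (-δ) δ, HasDerivAt (fun τ => f (Θ a τ)) 0 τ := by
      intro τ hτ
      rw [← mul_zero (s (Θ a τ))]
      refine hder (ζ := fun τ => Θ a τ) (hsrc a ha τ hτ)
        (hcΘ contDiffAt_const contDiffAt_id ha hτ) ?_
      refine (hasDerivAt_const τ a).congr_of_eventuallyEq ?_
      filter_upwards [isOpen_Ioo.mem_nhds hτ] with σ hσ using hu a ha σ hσ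
    exact isOpen_Ioo.is_const_of_deriv_eq_zero isPreconnected_Ioo
      (fun τ hτ => (hd τ hτ).differentiableAt.differentiableWithinAt)
      (fun τ hτ => (hd τ hτ).deriv) hb hz0
  set A : ℝ → ℝ := fun t => f (Θ t 0) with hAdef
  -- Since df = s du, the derivative may be computed along any line of constant v; hence s = A'(u)
  -- is also a function of u alone.
  have hAd : ∀ a ∈ Ioo (-δ) δ, ∀ b ∈ Ioo (-δ) δ, HasDerivAt A (s (Θ a b)) a := by
    intro a ha b hb
    have h1 : HasDerivAt (fun τ => f (Θ τ b)) (s (Θ a b) * 1) a := by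
      refine hder (ζ := fun τ => Θ τ b) (hsrc a ha b hb)
        (hcΘ contDiffAt_id contDiffAt_const ha hb) ?_
      refine (hasDerivAt_id a).congr_of_eventuallyEq ?_
      filter_upwards [isOpen_Ioo.mem_nhds ha] with σ hσ using hu σ hσ b hb
    rw [mul_one] at h1
    refine h1.congr_of_eventuallyEq ?_
    filter_upwards [isOpen_Ioo.mem_nhds ha] with σ hσ using (hA σ hσ b hb).symm
  have hAs : ∀ t ∈ Ioo (-δ) δ, ContDiffAt ℝ ∞ A t := fun t ht =>
    (h.smooth _ (hB (heΩ (hsrc t ht 0 hz0)))).comp t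
      (hcΘ contDiffAt_id contDiffAt_const ht hz0)
  have hAp : ∀ t ∈ Ioo (-δ) δ, 0 < A t := fun t ht => h.pos _ (hB (heΩ (hsrc t ht 0 hz0)))
  set Ω' : Set E2 := e.source ∩ e ⁻¹' {y | y 0 ∈ Ioo (-δ) δ ∧ y 1 ∈ Ioo (-δ) δ} with hΩ'
  have hO : IsOpen Ω' := by
    refine e.isOpen_inter_preimage ?_
    exact (isOpen_Ioo.preimage (by fun_prop)).inter (isOpen_Ioo.preimage (by fun_prop))
  have hrep : ∀ y ∈ Ω', u₀ y - u₀ x ∈ Ioo (-δ) δ ∧ v₀ y - v₀ x ∈ Ioo (-δ) δ ∧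
      y = Θ (u₀ y - u₀ x) (v₀ y - v₀ x) := by
    intro y hy
    obtain ⟨h1, h2, h3⟩ := hy
    rw [hew] at h2 h3
    refine ⟨h2, h3, ?_⟩
    rw [hΘ]
    exact ((congrArg e.symm (hew y).symm).trans (e.left_inv h1)).symm
  have hfA : ∀ y ∈ Ω', f y = A (u₀ y - u₀ x) ∧ s y = deriv A (u₀ y - u₀ x) := by
    intro y hy
    obtain ⟨h1, h2, h3⟩ := hrep y hy
    constructor
    · rw [hAdef]
      simp only
      rw [← hA _ h1 _ h2, ← h3]
    · rw [(hAd _ h1 _ h2).deriv, ← h3]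
  refine ⟨Ω', fun y => u₀ y - u₀ x, fun y => v₀ y - v₀ x, A, δ, hO, ?_, fun y hy => hB (heΩ hy.1), hδ,
    sub_self _, sub_self _, fun y hy => ⟨(hrep y hy).1, (hu₀ y (heΩ hy.1)).1.sub contDiffAt_const,
      (hv₀ y (heΩ hy.1)).1.sub contDiffAt_const, fun i => ?_, fun i => ?_, (hfA y hy).1⟩,
    fun t ht => ⟨hAs t ht, hAp t ht, ?_⟩⟩
  · refine ⟨hxe, ?_⟩
    rw [mem_preimage, hew, hwx]
    exact ⟨hz0, hz0⟩
  · rw [partialD_sub (hu₀ _ (heΩ hy.1)).1.diffAt (differentiableAt_const _), partialD_const, sub_zero,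
      (hu₀ _ (heΩ hy.1)).2]
  · rw [partialD_sub (hv₀ _ (heΩ hy.1)).1.diffAt (differentiableAt_const _), partialD_const, sub_zero,
      (hv₀ _ (heΩ hy.1)).2]
  · have hk : HasDerivAt (fun τ => 3 * deriv A τ / (4 * A τ))
        (deriv (fun τ => 3 * deriv A τ / (4 * A τ)) t) t := by
      have h1 := (hAs t ht).deriv_curve.diffAt
      have h2 := (hAs t ht).diffAt
      exact ((h1.const_mul 3).fun_div (h2.const_mul 4) (by simpa using (hAp t ht).ne')).hasDerivAt
    refine hk.congr_deriv ?_
    have hy : Θ t 0 ∈ Ω' := by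
      refine ⟨hsrc t ht 0 hz0, ?_⟩
      rw [mem_preimage, hew, hinv t ht 0 hz0]
      exact ⟨ht, hz0⟩
    have hut := hu t ht 0 hz0
    have hs := hfA _ hy
    rw [hut] at hs
    rw [h.riccati (hB (heΩ hy.1)) (m := deriv (fun τ => 3 * deriv A τ / (4 * A τ)) t), hs.1, hs.2]
    intro i
    have hud := (hu₀ _ (heΩ hy.1))
    have e1 : (fun y => 3 * s y / (4 * f y)) =ᶠ[𝓝 (Θ t 0)]
        fun y => 3 * deriv A (u₀ y - u₀ x) / (4 * A (u₀ y - u₀ x)) := by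
      filter_upwards [hO.mem_nhds hy] with y hy
      rw [(hfA y hy).1, (hfA y hy).2]
    rw [partialD_congr e1, partialD_comp (g := fun τ => 3 * deriv A τ / (4 * A τ))
      (g' := deriv (fun τ => 3 * deriv A τ / (4 * A τ)) t) (by rw [hut]; exact hk)
      (hud.1.diffAt.sub_const _), partialD_sub hud.1.diffAt (differentiableAt_const _), partialD_const,
      sub_zero, hud.2]

end Profile

/-! ### Linear differential equations for matrices -/

section LinearODE

/-- The real `4 × 4` matrices. -/
abbrev Mat : Type := Matrix (Fin 4) (Fin 4) ℝ

/-- The entries of a curve of matrices have the entries of `R'` as their derivatives. -/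
def HasDerivEntries (R : ℝ → Mat) (R' : Mat) (t : ℝ) : Prop :=
  ∀ i j, HasDerivAt (fun τ => R τ i j) (R' i j) t

variable {R S P : ℝ → Mat} {R' S' : Mat} {t δ : ℝ}

theorem HasDerivEntries.mul (hR : HasDerivEntries R R' t) (hS : HasDerivEntries S S' t) :
    HasDerivEntries (fun τ => R τ * S τ) (R' * S t + R t * S') t := by
  intro i j
  simp only [Matrix.mul_apply, Matrix.add_apply, ← Finset.sum_add_distrib]
  exact HasDerivAt.fun_sum fun k _ => (hR i k).mul (hS k j)

theorem HasDerivEntries.const (C : Mat) (t : ℝ) : HasDerivEntries (fun _ => C) 0 t :=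
  fun _ _ => hasDerivAt_const t _

theorem HasDerivEntries.transpose (hR : HasDerivEntries R R' t) :
    HasDerivEntries (fun τ => (R τ)ᵀ) R'ᵀ t := fun i j => hR j i

theorem HasDerivEntries.eq_const (hR : ∀ t ∈ Ioo (-δ) δ, HasDerivEntries R 0 t)
    (ht : t ∈ Ioo (-δ) δ) : R t = R 0 := by
  ext i j
  have h0 : (0 : ℝ) ∈ Ioo (-δ) δ := by
    have := ht.1.trans ht.2
    exact ⟨by linarith, by linarith⟩
  exact isOpen_Ioo.is_const_of_deriv_eq_zero isPreconnected_Ioo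
    (fun τ hτ => (hR τ hτ i j).differentiableAt.differentiableWithinAt)
    (fun τ hτ => (hR τ hτ i j).deriv) ht h0

/-- Adjoining the time as an extra coordinate makes the equation autonomous, so the flow of a smooth
vector field suffices. -/
theorem exists_fundamental_solution (hδ : 0 < δ)
    (hP : ∀ t ∈ Ioo (-δ) δ, ∀ i j, ContDiffAt ℝ ∞ (fun τ => P τ i j) t) :
    ∃ (R : ℝ → Mat) (ε : ℝ), 0 < ε ∧ ε ≤ δ ∧ R 0 = 1 ∧ ∀ t ∈ Ioo (-ε) ε,
      (∀ i j, ContDiffAt ℝ ∞ (fun τ => R τ i j) t) ∧ HasDerivEntries R (R t * P t) t := by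
  let V : ℝ × (Fin 4 → Fin 4 → ℝ) → ℝ × (Fin 4 → Fin 4 → ℝ) :=
    fun y => (1, fun i j => ∑ k, y.2 i k * P y.1 k j)
  have hV : ∀ y ∈ (Prod.fst ⁻¹' Ioo (-δ) δ : Set (ℝ × (Fin 4 → Fin 4 → ℝ))), ContDiffAt ℝ ∞ V y := by
    intro y hy
    refine contDiffAt_const.prodMk (contDiffAt_pi.2 fun i => contDiffAt_pi.2 fun j =>
      ContDiffAt.sum fun k _ => ContDiffAt.mul ?_ ?_)
    · exact (contDiffAt_pi.1 (contDiffAt_pi.1 contDiffAt_snd i) k)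
    · exact (hP y.1 hy k j).comp y contDiffAt_fst
  obtain ⟨ξ, ε, hε, h0, hξ⟩ := exists_smooth_integralCurve (isOpen_Ioo.preimage continuous_fst) hV
    (x := (0, fun i j => (1 : Mat) i j)) (by simpa using hδ)
  have h1 : ∀ t ∈ Ioo (-ε) ε, (ξ t).1 = t := by
    have hz : (0 : ℝ) ∈ Ioo (-ε) ε := ⟨by linarith, hε⟩
    have hd : ∀ t ∈ Ioo (-ε) ε, HasDerivAt (fun τ => (ξ τ).1 - τ) 0 t := by
      intro t ht
      have h2 : HasDerivAt (fun τ => (ξ τ).1) 1 t :=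
        (hasFDerivAt_fst (𝕜 := ℝ) (p := ξ t)).comp_hasDerivAt t (hξ t ht).2.2
      simpa using h2.fun_sub (hasDerivAt_id t)
    intro t ht
    have := isOpen_Ioo.is_const_of_deriv_eq_zero isPreconnected_Ioo
      (fun τ hτ => (hd τ hτ).differentiableAt.differentiableWithinAt)
      (fun τ hτ => (hd τ hτ).deriv) ht hz
    rw [h0] at this
    simp only [sub_self] at this
    linarith
  refine ⟨fun t => Matrix.of (ξ t).2, min ε δ, lt_min hε hδ, min_le_right _ _,
    congrArg Prod.snd h0, fun t ht => ?_⟩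
  have ht' : t ∈ Ioo (-ε) ε := by
    have := min_le_left ε δ
    exact ⟨by linarith [ht.1], by linarith [ht.2]⟩
  obtain ⟨-, h2, h3⟩ := hξ t ht'
  refine ⟨fun i j => contDiffAt_pi.1 (contDiffAt_pi.1 (contDiffAt_snd.comp t h2) i) j, fun i j => ?_⟩
  have h4 : HasDerivAt (fun τ => (ξ τ).2) (V (ξ t)).2 t :=
    (hasFDerivAt_snd (𝕜 := ℝ) (p := ξ t)).comp_hasDerivAt t h3
  have h5 := hasDerivAt_pi.1 (hasDerivAt_pi.1 h4 i) j
  refine h5.congr_deriv ?_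
  simp only [V, h1 t ht', Matrix.mul_apply, Matrix.of_apply]

end LinearODE

/-! ### The moving frame -/

section Frame

/-- The derivative of the frame along the gradient of the mean curvature function. -/
def frameP (c l : ℝ) : Mat := !![0, -c, 0, 0; 1, 0, 0, -l; 0, 0, 0, 0; 0, l, 0, 0]

/-- The derivative of the frame along the level curves of the mean curvature function. -/
def frameQ (c k l : ℝ) : Mat := !![0, 0, -c, 0; 0, 0, k, 0; 1, -k, 0, -l; 0, 0, l, 0]

/-- The form preserved by the frames. -/
def frameC (c : ℝ) : Mat := !![c, 0, 0, 0; 0, 1, 0, 0; 0, 0, 1, 0; 0, 0, 0, 1]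

variable {c : ℝ}

theorem frameP_skew (l : ℝ) : frameP c l * frameC c + frameC c * (frameP c l)ᵀ = 0 := by
  ext i j
  simp only [Matrix.add_apply, Matrix.mul_apply, Fin.sum_univ_four, Matrix.transpose_apply]
  fin_cases i <;> fin_cases j <;> simp [frameP, frameC]

theorem frameQ_skew (k l : ℝ) : frameQ c k l * frameC c + frameC c * (frameQ c k l)ᵀ = 0 := by
  ext i j
  simp only [Matrix.add_apply, Matrix.mul_apply, Fin.sum_univ_four, Matrix.transpose_apply]
  fin_cases i <;> fin_cases j <;> simp [frameQ, frameC]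

/-- With C = `frameC c`, the derivative of R C Rᵀ is R (P C + C Pᵀ) Rᵀ = 0. For c ≠ 0, C is the
inverse of the Gram matrix diag(1/c, 1, 1, 1) of a frame; this dual form remains meaningful at c =
0. -/
theorem HasDerivEntries.preserves {R : ℝ → Mat} {P : ℝ → Mat} {δ : ℝ} (h0 : R 0 = 1)
    (hR : ∀ t ∈ Ioo (-δ) δ, HasDerivEntries R (R t * P t) t)
    (hP : ∀ t, P t * frameC c + frameC c * (P t)ᵀ = 0) {t : ℝ} (ht : t ∈ Ioo (-δ) δ) :
    R t * frameC c * (R t)ᵀ = frameC c := by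
  have := HasDerivEntries.eq_const (R := fun τ => R τ * frameC c * (R τ)ᵀ) (fun t ht => by
    have h1 := ((hR t ht).mul (HasDerivEntries.const (frameC c) t)).mul (hR t ht).transpose
    have h2 : (R t * P t * frameC c + R t * 0) * (R t)ᵀ + R t * frameC c * (R t * P t)ᵀ = 0 := by
      have : R t * (P t * frameC c + frameC c * (P t)ᵀ) * (R t)ᵀ = 0 := by rw [hP]; simp
      rw [Matrix.mul_zero, add_zero, Matrix.transpose_mul, ← this]
      noncomm_ring
    rwa [h2] at h1) ht
  simp only [h0] at this
  simpa using this

/-- The fundamental solution of a linear equation intertwines a second coefficient matrix that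
satisfies the zero curvature equation. -/
theorem HasDerivEntries.intertwines {R P Q Q' : ℝ → Mat} {δ : ℝ} (hδ : 0 < δ) (h0 : R 0 = 1)
    (hP : ∀ t ∈ Ioo (-δ) δ, ∀ i j, ContDiffAt ℝ ∞ (fun τ => P τ i j) t)
    (hR : ∀ t ∈ Ioo (-δ) δ, HasDerivEntries R (R t * P t) t)
    (hQ : ∀ t ∈ Ioo (-δ) δ, HasDerivEntries Q (Q' t) t)
    (hz : ∀ t ∈ Ioo (-δ) δ, Q' t + P t * Q t - Q t * P t = 0) :
    ∃ ε, 0 < ε ∧ ε ≤ δ ∧ ∀ t ∈ Ioo (-ε) ε, Q 0 * R t = R t * Q t := by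
  -- The transpose of S solves the adjoint equation and is the inverse of R, so R⁻¹ need not be
  -- differentiated.
  obtain ⟨S, ε, hε, hεδ, hS0, hS⟩ := exists_fundamental_solution (P := fun t => -(P t)ᵀ) hδ
    (fun t ht i j => (hP t ht j i).neg)
  refine ⟨ε, hε, hεδ, fun t ht => ?_⟩
  have hsub : ∀ t ∈ Ioo (-ε) ε, t ∈ Ioo (-δ) δ := fun t ht =>
    ⟨by linarith [ht.1], by linarith [ht.2]⟩
  have hL : ∀ t ∈ Ioo (-ε) ε, HasDerivEntries (fun τ => (S τ)ᵀ) (-(P t * (S t)ᵀ)) t := by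
    intro t ht
    have := (hS t ht).2.transpose
    rwa [Matrix.transpose_mul, Matrix.transpose_neg, Matrix.transpose_transpose,
      Matrix.neg_mul] at this
  have e1 := HasDerivEntries.eq_const (R := fun τ => R τ * (S τ)ᵀ) (fun t ht => by
    have h1 := (hR t (hsub t ht)).mul (hL t ht)
    have h2 : R t * P t * (S t)ᵀ + R t * -(P t * (S t)ᵀ) = 0 := by noncomm_ring
    rwa [h2] at h1) ht
  -- The zero curvature equation says that the conjugate R Q R⁻¹ is constant.
  have e2 := HasDerivEntries.eq_const (R := fun τ => R τ * Q τ * (S τ)ᵀ) (fun t ht => by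
    have h1 := ((hR t (hsub t ht)).mul (hQ t (hsub t ht))).mul (hL t ht)
    have h2 : (R t * P t * Q t + R t * Q' t) * (S t)ᵀ + R t * Q t * -(P t * (S t)ᵀ) = 0 := by
      have : R t * (Q' t + P t * Q t - Q t * P t) * (S t)ᵀ = 0 := by rw [hz t (hsub t ht)]; simp
      rw [← this]
      noncomm_ring
    rwa [h2] at h1) ht
  simp only [h0, hS0, Matrix.transpose_one, mul_one, one_mul] at e1 e2
  have e3 := mul_eq_one_comm.1 e1
  rw [← e2, mul_assoc, e3, mul_one]

/-- The coefficients of the equations of the frame, in terms of the mean curvature function `A`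
as a function of the arc length of its gradient curves. -/
theorem exists_frame {A : ℝ → ℝ} {δ : ℝ} (hδ : 0 < δ) (hA : ∀ t ∈ Ioo (-δ) δ, ContDiffAt ℝ ∞ A t ∧
      0 < A t ∧ HasDerivAt (fun τ => 3 * deriv A τ / (4 * A τ))
          ((3 * deriv A t / (4 * A t)) ^ 2 + c - 3 / 4 * A t ^ 2) t) :
    ∃ (R V : ℝ → Mat) (Q₀ : Mat) (ε : ℝ), 0 < ε ∧ ε ≤ δ ∧ R 0 = 1 ∧ V 0 = 1 ∧ ∀ t ∈ Ioo (-ε) ε,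
      (∀ i j, ContDiffAt ℝ ∞ (fun τ => R τ i j) t) ∧ (∀ i j, ContDiffAt ℝ ∞ (fun τ => V τ i j) t) ∧
      HasDerivEntries R (R t * frameP c (-(A t / 2))) t ∧ HasDerivEntries V (V t * Q₀) t ∧
      A t ^ (3 / 4 : ℝ) • (Q₀ * R t) = R t * frameQ c (3 * deriv A t / (4 * A t)) (3 * A t / 2) ∧
      R t * frameC c * (R t)ᵀ = frameC c ∧ V t * frameC c * (V t)ᵀ = frameC c := by
  set k : ℝ → ℝ := fun τ => 3 * deriv A τ / (4 * A τ) with hk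
  -- θ¹ = ρ dv, so the coefficient of the frame equation in the v direction is ρ times `frameQ`.
  set ρ : ℝ → ℝ := fun τ => (A τ ^ (3 / 4 : ℝ))⁻¹ with hρ
  set P : ℝ → Mat := fun t => frameP c (-(A t / 2)) with hPdef
  have hP : ∀ t ∈ Ioo (-δ) δ, ∀ i j, ContDiffAt ℝ ∞ (fun τ => P τ i j) t := by
    intro t ht i j
    have h1 : ContDiffAt ℝ ∞ (fun τ => -(A τ / 2)) t := ((hA t ht).1.div_const 2).neg
    have h2 : ContDiffAt ℝ ∞ (fun τ => A τ / 2) t := (hA t ht).1.div_const 2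
    fin_cases i <;> fin_cases j <;> simp [hPdef, frameP] <;>
      first | exact contDiffAt_const | exact h1 | exact h2
  obtain ⟨R, ε₁, hε₁, hεδ₁, hR0, hR⟩ := exists_fundamental_solution hδ hP
  set Q : ℝ → Mat := fun t => ρ t • frameQ c (k t) (3 * A t / 2) with hQdef
  have hAd : ∀ t ∈ Ioo (-δ) δ, HasDerivAt A (4 / 3 * k t * A t) t := by
    intro t ht
    refine (hA t ht).1.diffAt.hasDerivAt.congr_deriv ?_
    have := (hA t ht).2.1.ne'
    simp only [hk]
    field_simp
  have hρd : ∀ t ∈ Ioo (-δ) δ, HasDerivAt ρ (-(k t * ρ t)) t := by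
    intro t ht
    have h0 := (hA t ht).2.1
    have h1 := ((hAd t ht).rpow_const (p := 3 / 4) (Or.inl h0.ne')).fun_inv
      (Real.rpow_pos_of_pos h0 _).ne'
    refine h1.congr_deriv ?_
    have h2 := (Real.rpow_pos_of_pos h0 (3 / 4)).ne'
    rw [Real.rpow_sub_one h0.ne']
    have h3 := h0.ne'
    simp only [hρ]
    field_simp
  have hkd : ∀ t ∈ Ioo (-δ) δ, HasDerivAt k (k t ^ 2 + c - 3 / 4 * A t ^ 2) t :=
    fun t ht => (hA t ht).2.2
  -- The derivative of Q after inserting ρ' = -kρ, A' = 4kA/3 and the Riccati equation, in which k²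
  -- cancels.
  set Q' : ℝ → Mat := fun t => ρ t • !![0, 0, c * k t, 0; 0, 0, c - 3 / 4 * A t ^ 2, 0;
    -k t, -(c - 3 / 4 * A t ^ 2), 0, -(k t * A t / 2); 0, 0, k t * A t / 2, 0] with hQ'def
  have hQ : ∀ t ∈ Ioo (-δ) δ, HasDerivEntries Q (Q' t) t := by
    intro t ht i j
    have d1 := hρd t ht
    have d2 := (hρd t ht).fun_mul (hkd t ht)
    have d3 := (hρd t ht).fun_mul (((hAd t ht).const_mul 3).div_const 2)
    have d4 := (hρd t ht).fun_mul (hasDerivAt_const t c)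
    have z := hasDerivAt_const t (0 : ℝ)
    fin_cases i <;> fin_cases j <;>
      simp only [hQdef, hQ'def, frameQ, Matrix.smul_apply, Matrix.of_apply, Matrix.cons_val',
        Matrix.cons_val_zero, Matrix.cons_val_one, Matrix.cons_val, Matrix.cons_val_fin_one,
        smul_eq_mul, mul_zero, mul_one, mul_neg, Fin.zero_eta, Fin.mk_one, Fin.reduceFinMk,
        Fin.isValue] <;>
      first
        | exact z
        | (refine d1.congr_deriv ?_; ring)
        | (refine d2.congr_deriv ?_; ring)
        | (refine d3.congr_deriv ?_; ring)
        | (refine d2.fun_neg.congr_deriv ?_; ring)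
        | (refine d3.fun_neg.congr_deriv ?_; ring)
        | (refine d4.fun_neg.congr_deriv ?_; ring)
  -- The Gauss and Codazzi equations of the prospective surface, with principal curvatures -A/2 and
  -- 3A/2.
  have hz : ∀ t ∈ Ioo (-δ) δ, Q' t + P t * Q t - Q t * P t = 0 := by
    intro t _
    simp only [hQdef, hQ'def, hPdef, Matrix.mul_smul, Matrix.smul_mul, ← smul_add, ← smul_sub]
    rw [smul_eq_zero]
    right
    ext i j
    fin_cases i <;> fin_cases j <;>
      simp [frameP, frameQ] <;> ring
  have hsub₁ : ∀ t ∈ Ioo (-ε₁) ε₁, t ∈ Ioo (-δ) δ := fun t ht =>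
    ⟨by linarith [ht.1], by linarith [ht.2]⟩
  obtain ⟨ε₂, hε₂, hεε, hQR⟩ := HasDerivEntries.intertwines hε₁ hR0
    (fun t ht => hP t (hsub₁ t ht)) (fun t ht => (hR t ht).2) (fun t ht => hQ t (hsub₁ t ht))
    (fun t ht => hz t (hsub₁ t ht))
  -- A constant coefficient: V is a one-parameter group of motions, whose orbits are the level
  -- curves of f.
  obtain ⟨V, ε₃, hε₃, -, hV0, hV⟩ := exists_fundamental_solution (P := fun _ => Q 0) hδ
    (fun t ht i j => contDiffAt_const)
  refine ⟨R, V, Q 0, min ε₂ ε₃, lt_min hε₂ hε₃, (min_le_left _ _).trans (hεε.trans hεδ₁), hR0, hV0,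
    fun t ht => ?_⟩
  have m1 := min_le_left ε₂ ε₃
  have m2 := min_le_right ε₂ ε₃
  have t1 : t ∈ Ioo (-ε₁) ε₁ := ⟨by linarith [ht.1], by linarith [ht.2]⟩
  have t2 : t ∈ Ioo (-ε₂) ε₂ := ⟨by linarith [ht.1], by linarith [ht.2]⟩
  have t3 : t ∈ Ioo (-ε₃) ε₃ := ⟨by linarith [ht.1], by linarith [ht.2]⟩
  refine ⟨(hR t t1).1, (hV t t3).1, (hR t t1).2, (hV t t3).2, ?_, ?_, ?_⟩
  · have := (Real.rpow_pos_of_pos (hA t (hsub₁ t t1)).2.1 (3 / 4)).ne'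
    rw [hQR t t2]
    simp only [hQdef, hρ, Matrix.mul_smul, smul_smul, mul_inv_cancel₀ this, one_smul, hk]
  · exact HasDerivEntries.preserves (δ := ε₁) hR0 (fun t ht => (hR t ht).2)
      (fun t => frameP_skew _) t1
  · refine HasDerivEntries.preserves (δ := ε₃) (P := fun _ => Q 0) hV0 (fun t ht => (hV t ht).2)
      (fun _ => ?_) t3
    simp only [hQdef, Matrix.smul_mul, Matrix.transpose_smul, Matrix.mul_smul]
    rw [← smul_add, frameQ_skew, smul_zero]

end Frame

/-! ### Construction of the surface -/

section FrameGram

variable {c : ℝ} {F M : Mat}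

/-- A column of a matrix. -/
def colVec (F : Mat) (j : Fin 4) : E4 := WithLp.toLp 2 fun a => F a j

theorem colVec_apply (j a : Fin 4) : colVec F j a = F a j := rfl

/-- The initial value of the frame: a point of the space form and an orthonormal basis of the tangent
space at that point. -/
def frameOrigin (c : ℝ) : Mat :=
  !![0, 1, 0, 0; 0, 0, 1, 0; 0, 0, 0, 1; (√|c|)⁻¹, 0, 0, 0]

theorem form_colVec (j k : Fin 4) :
    form c (colVec (frameOrigin c * M) j) (colVec (frameOrigin c * M) k) =
      (Mᵀ * frameC c⁻¹ * M) j k := by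
  -- The sign of the last coordinate in the form matches the sign of c. At c = 0 both sides are 0 by
  -- the convention for inverses, so no case distinction is needed.
  have hr : (if c < 0 then -1 else 1) * ((√|c|)⁻¹ * (√|c|)⁻¹) = c⁻¹ := by
    rw [← mul_inv, Real.mul_self_sqrt (abs_nonneg c)]
    split_ifs with h
    · rw [abs_of_neg h, inv_neg]
      ring
    · rw [abs_of_nonneg (not_lt.1 h), one_mul]
  simp only [form, colVec_apply, frameOrigin, frameC, Matrix.mul_apply, Fin.sum_univ_four,
    Matrix.transpose_apply]
  simp only [Matrix.of_apply, Matrix.cons_val', Matrix.cons_val_zero, Matrix.cons_val_one,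
    Matrix.cons_val, Matrix.cons_val_fin_one]
  linear_combination M 0 j * M 0 k * hr

/-- The columns of a frame are orthogonal. -/
theorem gram_of_preserves (hc : c ≠ 0) (hM : M * frameC c * Mᵀ = frameC c) :
    Mᵀ * frameC c⁻¹ * M = frameC c⁻¹ := by
  have h1 : frameC c * frameC c⁻¹ = 1 := by
    ext i j
    fin_cases i <;> fin_cases j <;> simp [frameC, hc]
  have h2 : M * (frameC c * Mᵀ * frameC c⁻¹) = 1 := by
    calc M * (frameC c * Mᵀ * frameC c⁻¹) = M * frameC c * Mᵀ * frameC c⁻¹ := by noncomm_ring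
      _ = 1 := by rw [hM, h1]
  have h3 := mul_eq_one_comm.1 h2
  have h4 := mul_eq_one_comm.1 h1
  calc Mᵀ * frameC c⁻¹ * M = (frameC c⁻¹ * frameC c) * (Mᵀ * frameC c⁻¹ * M) := by rw [h4, one_mul]
    _ = frameC c⁻¹ * (frameC c * Mᵀ * frameC c⁻¹ * M) := by noncomm_ring
    _ = frameC c⁻¹ := by rw [h3, mul_one]

/-- The tangential columns of a frame are orthonormal. -/
theorem gram_succ_of_preserves (hM : M * frameC c * Mᵀ = frameC c) (j k : Fin 3) :
    (Mᵀ * frameC c⁻¹ * M) j.succ k.succ = (1 : Matrix (Fin 3) (Fin 3) ℝ) j k := by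
  by_cases hc : c = 0
  · subst hc
    have e := fun i j => congrFun (congrFun hM i) j
    simp only [Matrix.mul_apply, Fin.sum_univ_four, Matrix.transpose_apply, frameC] at e
    simp at e
    -- For c = 0 the corner entry says that a sum of three squares vanishes, so the first row is
    -- zero off the diagonal and the remaining 3 × 3 block is orthogonal.
    have e0 := e 0 0
    simp at e0
    have h1 : M 0 1 = 0 := by nlinarith [mul_self_nonneg (M 0 1), mul_self_nonneg (M 0 2), mul_self_nonneg (M 0 3)]
    have h2 : M 0 2 = 0 := by nlinarith [mul_self_nonneg (M 0 1), mul_self_nonneg (M 0 2), mul_self_nonneg (M 0 3)]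
    have h3 : M 0 3 = 0 := by nlinarith [mul_self_nonneg (M 0 1), mul_self_nonneg (M 0 2), mul_self_nonneg (M 0 3)]
    have hN : M.submatrix Fin.succ Fin.succ * (M.submatrix Fin.succ Fin.succ)ᵀ =
        (1 : Matrix (Fin 3) (Fin 3) ℝ) := by
      ext i l
      have := e i.succ l.succ
      simp only [Matrix.mul_apply, Fin.sum_univ_three, Matrix.transpose_apply, Matrix.submatrix_apply]
      fin_cases i <;> fin_cases l <;> simp at this ⊢ <;> exact this
    have hN' : ((M.submatrix Fin.succ Fin.succ)ᵀ * M.submatrix Fin.succ Fin.succ) j k =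
        (1 : Matrix (Fin 3) (Fin 3) ℝ) j k := by rw [mul_eq_one_comm.1 hN]
    rw [← hN']
    simp only [Matrix.mul_apply, Fin.sum_univ_four, Fin.sum_univ_three, Matrix.transpose_apply,
      Matrix.submatrix_apply, frameC]
    fin_cases j <;> fin_cases k <;> simp [h1, h2, h3]
  · rw [gram_of_preserves hc hM]
    fin_cases j <;> fin_cases k <;> simp [frameC]

/-- In the flat case (√0)⁻¹ = 0, so the last row of the initial frame vanishes: the frame starts at
the origin and stays in the hyperplane. -/
theorem frameOrigin_zero_mul (hc : c = 0) (j : Fin 4) : (frameOrigin c * M) 3 j = 0 := by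
  simp [frameOrigin, hc, Matrix.mul_apply, Fin.sum_univ_four]

end FrameGram

/-! ### Partial derivatives of matrix-valued maps -/

section Partial

variable {F H : E2 → Mat} {F' H' : Mat} {x : E2} {i : Fin 2}

/-- The entries of `F'` are the partial derivatives of the entries of `F`. -/
def HasPartialEntries (i : Fin 2) (F : E2 → Mat) (F' : Mat) (x : E2) : Prop :=
  ∀ a b, DifferentiableAt ℝ (fun y => F y a b) x ∧ partialD i (fun y => F y a b) x = F' a b

theorem HasPartialEntries.mul (hF : HasPartialEntries i F F' x) (hH : HasPartialEntries i H H' x) :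
    HasPartialEntries i (fun y => F y * H y) (F x * H' + F' * H x) x := by
  intro a b
  have hd := fun k => (hF a k).1.fun_mul (hH k b).1
  refine ⟨?_, ?_⟩
  · simp only [Matrix.mul_apply]
    exact DifferentiableAt.fun_sum fun k _ => hd k
  · simp only [Matrix.mul_apply, Matrix.add_apply, ← Finset.sum_add_distrib]
    rw [partialD, fderiv_fun_sum fun k _ => hd k]
    simp only [_root_.sum_apply]
    refine Finset.sum_congr rfl fun k _ => ?_
    have := partialD_mul (i := i) (hF a k).1 (hH k b).1
    rw [partialD] at this
    rw [this, (hF a k).2, (hH k b).2]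

theorem HasPartialEntries.const (C : Mat) : HasPartialEntries i (fun _ => C) 0 x :=
  fun _ _ => ⟨differentiableAt_const _, partialD_const _⟩

theorem HasDerivEntries.comp {R : ℝ → Mat} {R' : Mat} {u : E2 → ℝ} (hR : HasDerivEntries R R' (u x))
    (hu : DifferentiableAt ℝ u x) :
    HasPartialEntries i (fun y => R (u y)) (partialD i u x • R') x := by
  intro a b
  refine ⟨(hR a b).differentiableAt.comp x hu, ?_⟩
  rw [partialD_comp (hR a b) hu, Matrix.smul_apply, smul_eq_mul, mul_comm]

end Partial

/-! ### The surface swept out by the moving frame -/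

section Surface

variable {c : ℝ} {G : E2 → Matrix (Fin 2) (Fin 2) ℝ} {Ω : Set E2} {x : E2}
  {θ : Fin 2 → Fin 2 → E2 → ℝ} {f s : E2 → ℝ}

/-- The equations for dΨ and dN determine the induced metric and the shape operator, with
eigenvalues -f/2 on E₁ and 3f/2 on E₂. Its trace is f, and 2A(∇f) + f∇f = 0 because ∇f points along
E₁. -/
theorem IsAdaptedOn.surface_eq (h : IsAdaptedOn c G θ f s Ω) {Ψ N E₁ E₂ : E2 → E4}
    (hΨ : ∀ x ∈ Ω, ContDiffAt ℝ ∞ Ψ x) (hN : ∀ x ∈ Ω, ContDiffAt ℝ ∞ N x)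
    (hmem : ∀ x ∈ Ω, Ψ x ∈ spaceForm c) (htan : ∀ x ∈ Ω, N x ∈ spaceFormTangent c (Ψ x))
    (h11 : ∀ x ∈ Ω, form c (E₁ x) (E₁ x) = 1) (h22 : ∀ x ∈ Ω, form c (E₂ x) (E₂ x) = 1)
    (h12 : ∀ x ∈ Ω, form c (E₁ x) (E₂ x) = 0) (h1 : ∀ x ∈ Ω, form c (N x) (E₁ x) = 0)
    (h2 : ∀ x ∈ Ω, form c (N x) (E₂ x) = 0) (hNN : ∀ x ∈ Ω, form c (N x) (N x) = 1)
    (hdΨ : ∀ x ∈ Ω, ∀ i, partialD i Ψ x = θ 0 i x • E₁ x + θ 1 i x • E₂ x)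
    (hdN : ∀ x ∈ Ω, ∀ i, partialD i N x =
      (θ 0 i x * (f x / 2)) • E₁ x + (θ 1 i x * -(3 * f x / 2)) • E₂ x) :
    IsSurfaceOn c G Ψ N Ω ∧ ∀ x ∈ Ω, coordMeanCurvature c G Ψ N x = f x ∧
      ∀ k, biconsForm c G Ψ N k x = 0 := by
  have hs : ∀ x ∈ Ω, ∀ i j, sff c Ψ N i j x =
      -(f x / 2) * (θ 0 i x * θ 0 j x) + 3 * f x / 2 * (θ 1 i x * θ 1 j x) := by
    intro x hx i j
    rw [sff, hdΨ x hx, hdN x hx]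
    simp only [form_add_left, form_add_right, form_smul_left, form_smul_right, h11 x hx, h22 x hx,
      h12 x hx, form_comm c (E₂ x) (E₁ x)]
    ring
  have hm : ∀ x ∈ Ω, coordMeanCurvature c G Ψ N x = f x := by
    intro x hx
    have hD := h.coframe.area_ne_zero h.metric hx
    obtain ⟨g1, g2, g3, g4⟩ := h.coframe.inv_eq h.metric hx
    have hA : area θ x = θ 0 0 x * θ 1 1 x - θ 0 1 x * θ 1 0 x := rfl
    simp only [coordMeanCurvature, hs x hx, Fin.sum_univ_two, g1, g2, g3, g4]
    generalize area θ x = D at *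
    field_simp
    rw [hA]
    ring
  refine ⟨⟨h.metric, hΨ, hN, hmem, fun x hx i j => ?_, htan, fun x hx i => ?_, hNN⟩,
    fun x hx => ⟨hm x hx, fun k => ?_⟩⟩
  · rw [hdΨ x hx, hdΨ x hx, h.coframe.gram x hx]
    simp only [form_add_left, form_add_right, form_smul_left, form_smul_right, h11 x hx, h22 x hx,
      h12 x hx, form_comm c (E₂ x) (E₁ x)]
    ring
  · rw [hdΨ x hx]
    simp only [form_add_right, form_smul_right, h1 x hx, h2 x hx]
    ring
  · have hd : ∀ i, partialD i (coordMeanCurvature c G Ψ N) x = s x * θ 0 i x := by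
      intro i
      rw [← h.partialD_eq x hx i]
      apply partialD_congr
      filter_upwards [h.metric.isOpen.mem_nhds hx] with y hy using hm y hy
    have hD := h.coframe.area_ne_zero h.metric hx
    obtain ⟨g1, g2, g3, g4⟩ := h.coframe.inv_eq h.metric hx
    have hA : area θ x = θ 0 0 x * θ 1 1 x - θ 0 1 x * θ 1 0 x := rfl
    simp only [biconsForm, hs x hx, hm x hx, hd, Fin.sum_univ_two, g1, g2, g3, g4]
    generalize area θ x = D at *
    field_simp
    rw [hA]
    ring

theorem colVec_mul_frameP (F : Mat) (l : ℝ) : colVec (F * frameP c l) 0 = colVec F 1 ∧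
    colVec (F * frameP c l) 3 = -l • colVec F 1 := by
  constructor <;> ext a <;> simp [colVec_apply, frameP, Matrix.mul_apply, Fin.sum_univ_four, mul_comm]

theorem colVec_mul_frameQ (F : Mat) (k l : ℝ) : colVec (F * frameQ c k l) 0 = colVec F 2 ∧
    colVec (F * frameQ c k l) 3 = -l • colVec F 2 := by
  constructor <;> ext a <;> simp [colVec_apply, frameQ, Matrix.mul_apply, Fin.sum_univ_four, mul_comm]

/-- The fundamental theorem of surfaces, for special metrics. -/
theorem IsSpecialOn.exists_surface (h : IsSpecialOn c G θ f s Ω) (hx : x ∈ Ω) :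
    ∃ (Ω' : Set E2) (Ψ N : E2 → E4), x ∈ Ω' ∧ Ω' ⊆ Ω ∧ IsSurfaceOn c G Ψ N Ω' ∧
      ∀ y ∈ Ω', coordMeanCurvature c G Ψ N y = f y ∧ ∀ k, biconsForm c G Ψ N k y = 0 := by
  obtain ⟨Ω₁, u, v, A, δ, hO, hx₁, hsub, hδ, hu0, hv0, hΩ₁, hA⟩ := h.exists_profile hx
  obtain ⟨R, V, Q₀, ε, hε, hεδ, hR0, hV0, hRV⟩ := exists_frame hδ hA
  -- The columns are position, E₁, E₂ and N.
  set F : E2 → Mat := fun y => frameOrigin c * (V (v y) * R (u y)) with hF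
  set Ω₂ : Set E2 := {y | y ∈ Ω₁ ∧ u y ∈ Ioo (-ε) ε ∧ v y ∈ Ioo (-ε) ε} with hΩ₂
  have hmem₂ : ∀ y ∈ Ω₂, Ω₂ ∈ 𝓝 y := by
    intro y hy
    obtain ⟨-, h1, h2, -⟩ := hΩ₁ y hy.1
    filter_upwards [hO.mem_nhds hy.1,
      h1.continuousAt.preimage_mem_nhds (isOpen_Ioo.mem_nhds hy.2.1),
      h2.continuousAt.preimage_mem_nhds (isOpen_Ioo.mem_nhds hy.2.2)] with z z1 z2 z3
    exact ⟨z1, z2, z3⟩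
  have hFs : ∀ y ∈ Ω₂, ∀ a b, ContDiffAt ℝ ∞ (fun z => F z a b) y := by
    intro y hy a b
    obtain ⟨-, h1, h2, -⟩ := hΩ₁ y hy.1
    simp only [hF, Matrix.mul_apply]
    exact ContDiffAt.sum fun k _ => contDiffAt_const.mul (ContDiffAt.sum fun l _ =>
      (((hRV _ hy.2.2).2.1 k l).comp y h2).mul (((hRV _ hy.2.1).1 l b).comp y h1))
  -- The preserved form places the position on the hyperboloid but does not select the sheet; that
  -- is an open condition, true at x.
  set Ω₃ : Set E2 := {y | y ∈ Ω₂ ∧ (c < 0 → 0 < F y 3 0)} with hΩ₃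
  have hO₃ : IsOpen Ω₃ := by
    rw [isOpen_iff_mem_nhds]
    intro y hy
    by_cases hc : c < 0
    · filter_upwards [hmem₂ y hy.1, (hFs y hy.1 3 0).continuousAt.preimage_mem_nhds
        (isOpen_Ioi.mem_nhds (hy.2 hc))] with z z1 z2
      exact ⟨z1, fun _ => z2⟩
    · filter_upwards [hmem₂ y hy.1] with z z1
      exact ⟨z1, fun h => absurd h hc⟩
  have hx₃ : x ∈ Ω₃ := by
    refine ⟨⟨hx₁, by rw [hu0]; exact ⟨by linarith, hε⟩, by rw [hv0]; exact ⟨by linarith, hε⟩⟩,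
      fun hc => ?_⟩
    simp only [hF, hu0, hv0, hR0, hV0, mul_one]
    simp [frameOrigin, hc.ne]
  have hpres : ∀ y ∈ Ω₃, (V (v y) * R (u y)) * frameC c * (V (v y) * R (u y))ᵀ = frameC c := by
    intro y hy
    obtain ⟨-, -, -, -, -, hR, -⟩ := hRV _ hy.1.2.1
    obtain ⟨-, -, -, -, -, -, hV⟩ := hRV _ hy.1.2.2
    -- The right-hand side is expanded to V (R C Rᵀ) Vᵀ.
    nth_rw 2 [← hV]
    nth_rw 2 [← hR]
    rw [Matrix.transpose_mul]
    noncomm_ring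
  have hgram : ∀ y ∈ Ω₃, ∀ j k : Fin 3, form c (colVec (F y) j.succ) (colVec (F y) k.succ) =
      (1 : Matrix (Fin 3) (Fin 3) ℝ) j k := fun y hy j k =>
    (form_colVec j.succ k.succ).trans (gram_succ_of_preserves (hpres y hy) j k)
  have hgram₀ : ∀ y ∈ Ω₃, c ≠ 0 → ∀ j k, form c (colVec (F y) j) (colVec (F y) k) =
      frameC c⁻¹ j k := fun y hy hc j k => by
    rw [hF, form_colVec, gram_of_preserves hc (hpres y hy)]
  -- In the v direction the product rule gives V Q₀ R, with Q₀ in the wrong place; the intertwining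
  -- relation moves it to the right of R, and the factor f^(3/4) from dv = f^(3/4) θ¹ is absorbed
  -- there.
  have hder : ∀ y ∈ Ω₃, ∀ i, HasPartialEntries i F (θ 0 i y • (F y * frameP c (-(f y / 2))) +
      θ 1 i y • (F y * frameQ c (3 * deriv A (u y) / (4 * A (u y))) (3 * f y / 2))) y := by
    intro y hy i
    obtain ⟨-, h1, h2, h3, h4, h5⟩ := hΩ₁ y hy.1.1
    obtain ⟨-, -, hR, -, hQ, -⟩ := hRV _ hy.1.2.1
    obtain ⟨-, -, -, hV, -⟩ := hRV _ hy.1.2.2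
    have key := (HasPartialEntries.const (x := y) (i := i) (frameOrigin c)).mul
      ((hV.comp (i := i) h2.diffAt).mul (hR.comp (i := i) h1.diffAt))
    rw [h3, h4] at key
    rw [← h5] at hQ key
    convert key using 1
    rw [hF, ← h5]
    simp only [Matrix.zero_mul, add_zero, mul_smul_comm, smul_mul_assoc, mul_assoc, ← hQ, mul_add,
      smul_smul]
    rw [mul_comm (θ 1 i y)]
  have hsm : ∀ y ∈ Ω₃, ∀ b, ContDiffAt ℝ ∞ (fun z => colVec (F z) b) y := fun y hy b =>
    contDiffAt_euclidean.2 fun a => hFs y hy.1 a b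
  have hcol : ∀ y ∈ Ω₃, ∀ i b, partialD i (fun z => colVec (F z) b) y =
      θ 0 i y • colVec (F y * frameP c (-(f y / 2))) b +
      θ 1 i y • colVec (F y * frameQ c (3 * deriv A (u y) / (4 * A (u y))) (3 * f y / 2)) b := by
    intro y hy i b
    ext a
    rw [← partialD_coord (hsm y hy b).diffAt]
    exact (hder y hy i a b).2
  have hsub₃ : Ω₃ ⊆ Ω := fun y hy => hsub hy.1.1
  refine ⟨Ω₃, fun y => colVec (F y) 0, fun y => colVec (F y) 3, hx₃, hsub₃,
    (h.toIsAdaptedOn.mono hsub₃ hO₃).surface_eq (E₁ := fun y => colVec (F y) 1)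
      (E₂ := fun y => colVec (F y) 2) (fun y hy => hsm y hy 0) (fun y hy => hsm y hy 3) ?_ ?_
      (fun y hy => by simpa using hgram y hy 0 0) (fun y hy => by simpa using hgram y hy 1 1)
      (fun y hy => by simpa using hgram y hy 0 1) (fun y hy => by simpa using hgram y hy 2 0)
      (fun y hy => by simpa using hgram y hy 2 1) (fun y hy => by simpa using hgram y hy 2 2) ?_ ?_⟩
  · intro y hy
    by_cases hc : c = 0
    · simp only [spaceForm, hc, if_true, mem_ofPred_eq]
      exact frameOrigin_zero_mul hc 0
    · simp only [spaceForm, hc, if_false, mem_ofPred_eq]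
      refine ⟨(hgram₀ y hy hc 0 0).trans (by simp [frameC]), fun hc' => hy.2 hc'⟩
  · intro y hy
    by_cases hc : c = 0
    · simp only [spaceFormTangent, hc, if_true, mem_ofPred_eq]
      exact frameOrigin_zero_mul hc 3
    · simp only [spaceFormTangent, hc, if_false, mem_ofPred_eq]
      exact (hgram₀ y hy hc 3 0).trans (by simp [frameC])
  · intro y hy i
    rw [hcol y hy, (colVec_mul_frameP _ _).1, (colVec_mul_frameQ _ _ _).1]
  · intro y hy i
    rw [hcol y hy, (colVec_mul_frameP _ _).2, (colVec_mul_frameQ _ _ _).2, smul_smul, smul_smul,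
      neg_neg]

end Surface

/-! ### Local embeddings -/

section LocalEmbedding

variable {c : ℝ} {G : E2 → Matrix (Fin 2) (Fin 2) ℝ} {Ψ N : E2 → E4} {Ω : Set E2} {x : E2}

/-- An immersed surface is locally embedded. -/
theorem IsSurfaceOn.exists_leftInverse (h : IsSurfaceOn c G Ψ N Ω) (hx : x ∈ Ω) :
    ∃ (e : OpenPartialHomeomorph E2 E2) (L : E4 → E2), x ∈ e.source ∧ e.source ⊆ Ω ∧
      Continuous L ∧ ∀ y, e y = L (Ψ y) := by
  -- Pairing with the tangent plane at x: the differential of L ∘ Ψ at x is the Gram matrix G x,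
  -- hence invertible.
  set L : E4 → E2 := fun z => !₂[form c z (partialD 0 Ψ x), form c z (partialD 1 Ψ x)] with hL
  have hLc : Continuous L := by
    simp only [hL, form]
    fun_prop
  have hs : ∀ y ∈ Ω, ∀ k, ContDiffAt ℝ ∞ (fun z => form c (Ψ z) (partialD k Ψ x)) y :=
    fun y hy k => (h.smooth y hy).form contDiffAt_const
  have hw : ∀ y ∈ Ω, ContDiffAt ℝ ∞ (fun z => L (Ψ z)) y := by
    intro y hy
    rw [contDiffAt_euclidean]
    intro i
    fin_cases i
    · exact hs y hy 0
    · exact hs y hy 1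
  have hJ : jacobian (fun z => L (Ψ z)) x ≠ 0 := by
    have hp : ∀ i k, partialD i (fun z => form c (Ψ z) (partialD k Ψ x)) x = G x i k := by
      intro i k
      rw [partialD_form (h.smooth x hx) contDiffAt_const, partialD_const, h.isom x hx,
        form_comm c (Ψ x), form_zero_left, add_zero]
    have e0 : ∀ i, partialD i (fun z => L (Ψ z)) x 0 = G x i 0 := fun i =>
      (partialD_coord (hw x hx).diffAt i 0).symm.trans (hp i 0)
    have e1 : ∀ i, partialD i (fun z => L (Ψ z)) x 1 = G x i 1 := fun i =>
      (partialD_coord (hw x hx).diffAt i 1).symm.trans (hp i 1)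
    rw [jacobian, e0, e0, e1, e1, h.metric.symm x hx, ← sq]
    exact (h.metric.det_pos x hx).ne'
  set Ω' : Set E2 := {y | y ∈ Ω ∧ jacobian (fun z => L (Ψ z)) y ≠ 0} with hΩ'
  have hO : IsOpen Ω' := by
    rw [isOpen_iff_mem_nhds]
    intro y hy
    have hp := fun i => (hw y hy.1).partialD i
    have hc : ContinuousAt (jacobian (fun z => L (Ψ z))) y :=
      ((((hp 0).coord 0).mul ((hp 1).coord 1)).sub
        (((hp 1).coord 0).mul ((hp 0).coord 1))).continuousAt
    filter_upwards [h.metric.isOpen.mem_nhds hy.1, hc.eventually_ne hy.2] with z z1 z2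
    exact ⟨z1, z2⟩
  obtain ⟨e, h1, h2, h3, -⟩ := exists_local_diffeomorph hO (fun y hy => hw y hy.1)
    (fun y hy => hy.2) ⟨hx, hJ⟩
  exact ⟨e, L, h1, fun y hy => (h2 hy).1, hLc, h3⟩

end LocalEmbedding

/-! ### Transfer of the coordinate surface to the manifold -/

section Manifold

variable {M : Type*} [TopologicalSpace M] [ChartedSpace E2 M] [IsManifold (𝓡 2) ∞ M]
  {g : SurfaceMetric M} {c : ℝ} {p : M} {x : E2} {G : E2 → Matrix (Fin 2) (Fin 2) ℝ}
  {Ψ N : E2 → E4} {Ω : Set E2}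

omit [IsManifold (𝓡 2) ∞ M] in
theorem comp_chart_symm_eventuallyEq (F : E2 → E4) (hx : x ∈ (chartAt E2 p).target) :
    (F ∘ chartAt E2 p) ∘ (chartAt E2 p).symm =ᶠ[𝓝 x] F := by
  filter_upwards [(chartAt E2 p).open_target.mem_nhds hx] with y hy
  simp [(chartAt E2 p).right_inv hy]

theorem chartD_surjective (hx : x ∈ (chartAt E2 p).target) :
    Function.Surjective (chartD (chartAt E2 p) x) :=
  LinearMap.injective_iff_surjective (f := (chartD (chartAt E2 p) x : E2 →ₗ[ℝ] E2)).1
    (chartD_injective hx)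

theorem contMDiffAt_comp_chart {F : E2 → E4} (hx : x ∈ (chartAt E2 p).target)
    (hF : ContDiffAt ℝ ∞ F x) :
    ContMDiffAt (𝓡 2) 𝓘(ℝ, E4) ∞ (F ∘ chartAt E2 p) ((chartAt E2 p).symm x) :=
  contMDiffAt_of_chart hx (hF.congr_of_eventuallyEq (comp_chart_symm_eventuallyEq F hx))

theorem diff_comp_chart {F : E2 → E4} (hx : x ∈ (chartAt E2 p).target)
    (hF : ContDiffAt ℝ ∞ F x) (v : E2) :
    diff (F ∘ chartAt E2 p) ((chartAt E2 p).symm x) (chartD (chartAt E2 p) x v) =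
      v 0 • partialD 0 F x + v 1 • partialD 1 F x := by
  have := fderiv_comp_chart_symm hx
    ((contMDiffAt_comp_chart hx hF).mdifferentiableAt (by simp)) v
  rw [← fderiv_eq_partialD, ← (comp_chart_symm_eventuallyEq F hx).fderiv_eq]
  exact this.symm

theorem coordMeanCurvature_congr {Ψ' N' : E2 → E4} (hΨ : Ψ' =ᶠ[𝓝 x] Ψ) (hN : N' =ᶠ[𝓝 x] N) :
    coordMeanCurvature c G Ψ' N' x = coordMeanCurvature c G Ψ N x := by
  simp only [coordMeanCurvature, sff, partialD_congr hΨ, partialD_congr hN]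

theorem biconsForm_congr {Ψ' N' : E2 → E4} (hΨ : Ψ' =ᶠ[𝓝 x] Ψ) (hN : N' =ᶠ[𝓝 x] N) (k : Fin 2) :
    biconsForm c G Ψ' N' k x = biconsForm c G Ψ N k x := by
  have e : coordMeanCurvature c G Ψ' N' =ᶠ[𝓝 x] coordMeanCurvature c G Ψ N := by
    filter_upwards [hΨ.eventuallyEq_nhds, hN.eventuallyEq_nhds] with y h1 h2
    exact coordMeanCurvature_congr h1 h2
  simp only [biconsForm, partialD_congr e, e.eq_of_nhds, sff, partialD_congr hΨ, partialD_congr hN]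

/-- A metric that satisfies the local geometric condition is induced by a biconservative local
embedding. -/
theorem IsSpecialAt.exists_embedding (h : IsSpecialAt g c p) :
    ∃ U : Set M, IsOpen U ∧ p ∈ U ∧ ∃ ψ η : M → E4,
    IsIsometricEmbeddingOn g c ψ U ∧ IsUnitNormalOn c ψ η U ∧ IsBiconservativeOn g c ψ U ∧
    ∀ q ∈ U, 0 < meanCurvature g c ψ η q ∧ gradE g (meanCurvature g c ψ η) q ≠ 0 := by
  obtain ⟨Ω, θ, f, s, hΩ, hp, hS⟩ := h
  obtain ⟨Ω', Ψ, N, hp', hsub, hΨ, hf⟩ := hS.exists_surface hp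
  obtain ⟨e, L, hpe, heΩ, hL, heL⟩ := hΨ.exists_leftInverse hp'
  set φ := chartAt E2 p with hφ
  set U : Set M := (φ.trans e).source with hU
  have hUe : U = φ.source ∩ φ ⁻¹' e.source := by rw [hU, OpenPartialHomeomorph.trans_source]
  have hUo : IsOpen U := (φ.trans e).open_source
  have hx : ∀ q ∈ U, ∃ x ∈ e.source, φ.symm x = q := by
    intro q hq
    rw [hUe] at hq
    exact ⟨φ q, hq.2, φ.left_inv hq.1⟩
  have htgt : ∀ x ∈ e.source, x ∈ φ.target := fun x hx => hΩ (hsub (heΩ hx))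
  have hinv : ∀ x ∈ e.source, φ (φ.symm x) = x := fun x hx => φ.right_inv (htgt x hx)
  have hmem : ∀ x ∈ e.source, x ∈ chartDom p U := by
    intro x hx
    refine ⟨htgt x hx, ?_⟩
    rw [mem_preimage, hUe]
    refine ⟨φ.map_target (htgt x hx), ?_⟩
    rw [mem_preimage, hinv x hx]
    exact hx
  have hsm := fun x (hx : x ∈ e.source) => contMDiffAt_comp_chart (htgt x hx) (hΨ.smooth x (heΩ hx))
  have hsm' := fun x (hx : x ∈ e.source) =>
    contMDiffAt_comp_chart (htgt x hx) (hΨ.smooth_normal x (heΩ hx))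
  have hcont : ContMDiffOn (𝓡 2) 𝓘(ℝ, E4) ∞ (Ψ ∘ φ) U := by
    intro q hq
    obtain ⟨x, hx, rfl⟩ := hx q hq
    exact (hsm x hx).contMDiffWithinAt
  have hψ : IsIsometricEmbeddingOn g c (Ψ ∘ φ) U := by
    refine ⟨hcont, ?_, ?_, ?_⟩
    · intro q hq
      obtain ⟨x, hx, rfl⟩ := hx q hq
      rw [Function.comp, hinv x hx]
      exact hΨ.mem x (heΩ hx)
    · intro q hq v w
      obtain ⟨x, hx, rfl⟩ := hx q hq
      obtain ⟨v, rfl⟩ := chartD_surjective (htgt x hx) v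
      obtain ⟨w, rfl⟩ := chartD_surjective (htgt x hx) w
      refine Eq.trans ?_ (ip_chartD g φ x v w).symm
      rw [diff_comp_chart (htgt x hx) (hΨ.smooth x (heΩ hx)),
        diff_comp_chart (htgt x hx) (hΨ.smooth x (heΩ hx))]
      simp only [form_add_left, form_add_right, form_smul_left, form_smul_right,
        hΨ.isom x (heΩ hx), Fin.sum_univ_two]
      ring
    -- Composed with the continuous map L, the immersion becomes a local homeomorphism restricted to
    -- its source, which is an embedding.
    · refine Topology.IsEmbedding.of_comp (g := L)
        (continuousOn_iff_continuous_domRestrict.1 hcont.continuousOn) hL ?_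
      have : L ∘ U.domRestrict (Ψ ∘ φ) = (φ.trans e).source.domRestrict (φ.trans e) := by
        ext1 q
        exact (heL _).symm
      rw [this]
      exact (φ.trans e).isEmbedding_restrict
  have hη : IsUnitNormalOn c (Ψ ∘ φ) (N ∘ φ) U := by
    refine ⟨?_, ?_, ?_, ?_⟩
    · intro q hq
      obtain ⟨x, hx, rfl⟩ := hx q hq
      exact (hsm' x hx).contMDiffWithinAt
    · intro q hq
      obtain ⟨x, hx, rfl⟩ := hx q hq
      simp only [Function.comp, hinv x hx]
      exact hΨ.tangent x (heΩ hx)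
    · intro q hq v
      obtain ⟨x, hx, rfl⟩ := hx q hq
      obtain ⟨v, rfl⟩ := chartD_surjective (htgt x hx) v
      rw [diff_comp_chart (htgt x hx) (hΨ.smooth x (heΩ hx)), Function.comp, hinv x hx,
        form_add_right, form_smul_right, form_smul_right, hΨ.normal x (heΩ hx),
        hΨ.normal x (heΩ hx)]
      ring
    · intro q hq
      obtain ⟨x, hx, rfl⟩ := hx q hq
      simp only [Function.comp, hinv x hx]
      exact hΨ.unit x (heΩ hx)
  have hm : ∀ x ∈ e.source, meanCurvature g c (Ψ ∘ φ) (N ∘ φ) (φ.symm x) = f x := by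
    intro x hx
    rw [meanCurvature_eq hUo hψ hη (hmem x hx),
      coordMeanCurvature_congr (comp_chart_symm_eventuallyEq Ψ (htgt x hx))
        (comp_chart_symm_eventuallyEq N (htgt x hx)), (hf x (heΩ hx)).1]
  refine ⟨U, hUo, ?_, Ψ ∘ φ, N ∘ φ, hψ, hη, ?_, ?_⟩
  · rw [hUe]
    exact ⟨mem_chart_source E2 p, hpe⟩
  · intro q hq
    obtain ⟨x, hx, rfl⟩ := hx q hq
    refine (divTensor_eq_zero_iff hUo hψ hη (hmem x hx)).1 fun k => ?_
    rw [biconsForm_congr (comp_chart_symm_eventuallyEq Ψ (htgt x hx))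
      (comp_chart_symm_eventuallyEq N (htgt x hx)), (hf x (heΩ hx)).2]
  · intro q hq
    obtain ⟨x, hx, rfl⟩ := hx q hq
    have hxΩ := hsub (heΩ hx)
    have em : meanCurvature g c (Ψ ∘ φ) (N ∘ φ) ∘ φ.symm =ᶠ[𝓝 x] f := by
      filter_upwards [e.open_source.mem_nhds hx] with y hy using hm y hy
    refine ⟨by rw [hm x hx]; exact hS.pos x hxΩ, ?_⟩
    rw [gradE_ne_zero_iff (htgt x hx) ((hS.smooth x hxΩ).congr_of_eventuallyEq em),
      partialD_congr em, partialD_congr em, hS.partialD_eq x hxΩ, hS.partialD_eq x hxΩ]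
    have hs := (hS.speed_pos x hxΩ).ne'
    have hD := hS.coframe.area_ne_zero hS.metric hxΩ
    -- If both partial derivatives vanished, so would θ⁰ and with it the area density.
    by_contra h0
    push Not at h0
    apply hD
    rw [area, (mul_eq_zero.1 h0.1).resolve_left hs, (mul_eq_zero.1 h0.2).resolve_left hs]
    ring

end Manifold

end Bicons

end

theorem mainTheorem1 {M : Type*} [TopologicalSpace M] [T2Space M] [SecondCountableTopology M]
    [ChartedSpace Bicons.E2 M] [IsManifold (𝓡 2) ∞ M]
    (g : Bicons.SurfaceMetric M) (c : ℝ) :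
    Bicons.LocallyEmbedsBiconservatively g c ↔
      (∀ p : M, 0 < c - Bicons.gaussCurvature g p) ∧
      (∀ p : M, Bicons.grad g (Bicons.gaussCurvature g) p ≠ 0) ∧
      Bicons.LevelCurvesAreCircles g (Bicons.gaussCurvature g)
        (fun p => 3 * Bicons.gnorm g (Bicons.grad g (Bicons.gaussCurvature g) p) /
          (8 * (c - Bicons.gaussCurvature g p))) :=
  ⟨fun h => ⟨fun p => (h.isSpecialAt p).pos, fun p => (h.isSpecialAt p).gradE_ne_zero,
    Bicons.levelCurvesAreCircles_of_isSpecialAt h.isSpecialAt⟩,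
  fun ⟨hK, hd, hL⟩ p =>
    (Bicons.isSpecialAt_of_levelCurvesAreCircles hK hd hL p).exists_embedding⟩
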